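/- Let $\mathbf k$ be a nonzero commutative unitary ring containing $\mathbb Q$, let $\mathbb P=\{1,2,\dots\}$, $\mathbb N=\{0,1,2,\dots\}$ and let $X=\{x_i : i\in\mathbb P\}$ be commuting variables. A *weak composition* is a finite (possibly empty) list $\alpha=(\alpha_1,\dots,\alpha_k)$ of nonnegative integers; it is *left weak* if it is empty or $\alpha_k>0$. **Quasi-shuffle algebra.** For a commutative additive semigroup $A$, $QS(A)$ is the free $\mathbf k$-module on the words in $A$, with the empty word as unit and the product determined by $$(a,u)*(b,v)=(a,\,u*(b,v))+(b,\,(a,u)*v)+(a+b,\,u*v)\qquad(a,b\in A,\ u,v \text{ words}).$$ With the deconcatenation coproduct $\Delta(a_1,\dots,a_m)=\sum_{i=0}^m(a_1,\dots,a_i)\otimes(a_{i+1},\dots,a_m)$ and the counit $\epsilon(w)=\delta_{w,\emptyset}$ it is a Hopf algebra. The weak compositions are a basis of $QS(\mathbb N)$. **Left weak quasisymmetric functions.** $LWQSym\subseteq\mathbf k[[X]]$ is the $\mathbf k$-span of the series $\sum_{i_1<\dots<i_k}x_{i_1}^{\alpha_1}\cdots x_{i_k}^{\alpha_k}$ with $\alpha$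 left weak, the empty composition giving $1$. **Renormalized functions.** For a word $w=\binom{\alpha}{\beta}$, $\alpha\in\mathbb N^k$, $\beta\in\mathbb P^k$, let $\phi(w)\in\mathbb Q[[X]][t][z^{-1},z]]$ be the Laurent expansion at $z=0$ of $$\sum_{0<i_1<\dots<i_k}x_{i_1}^{\alpha_1}\cdots x_{i_k}^{\alpha_k}\,e^{(i_1+t)\beta_1z}\cdots e^{(i_k+t)\beta_kz}\qquad(t\ge0,\ \operatorname{Re}z<0),$$ that is, the Laurent series such that for every monomial in $X$ and every real $t\ge 0$ the coefficient of that monomial in the sum is a convergent series with the corresponding Laurent expansion, for all $z$ near $0$ with $\operatorname{Re}z<0$. Let $P$ be the projection of a Laurent series to its part with negative powers of $z$. Put $\phi_\pm(\emptyset)=1$ and, for $k\ge1$, $$\bar\phi(w)=\phi(w)+\sum_{w=w'w'',\ w',w''\neq\emptyset}\phi(w')\,\phi_-(w''),\qquad \phi_-(w)=-P(\bar\phi(w)),\qquad \phi_+(w)=(\mathrm{id}-P)(\bar\phi(w)).$$ Fix $\delta\in\mathbb P$. The renormalized monomial quasisymmetric function of a weak composition $\alpha$ of length $k$ is $M_\alpha:=\phi_+\binom{\alpha}{\delta^k}\big|_{z=0}\in\mathbb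 Q[[X]][t]$, $\delta^k=(\delta,\dots,\delta)$, regarded as an element of $\mathbf k[[X]][t]$, and $RenQSym\subseteq\mathbf k[[X]][t]$ is the $\mathbf k$-span of all $M_\alpha$. **Theorem.** The Laurent series $\phi(w)$ exists and is unique for every $w$, and $M_\alpha$ does not depend on $\delta$. Moreover: 1. The family $(M_\alpha)$, indexed by all weak compositions $\alpha$, is a $\mathbf k$-basis of $RenQSym$. 2. $LWQSym$ is a subalgebra of $\mathbf k[[X]]$, $RenQSym$ is a subalgebra of $\mathbf k[[X]][t]$, $RenQSym=LWQSym[t]$, and there is an isomorphism of $\mathbf k$-algebras $f\colon QS(\mathbb N)\to RenQSym=LWQSym[t]$ with $f(\alpha)=M_\alpha$ for every weak composition $\alpha$. There is a Hopf algebra structure on the algebra $RenQSym$ for which $f$ is an isomorphism of Hopf algebras. -/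

import Mathlib

open scoped TensorProduct

/-! ### The quasi-shuffle Hopf algebra -/

/-- The quasi-shuffle Hopf algebra `QS(A)` on an additive commutative semigroup `A`. The underlying
module is `k⟨A⟩ = ⨁ₙ k Aⁿ`, the free module on the words in `A`. -/
def QS (k : Type*) (A : Type*) [CommRing k] : Type _ := List A →₀ k

namespace QS

variable {k : Type*} {A : Type*} [CommRing k]

noncomputable instance : AddCommGroup (QS k A) := inferInstanceAs (AddCommGroup (List A →₀ k))

noncomputable instance : Module k (QS k A) := inferInstanceAs (Module k (List A →₀ k))

/-- The basis of words. -/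
noncomputable def basis (k : Type*) (A : Type*) [CommRing k] : Module.Basis (List A) k (QS k A) :=
  Finsupp.basisSingleOne

/-- The word `w` as an element of `QS(A)`. -/
noncomputable def of (k : Type*) {A : Type*} [CommRing k] (w : List A) : QS k A := basis k A w

/-- The linear map that puts the letter `a` in front of each word. -/
noncomputable def cons (a : A) : QS k A →ₗ[k] QS k A :=
  (basis k A).constr k fun w => of k (a :: w)

/-- The quasi-shuffle product of two words. -/
noncomputable def wordMul (k : Type*) {A : Type*} [CommRing k] [Add A] : List A → List A → QS k A
  | [], v => of k v
  | a :: u, [] => of k (a :: u)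
  | a :: u, b :: v =>
      cons a (wordMul k u (b :: v)) + cons b (wordMul k (a :: u) v) + cons (a + b) (wordMul k u v)
  termination_by u v => u.length + v.length

/-- The quasi-shuffle product, extended bilinearly. -/
noncomputable def mulHom (k : Type*) (A : Type*) [CommRing k] [Add A] :
    QS k A →ₗ[k] QS k A →ₗ[k] QS k A :=
  (basis k A).constr k fun u => (basis k A).constr k fun v => wordMul k u v

/-- The deconcatenation coproduct. -/
noncomputable def comulHom (k : Type*) (A : Type*) [CommRing k] :
    QS k A →ₗ[k] QS k A ⊗[k] QS k A :=
  (basis k A).constr k fun w =>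
    ∑ i ∈ Finset.range (w.length + 1), of k (w.take i) ⊗ₜ[k] of k (w.drop i)

/-- The counit: `1` on the empty word and `0` on all other words. -/
noncomputable def counitHom (k : Type*) (A : Type*) [CommRing k] : QS k A →ₗ[k] k :=
  (basis k A).constr k fun w => if w = [] then 1 else 0

theorem cons_of (a : A) (w : List A) : cons a (of k w) = of k (a :: w) :=
  (basis k A).constr_basis k _ w

theorem comulHom_nil : comulHom k A (of k []) = of k [] ⊗ₜ[k] of k [] := by
  rw [comulHom, of, Module.Basis.constr_basis]; simp [of]

theorem comulHom_cons (a : A) (x : QS k A) :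
    comulHom k A (cons a x) = of k [] ⊗ₜ[k] cons a x + (cons a).rTensor _ (comulHom k A x) := by
  suffices h : comulHom k A ∘ₗ cons a = TensorProduct.mk k _ _ (of k []) ∘ₗ cons a +
      (cons a).rTensor _ ∘ₗ comulHom k A from LinearMap.congr_fun h x
  refine (basis k A).ext fun w => ?_
  change comulHom k A (cons a (of k w)) = of k [] ⊗ₜ[k] cons a (of k w) +
    (cons a).rTensor _ (comulHom k A (of k w))
  rw [cons_of]
  conv_lhs => rw [comulHom, of, Module.Basis.constr_basis]
  rw [comulHom]
  conv_rhs => rw [of.eq_1 k w, Module.Basis.constr_basis]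
  rw [List.length_cons, Finset.sum_range_succ']
  simp only [map_sum, LinearMap.rTensor_tmul, cons_of, List.take_succ_cons, List.drop_succ_cons,
    List.take_zero, List.drop_zero]
  rw [add_comm]

theorem counitHom_nil : counitHom k A (of k []) = 1 := by
  rw [counitHom, of, Module.Basis.constr_basis]; simp

theorem counitHom_cons (a : A) (x : QS k A) : counitHom k A (cons a x) = 0 := by
  suffices h : counitHom k A ∘ₗ cons a = 0 from LinearMap.congr_fun h x
  refine (basis k A).ext fun w => ?_
  change counitHom k A (cons a (of k w)) = 0
  rw [cons_of, counitHom, of, Module.Basis.constr_basis]; simp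

theorem ind {p : QS k A → Prop} (h0 : p 0) (hadd : ∀ x y, p x → p y → p (x + y))
    (hsmul : ∀ (c : k) x, p x → p (c • x)) (hof : ∀ w, p (of k w)) (x : QS k A) : p x := by
  have hx : x ∈ Submodule.span k (Set.range (basis k A)) := by
    rw [(basis k A).span_eq]; trivial
  induction hx using Submodule.span_induction with
  | mem x hx => obtain ⟨w, rfl⟩ := hx; exact hof w
  | zero => exact h0
  | add x y _ _ hx hy => exact hadd x y hx hy
  | smul c x _ hx => exact hsmul c x hx

section Mul
variable [Add A]

theorem mulHom_of (u v : List A) : mulHom k A (of k u) (of k v) = wordMul k u v := by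
  rw [mulHom, of, of, Module.Basis.constr_basis, Module.Basis.constr_basis]

theorem mulHom_nil_left (x : QS k A) : mulHom k A (of k []) x = x := by
  suffices h : mulHom k A (of k []) = LinearMap.id from LinearMap.congr_fun h x
  refine (basis k A).ext fun w => ?_
  change mulHom k A (of k []) (of k w) = of k w
  rw [mulHom_of, wordMul]

theorem mulHom_nil_right (x : QS k A) : mulHom k A x (of k []) = x := by
  suffices h : (mulHom k A).flip (of k []) = LinearMap.id from LinearMap.congr_fun h x
  refine (basis k A).ext fun w => ?_
  change mulHom k A (of k w) (of k []) = of k w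
  rw [mulHom_of]; cases w <;> rw [wordMul]

theorem mulHom_cons_cons (a b : A) (x y : QS k A) :
    mulHom k A (cons a x) (cons b y) = cons a (mulHom k A x (cons b y)) +
      cons b (mulHom k A (cons a x) y) + cons (a + b) (mulHom k A x y) := by
  induction x using ind with
  | h0 => simp
  | hadd x x' h h' => simp only [map_add, LinearMap.add_apply, h, h']; abel
  | hsmul c x h => simp only [map_smul, LinearMap.smul_apply, h, smul_add]
  | hof u =>
    induction y using ind with
    | h0 => simp
    | hadd x x' h h' => simp only [map_add, h, h']; abel
    | hsmul c x h => simp only [map_smul, h, smul_add]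
    | hof v => simp only [cons_of, mulHom_of]; rw [wordMul]


end Mul

section Ring
variable [AddCommSemigroup A]

theorem mulHom_comm (x y : QS k A) : mulHom k A x y = mulHom k A y x := by
  induction x using ind with
  | h0 => simp
  | hadd x x' h h' => simp only [map_add, LinearMap.add_apply, h, h']
  | hsmul c x h => simp only [map_smul, LinearMap.smul_apply, h]
  | hof u =>
    induction y using ind with
    | h0 => simp
    | hadd x x' h h' => simp only [map_add, LinearMap.add_apply, h, h']
    | hsmul c x h => simp only [map_smul, LinearMap.smul_apply, h]
    | hof v =>
      induction u generalizing v with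
      | nil => rw [mulHom_nil_left, mulHom_nil_right]
      | cons a u ihu =>
        induction v with
        | nil => rw [mulHom_nil_left, mulHom_nil_right]
        | cons b v ihv =>
          have h1 := ihu (b :: v)
          have h2 := ihu v
          simp only [← cons_of (k := k)] at h1 h2 ihv ⊢
          rw [mulHom_cons_cons, mulHom_cons_cons, h1, h2, ihv, add_comm b a]
          abel

theorem mulHom_assoc_step (a b c : A) (x y z : QS k A)
    (h1 : mulHom k A (mulHom k A x (cons b y)) (cons c z) =
      mulHom k A x (mulHom k A (cons b y) (cons c z)))
    (h2 : mulHom k A (mulHom k A (cons a x) y) (cons c z) =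
      mulHom k A (cons a x) (mulHom k A y (cons c z)))
    (h3 : mulHom k A (mulHom k A x y) (cons c z) = mulHom k A x (mulHom k A y (cons c z)))
    (h4 : mulHom k A (mulHom k A x (cons b y)) z = mulHom k A x (mulHom k A (cons b y) z))
    (h5 : mulHom k A (mulHom k A (cons a x) y) z = mulHom k A (cons a x) (mulHom k A y z))
    (h6 : mulHom k A (mulHom k A x y) z = mulHom k A x (mulHom k A y z))
    (h7 : mulHom k A (mulHom k A (cons a x) (cons b y)) z =
      mulHom k A (cons a x) (mulHom k A (cons b y) z)) :
    mulHom k A (mulHom k A (cons a x) (cons b y)) (cons c z) =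
      mulHom k A (cons a x) (mulHom k A (cons b y) (cons c z)) := by
  simp only [mulHom_cons_cons, map_add, LinearMap.add_apply, add_assoc a b c] at h1 h7 ⊢
  rw [h1, h2, h3, h4, h5, h6, ← h7]
  simp only [map_add]
  abel

theorem mulHom_assoc (x y z : QS k A) :
    mulHom k A (mulHom k A x y) z = mulHom k A x (mulHom k A y z) := by
  induction x using ind with
  | h0 => simp
  | hadd x x' h h' => simp only [map_add, LinearMap.add_apply, h, h']
  | hsmul c x h => simp only [map_smul, LinearMap.smul_apply, h]
  | hof u =>
    induction y using ind with
    | h0 => simp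
    | hadd x x' h h' => simp only [map_add, LinearMap.add_apply, h, h']
    | hsmul c x h => simp only [map_smul, LinearMap.smul_apply, h]
    | hof v =>
      induction z using ind with
      | h0 => simp
      | hadd x x' h h' => simp only [map_add, h, h']
      | hsmul c x h => simp only [map_smul, h]
      | hof w =>
        induction u generalizing v w with
        | nil => simp only [mulHom_nil_left]
        | cons a u ihu =>
          induction v generalizing w with
          | nil => simp only [mulHom_nil_left, mulHom_nil_right]
          | cons b v ihv =>
            induction w with
            | nil => simp only [mulHom_nil_right]
            | cons c w ihw =>
              have h1 := ihu (b :: v) (c :: w)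
              have h2 := ihv (c :: w)
              have h3 := ihu v (c :: w)
              have h4 := ihu (b :: v) w
              have h5 := ihv w
              have h6 := ihu v w
              simp only [← cons_of (k := k)] at h1 h2 h3 h4 h5 h6 ihw ⊢
              exact mulHom_assoc_step a b c _ _ _ h1 h2 h3 h4 h5 h6 ihw

noncomputable instance : CommRing (QS k A) :=
  { (inferInstance : AddCommGroup (QS k A)) with
    mul := fun x y => mulHom k A x y
    one := of k []
    left_distrib := fun x y z => map_add (mulHom k A x) y z
    right_distrib := fun x y z => LinearMap.map_add₂ (mulHom k A) x y z
    zero_mul := fun x => LinearMap.map_zero₂ (mulHom k A) x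
    mul_zero := fun x => map_zero (mulHom k A x)
    mul_assoc := mulHom_assoc
    one_mul := mulHom_nil_left
    mul_one := mulHom_nil_right
    mul_comm := mulHom_comm }

theorem mul_def (x y : QS k A) : x * y = mulHom k A x y := rfl

theorem one_def : (1 : QS k A) = of k [] := rfl

/-- The algebra `QS(A)`: the unit is the empty word, the product is the quasi-shuffle product. -/
noncomputable instance : Algebra k (QS k A) :=
  Algebra.ofModule (fun c x y => LinearMap.map_smul₂ (mulHom k A) c x y)
    (fun c x y => map_smul (mulHom k A x) c y)

theorem cons_mul_cons (a b : A) (x y : QS k A) :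
    cons a x * cons b y =
      cons a (x * cons b y) + cons b (cons a x * y) + cons (a + b) (x * y) :=
  mulHom_cons_cons a b x y

theorem rTensor_mul (a b : A) (p q : QS k A ⊗[k] QS k A) :
    (cons a).rTensor _ p * (cons b).rTensor _ q =
      (cons a).rTensor _ (p * (cons b).rTensor _ q) +
      (cons b).rTensor _ ((cons a).rTensor _ p * q) + (cons (a + b)).rTensor _ (p * q) := by
  induction p using TensorProduct.induction_on with
  | zero => simp
  | add p p' h h' => simp only [map_add, add_mul, h, h']; abel
  | tmul x x' =>
    induction q using TensorProduct.induction_on with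
    | zero => simp
    | add p p' h h' => simp only [map_add, mul_add, h, h']; abel
    | tmul y y' =>
      simp only [LinearMap.rTensor_tmul, Algebra.TensorProduct.tmul_mul_tmul, cons_mul_cons,
        TensorProduct.add_tmul]

theorem rTensor_mul_one_tmul (a : A) (p : QS k A ⊗[k] QS k A) (y : QS k A) :
    (cons a).rTensor _ p * (1 ⊗ₜ[k] y) = (cons a).rTensor _ (p * (1 ⊗ₜ[k] y)) := by
  induction p using TensorProduct.induction_on with
  | zero => simp
  | add p p' h h' => simp only [map_add, add_mul, h, h']
  | tmul x x' => simp

theorem comulHom_cons' (a : A) (x : QS k A) :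
    comulHom k A (cons a x) = 1 ⊗ₜ[k] cons a x + (cons a).rTensor _ (comulHom k A x) :=
  comulHom_cons a x

theorem comulHom_one : comulHom k A 1 = 1 := comulHom_nil

theorem comulHom_mul (x y : QS k A) : comulHom k A (x * y) = comulHom k A x * comulHom k A y := by
  induction x using ind with
  | h0 => simp
  | hadd x x' h h' => simp only [map_add, add_mul, h, h']
  | hsmul c x h => simp only [map_smul, smul_mul_assoc, h]
  | hof u =>
    induction y using ind with
    | h0 => simp
    | hadd x x' h h' => simp only [map_add, mul_add, h, h']
    | hsmul c x h => simp only [map_smul, mul_smul_comm, h]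
    | hof v =>
      induction u generalizing v with
      | nil => rw [← one_def, comulHom_one, one_mul, one_mul]
      | cons a u ihu =>
        induction v with
        | nil => rw [← one_def, comulHom_one, mul_one, mul_one]
        | cons b v ihv =>
          have h1 := ihu (b :: v)
          have h2 := ihu v
          simp only [← cons_of (k := k)] at h1 h2 ihv ⊢
          rw [cons_mul_cons, map_add, map_add, comulHom_cons', comulHom_cons', comulHom_cons',
            h1, h2, ihv, comulHom_cons', comulHom_cons']
          simp only [add_mul, mul_add, map_add, rTensor_mul, rTensor_mul_one_tmul,
            Algebra.TensorProduct.tmul_mul_tmul, one_mul, cons_mul_cons, TensorProduct.tmul_add]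
          rw [mul_comm (1 ⊗ₜ[k] cons a (of k u)) ((cons b).rTensor _ _), rTensor_mul_one_tmul,
            mul_comm (comulHom k A (of k v))]
          abel

theorem counitHom_one : counitHom k A 1 = 1 := counitHom_nil

theorem counitHom_mul (x y : QS k A) :
    counitHom k A (x * y) = counitHom k A x * counitHom k A y := by
  induction x using ind with
  | h0 => simp
  | hadd x x' h h' => simp only [map_add, add_mul, h, h']
  | hsmul c x h => simp only [map_smul, smul_mul_assoc, h]
  | hof u =>
    induction y using ind with
    | h0 => simp
    | hadd x x' h h' => simp only [map_add, mul_add, h, h']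
    | hsmul c x h => simp only [map_smul, mul_smul_comm, h]
    | hof v =>
      cases u with
      | nil => rw [← one_def, counitHom_one, one_mul, one_mul]
      | cons a u =>
        cases v with
        | nil => rw [← one_def, counitHom_one, mul_one, mul_one]
        | cons b v =>
          simp only [← cons_of (k := k)]
          rw [cons_mul_cons, map_add, map_add]
          simp only [counitHom_cons, add_zero, zero_mul]

theorem assoc_rTensor (a : A) (r : QS k A ⊗[k] QS k A) (y : QS k A) :
    TensorProduct.assoc k _ _ _ ((cons a).rTensor _ r ⊗ₜ[k] y) =
      (cons a).rTensor _ (TensorProduct.assoc k _ _ _ (r ⊗ₜ[k] y)) := by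
  induction r using TensorProduct.induction_on with
  | zero => rw [LinearMap.map_zero, TensorProduct.zero_tmul, LinearEquiv.map_zero,
      LinearMap.map_zero]
  | add p p' h h' => rw [LinearMap.map_add, TensorProduct.add_tmul, LinearEquiv.map_add, h, h',
      TensorProduct.add_tmul, LinearEquiv.map_add, LinearMap.map_add]
  | tmul x z => rfl

theorem coassoc_aux (a : A) (q : QS k A ⊗[k] QS k A) :
    TensorProduct.assoc k _ _ _ ((comulHom k A).rTensor _ ((cons a).rTensor _ q)) =
      1 ⊗ₜ[k] (cons a).rTensor _ q +
      (cons a).rTensor _ (TensorProduct.assoc k _ _ _ ((comulHom k A).rTensor _ q)) := by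
  induction q using TensorProduct.induction_on with
  | zero => simp only [LinearMap.map_zero, LinearEquiv.map_zero, TensorProduct.tmul_zero, add_zero]
  | add p p' h h' =>
    simp only [LinearMap.map_add, LinearEquiv.map_add, TensorProduct.tmul_add, h, h']; abel
  | tmul x y =>
    simp only [LinearMap.rTensor_tmul, comulHom_cons', TensorProduct.add_tmul, LinearEquiv.map_add,
      TensorProduct.assoc_tmul, assoc_rTensor]

theorem lTensor_rTensor_comm (a : A) (q : QS k A ⊗[k] QS k A) :
    (comulHom k A).lTensor _ ((cons a).rTensor _ q) =
      (cons a).rTensor _ ((comulHom k A).lTensor _ q) := by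
  rw [← LinearMap.comp_apply, LinearMap.lTensor_comp_rTensor, ← LinearMap.rTensor_comp_lTensor,
    LinearMap.comp_apply]

theorem coassoc' (x : QS k A) :
    TensorProduct.assoc k _ _ _ ((comulHom k A).rTensor _ (comulHom k A x)) =
      (comulHom k A).lTensor _ (comulHom k A x) := by
  induction x using ind with
  | h0 => simp
  | hadd x x' h h' => simp only [map_add, h, h']
  | hsmul c x h => simp only [map_smul, h]
  | hof w =>
    induction w with
    | nil => simp [comulHom_nil]
    | cons a w ih =>
      rw [← cons_of, comulHom_cons', LinearMap.map_add, LinearEquiv.map_add, coassoc_aux, ih,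
        LinearMap.map_add, LinearMap.rTensor_tmul, LinearMap.lTensor_tmul, comulHom_one,
        comulHom_cons', TensorProduct.tmul_add, lTensor_rTensor_comm, Algebra.TensorProduct.one_def,
        TensorProduct.assoc_tmul, add_assoc]

/-- The deconcatenation coalgebra structure. -/
noncomputable instance : Coalgebra k (QS k A) where
  comul := comulHom k A
  counit := counitHom k A
  coassoc := LinearMap.ext coassoc'
  rTensor_counit_comp_comul := by
    refine (basis k A).ext fun w => ?_
    change (counitHom k A).rTensor _ (comulHom k A (of k w)) = 1 ⊗ₜ[k] of k w
    cases w with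
    | nil => simp [comulHom_nil, counitHom_nil]
    | cons a w =>
      rw [← cons_of, comulHom_cons', map_add, LinearMap.rTensor_tmul, counitHom_one,
        ← LinearMap.comp_apply, ← LinearMap.rTensor_comp]
      have : counitHom k A ∘ₗ cons a = 0 := LinearMap.ext (counitHom_cons a)
      rw [this]; simp
  lTensor_counit_comp_comul := by
    refine (basis k A).ext fun w => ?_
    change (counitHom k A).lTensor _ (comulHom k A (of k w)) = of k w ⊗ₜ[k] 1
    induction w with
    | nil => simp [comulHom_nil, counitHom_nil]
    | cons a w ih =>
      rw [← cons_of, comulHom_cons', map_add, LinearMap.lTensor_tmul, counitHom_cons,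
        TensorProduct.tmul_zero, zero_add, ← LinearMap.comp_apply (LinearMap.lTensor _ _),
        LinearMap.lTensor_comp_rTensor, ← LinearMap.rTensor_comp_lTensor, LinearMap.comp_apply, ih,
        LinearMap.rTensor_tmul]

noncomputable instance : Bialgebra k (QS k A) :=
  Bialgebra.mk' k (QS k A) counitHom_one (counitHom_mul _ _) comulHom_one (comulHom_mul _ _)

/-- Left antipode on words, by recursion on prefixes. -/
noncomputable def antiL (k : Type*) {A : Type*} [CommRing k] [AddCommSemigroup A] :
    List A → QS k A
  | [] => 1
  | a :: w => -∑ i : Fin (w.length + 1),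
      antiL k ((a :: w).take i) * of k ((a :: w).drop i)
  termination_by w => w.length
  decreasing_by simp; omega

/-- Right antipode on words, by recursion on suffixes. -/
noncomputable def antiR (k : Type*) {A : Type*} [CommRing k] [AddCommSemigroup A] :
    List A → QS k A
  | [] => 1
  | a :: w => -∑ i : Fin (w.length + 1),
      of k ((a :: w).take (i + 1)) * antiR k ((a :: w).drop (i + 1))
  termination_by w => w.length
  decreasing_by simp

noncomputable def antipodeL (k : Type*) (A : Type*) [CommRing k] [AddCommSemigroup A] :
    QS k A →ₗ[k] QS k A := (basis k A).constr k (antiL k)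

noncomputable def antipodeR (k : Type*) (A : Type*) [CommRing k] [AddCommSemigroup A] :
    QS k A →ₗ[k] QS k A := (basis k A).constr k (antiR k)

theorem antipodeL_of (w : List A) : antipodeL k A (of k w) = antiL k w :=
  (basis k A).constr_basis k _ w

theorem antipodeR_of (w : List A) : antipodeR k A (of k w) = antiR k w :=
  (basis k A).constr_basis k _ w

theorem comul_of (w : List A) : Coalgebra.comul (R := k) (of k w) =
    ∑ i ∈ Finset.range (w.length + 1), of k (w.take i) ⊗ₜ[k] of k (w.drop i) :=
  (basis k A).constr_basis k _ w

theorem counit_of (w : List A) :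
    Coalgebra.counit (R := k) (of k w) = if w = [] then (1 : k) else 0 :=
  (basis k A).constr_basis k _ w

theorem antipodeL_spec : LinearMap.mul' k (QS k A) ∘ₗ (antipodeL k A).rTensor _ ∘ₗ Coalgebra.comul =
    Algebra.linearMap k (QS k A) ∘ₗ Coalgebra.counit := by
  refine (basis k A).ext fun w => ?_
  change LinearMap.mul' k (QS k A) ((antipodeL k A).rTensor _ (Coalgebra.comul (of k w))) =
    algebraMap k (QS k A) (Coalgebra.counit (of k w))
  rw [comul_of, counit_of]
  simp only [map_sum, LinearMap.rTensor_tmul, LinearMap.mul'_apply, antipodeL_of]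
  cases w with
  | nil => simp [antiL, ← one_def]
  | cons a w =>
    rw [List.length_cons, Finset.sum_range_succ, ← List.length_cons (a := a), List.take_length,
      List.drop_length, ← one_def, mul_one, antiL, Finset.sum_range]
    simp

theorem antipodeR_spec : LinearMap.mul' k (QS k A) ∘ₗ (antipodeR k A).lTensor _ ∘ₗ Coalgebra.comul =
    Algebra.linearMap k (QS k A) ∘ₗ Coalgebra.counit := by
  refine (basis k A).ext fun w => ?_
  change LinearMap.mul' k (QS k A) ((antipodeR k A).lTensor _ (Coalgebra.comul (of k w))) =
    algebraMap k (QS k A) (Coalgebra.counit (of k w))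
  rw [comul_of, counit_of]
  simp only [map_sum, LinearMap.lTensor_tmul, LinearMap.mul'_apply, antipodeR_of]
  cases w with
  | nil => simp [antiR.eq_1, ← one_def]
  | cons a w =>
    rw [List.length_cons, Finset.sum_range_succ', List.take_zero,
      List.drop_zero, ← one_def, one_mul, antiR.eq_2, Finset.sum_range]
    simp

theorem antipodeL_eq_antipodeR : antipodeL k A = antipodeR k A := by
  have h := left_inv_eq_right_inv (a := WithConv.toConv (LinearMap.id (R := k) (M := QS k A)))
    (b := WithConv.toConv (antipodeL k A)) (c := WithConv.toConv (antipodeR k A))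
    (congrArg WithConv.toConv antipodeL_spec) (congrArg WithConv.toConv antipodeR_spec)
  exact WithConv.toConv_injective h

/-- The Hopf algebra `QS(A)`; its antipode is the convolution inverse of the identity. -/
noncomputable instance : HopfAlgebra k (QS k A) where
  antipode := antipodeL k A
  mul_antipode_rTensor_comul := antipodeL_spec
  mul_antipode_lTensor_comul := antipodeL_eq_antipodeR (k := k) (A := A) ▸ antipodeR_spec

end Ring
end QS

/-- The algebra isomorphism `f` onto a Hopf algebra `B` is an isomorphism of Hopf algebras. (A
bijective bialgebra map automatically commutes with the antipodes.) -/
def IsHopfIso (k : Type*) {A B : Type*} [CommRing k] [Ring A] [HopfAlgebra k A] [Ring B]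
    [HopfAlgebra k B] (f : A → B) : Prop :=
  ∃ g : A ≃ₐc[k] B, ∀ x, g x = f x

/-! ### Power series in `x₁, x₂, …` -/

/-- The exponent of the monomial `x_{i₁}^{a₁} ⋯ x_{iₙ}^{aₙ}`. -/
noncomputable def xExponent {n : ℕ} (a : Fin n → ℕ) (I : Fin n → ℕ+) : ℕ+ →₀ ℕ :=
  ∑ j, Finsupp.single (I j) (a j)

/-- The sequences `i₁ < ⋯ < iₙ` of positive integers with `x_{i₁}^{a₁} ⋯ x_{iₙ}^{aₙ} = x^m`. -/
def Occurrence {n : ℕ} (a : Fin n → ℕ) (m : ℕ+ →₀ ℕ) : Type :=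
  {I : Fin n → ℕ+ // StrictMono I ∧ xExponent a I = m}

/-- A weak composition (a list of nonnegative integers) is left weak if its last component is
positive; the empty composition is included. -/
def IsLeftWeak (α : List ℕ) : Prop := ∀ a ∈ α.getLast?, 0 < a

/-- The monomial quasisymmetric function `∑_{i₁ < ⋯ < iₙ} x_{i₁}^{α₁} ⋯ x_{iₙ}^{αₙ}`: the
coefficient of `x^m` is the number of summands equal to `x^m`. That number is finite for each `m`
when `α` is left weak, and only such `α` are used. -/
noncomputable def monomialQSym (k : Type*) [CommRing k] (α : List ℕ) : MvPowerSeries ℕ+ k :=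
  fun m => (Nat.card (Occurrence α.get m) : k)

/-- The module of left weak quasisymmetric functions. -/
noncomputable def LWQSym (k : Type*) [CommRing k] : Submodule k (MvPowerSeries ℕ+ k) :=
  Submodule.span k {F | ∃ α, IsLeftWeak α ∧ F = monomialQSym k α}

/-! ### Regularization -/

/-- The ring `k[[X]][t]`. -/
abbrev PowerSeriesT (k : Type*) [CommRing k] : Type _ := Polynomial (MvPowerSeries ℕ+ k)

/-- For `p ∈ ℚ[[X]][t]`, the coefficient of `x^m` in `p`, evaluated at a real number `t`. -/
noncomputable def coeffEval (m : ℕ+ →₀ ℕ) (t : ℝ) (p : PowerSeriesT ℚ) : ℂ :=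
  p.sum fun s F => ((MvPowerSeries.coeff m F : ℚ) : ℂ) * (t : ℂ) ^ s

/-- A weak composition `α` in the direction `β` is the list of the pairs `(αⱼ, βⱼ)`. The Laurent
series `F ∈ ℚ[[X]][t][z⁻¹,z]]` is the expansion at `z = 0` of the regularized sum
`∑_{i₁ < ⋯ < iₙ} ∏ⱼ x_{iⱼ}^{αⱼ} exp((iⱼ + t) βⱼ z)` (for `t ≥ 0` and `Re z < 0`): for each monomial
`x^m` and each `t ≥ 0`, the numerical series that is the coefficient of `x^m` in the sum converges
and equals the Laurent series given by `F`, for all `z` near `0` with `Re z < 0`. -/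
def IsRegularization (w : List (ℕ × ℕ+)) (F : LaurentSeries (PowerSeriesT ℚ)) : Prop :=
  ∀ (m : ℕ+ →₀ ℕ) (t : ℝ), 0 ≤ t → ∀ᶠ z : ℂ in nhdsWithin 0 {z : ℂ | z.re < 0},
    ∃ s : ℂ,
      HasSum (fun I : Occurrence (fun j => (w.get j).1) m =>
        ∏ j, Complex.exp ((((I.1 j : ℕ) : ℂ) + (t : ℂ)) * ((w.get j).2 : ℕ) * z)) s ∧
      HasSum (fun n : ℤ => coeffEval m t (F.coeff n) * z ^ n) s

open Classical in
/-- The regularization map `φ` on words; the value is the unique `F` with `IsRegularization w F`. -/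
noncomputable def regularization (w : List (ℕ × ℕ+)) : LaurentSeries (PowerSeriesT ℚ) :=
  if h : ∃ F, IsRegularization w F then h.choose else 0

/-! ### Algebraic Birkhoff factorization -/

/-- The projection of a Laurent series to its polar part `∑_{n < 0} aₙ zⁿ`. -/
noncomputable def polarPart {R : Type*} [CommRing R] (F : LaurentSeries R) : LaurentSeries R :=
  HahnSeries.truncLT 0 F

/-- The factor `φ₋` of the algebraic Birkhoff factorization of `φ`, on words:
`φ₋(w) = -P(φ(w) + ∑ φ(w') φ₋(w''))`, with the sum over `w = w' w''`, `w'` and `w''` non-empty. -/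
noncomputable def birkhoffMinus : List (ℕ × ℕ+) → LaurentSeries (PowerSeriesT ℚ)
  | [] => 1
  | a :: w => -polarPart (regularization (a :: w) + ∑ i : Fin w.length,
      regularization ((a :: w).take (i + 1)) * birkhoffMinus ((a :: w).drop (i + 1)))
  termination_by w => w.length
  decreasing_by simp

/-- The factor `φ₊` of the algebraic Birkhoff factorization of `φ`, on words:
`φ₊(w) = (id - P)(φ(w) + ∑ φ(w') φ₋(w''))`. -/
noncomputable def birkhoffPlus : List (ℕ × ℕ+) → LaurentSeries (PowerSeriesT ℚ)
  | [] => 1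
  | a :: w =>
    let F := regularization (a :: w) + ∑ i : Fin w.length,
      regularization ((a :: w).take (i + 1)) * birkhoffMinus ((a :: w).drop (i + 1))
    F - polarPart F

/-- The directional quasisymmetric function: `φ₊` at `z = 0`. -/
noncomputable def directionalQSym (w : List (ℕ × ℕ+)) : PowerSeriesT ℚ :=
  (birkhoffPlus w).coeff 0

/-- The renormalized monomial quasisymmetric function `M_α`, computed in the constant direction
`(δ, …, δ)`, as an element of `k[[X]][t]`. -/
noncomputable def renMonomial (k : Type*) [CommRing k] [Algebra ℚ k] (δ : ℕ+) (α : List ℕ) :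
    PowerSeriesT k :=
  (directionalQSym (α.map fun a => (a, δ))).map (MvPowerSeries.map (algebraMap ℚ k))

/-- The module of renormalized quasisymmetric functions. -/
noncomputable def RenQSym (k : Type*) [CommRing k] [Algebra ℚ k] (δ : ℕ+) :
    Submodule k (PowerSeriesT k) :=
  Submodule.span k (Set.range (renMonomial k δ))

/-! Fix a monomial `x^m` in the variables `x₁, …, x_N`. An index beyond `N` can only carry the
exponent 0, so the coefficient of `x^m` in the regularized sum combines a finite part, where letters
are evaluated at the indices `1, …, N` (`prefixSum`), with a tail that lives on words of zeros. The
tail is a nested geometric series: an exponential times factors `Q(b) = e^{bz}/(1 - e^{bz})`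
(`hasSum_zeroTail`), whose Laurent coefficients are Bernoulli numbers. The coefficient of `zⁿ` has
degree at most `n + |w|` in `t`, uniformly in `m`, so the expansions for the separate monomials
assemble into one series (`exists_agreeAt`). Uniqueness is the identity theorem in `z` together with
polynomiality in `t`.

In a constant direction `δ` the tails on the words `0 ⋯ 0` are the elementary symmetric functions of
the geometric progression `e^{(i+t)δz}`, `i > N`. By Newton's identities (`newton_geometric`) the
logarithmic derivative of their generating series is the alternating series of the power sums. Each
power sum has a simple pole whose polar part depends neither on `N` nor on `t`
(`expSeries_mul_geomSeries`). Multiplying by the exponential of minus the polar parts leaves a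
series holomorphic in `z` (`coeff_elementaryTail_mul_counterterm`), and the factor used has purely
polar coefficients in positive degree. Hence it is the negative Birkhoff factor, and `φ₊` is the
convolution of `φ` with it.

At `z = 0` the regularized power sums all become `c = -(N + t + 1/2)`, so the generating series of
the tails becomes `(1 + u)^c` and the tail of `M_α` consists of binomial coefficients
(`coeff_directionalQSym`). The direction has disappeared, and `α ↦ M_α` is multiplicative, because
binomial coefficients define a character and evaluating prefixes preserves characters.

For left weak `α` the tail vanishes and `M_α` is the ordinary monomial function, free of `t`;
moreover `M_(0) = -(t + 1/2)`. Multiplication by the word `(0)` then shows that `M_{β0^j}` has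
degree at most `j` in `t`, with `t^j`-coefficient a unit times the monomial function of `β`
(`renMonomial_append_replicate_spec`). This triangularity gives linear independence, the image is
`LWQSym[t]`, and the Hopf structure is transported along the resulting isomorphism. -/

/-! ### Characters of the quasi-shuffle algebra -/

/-- The words of the quasi-shuffle product of two words, with multiplicity. -/
def quasiShuffle {A : Type*} [Add A] : List A → List A → List (List A)
  | [], v => [v]
  | a :: u, [] => [a :: u]
  | a :: u, b :: v =>
      (quasiShuffle u (b :: v)).map (a :: ·) ++ ((quasiShuffle (a :: u) v).map (b :: ·) ++
        (quasiShuffle u v).map ((a + b) :: ·))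
  termination_by u v => u.length + v.length

theorem QS.cons_sum_of {k A : Type*} [CommRing k] (a : A) (l : List (List A)) :
    QS.cons a ((l.map (QS.of k)).sum) = ((l.map (a :: ·)).map (QS.of k)).sum := by
  induction l with
  | nil => simp
  | cons w l ih =>
    simp only [List.map_cons, List.sum_cons, map_add, ih, QS.cons_of]

theorem QS.wordMul_eq_sum {k A : Type*} [CommRing k] [Add A] (u v : List A) :
    QS.wordMul k u v = ((quasiShuffle u v).map (QS.of k)).sum := by
  fun_induction quasiShuffle u v with
  | case1 v => simp [QS.wordMul]
  | case2 a u => simp [QS.wordMul]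
  | case3 a u b v h1 h2 h3 =>
    rw [QS.wordMul, h1, h2, h3, QS.cons_sum_of, QS.cons_sum_of, QS.cons_sum_of]
    simp only [List.map_append, List.sum_append, add_assoc]

theorem QS.of_mul_of {k A : Type*} [CommRing k] [AddCommSemigroup A] (u v : List A) :
    QS.of k u * QS.of k v = ((quasiShuffle u v).map (QS.of k)).sum := by
  rw [QS.mul_def, QS.mulHom_of, QS.wordMul_eq_sum]

/-- A function on words whose linear extension to the quasi-shuffle algebra is multiplicative. -/
structure IsCharacter {A B : Type*} [Add A] [CommRing B] (τ : List A → B) : Prop where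
  nil : τ [] = 1
  mul : ∀ u v, ((quasiShuffle u v).map τ).sum = τ u * τ v

theorem isCharacter_counit {A B : Type*} [Add A] [CommRing B] :
    IsCharacter (fun w : List A => if w = [] then (1 : B) else 0) where
  nil := by simp
  mul u v := by
    rcases u with _ | ⟨a, u⟩ <;> rcases v with _ | ⟨b, v⟩ <;>
      simp [quasiShuffle, Function.comp_def, List.map_const']

/-- Convolution of a function on words with a function that vanishes on words of length at least
two and sends the empty word to one and the letter `a` to `e a`. -/
def prependLetter {A B : Type*} [CommRing B] (e : A → B) (τ : List A → B) : List A → B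
  | [] => τ []
  | a :: w => τ (a :: w) + e a * τ w

/-- Iterated `prependLetter`: the sum over all ways to evaluate the letters of a prefix of the word
at an increasing sequence of elements of `l`, and the rest of the word by `τ`. -/
def prefixSum {A B : Type*} [CommRing B] (l : List (A → B)) (τ : List A → B) : List A → B :=
  l.foldr prependLetter τ

section prefixSum
variable {A B B' : Type*} [CommRing B] [CommRing B']

@[simp] theorem prefixSum_nil (τ : List A → B) : prefixSum [] τ = τ := rfl

@[simp] theorem prefixSum_cons (e : A → B) (l : List (A → B)) (τ : List A → B) :
    prefixSum (e :: l) τ = prependLetter e (prefixSum l τ) := rfl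

theorem prefixSum_apply_nil (l : List (A → B)) (τ : List A → B) : prefixSum l τ [] = τ [] := by
  induction l with
  | nil => rfl
  | cons e l ih => rw [prefixSum_cons, prependLetter, ih]

theorem prefixSum_congr (l : List (A → B)) {τ τ' : List A → B} (w : List A)
    (h : ∀ v, v <:+ w → τ v = τ' v) : prefixSum l τ w = prefixSum l τ' w := by
  induction l generalizing w with
  | nil => exact h w List.suffix_rfl
  | cons e l ih =>
    cases w with
    | nil => exact ih [] h
    | cons a w =>
      simp only [prefixSum_cons, prependLetter]
      rw [ih _ h, ih w fun v hv => h v (hv.trans (List.suffix_cons a w))]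

theorem map_prefixSum (f : B →+* B') (l : List (A → B)) (τ : List A → B) (w : List A) :
    f (prefixSum l τ w) = prefixSum (l.map fun e a => f (e a)) (fun v => f (τ v)) w := by
  induction l generalizing w with
  | nil => rfl
  | cons e l ih =>
    cases w with
    | nil => exact ih []
    | cons a w => simp only [prefixSum_cons, List.map_cons, prependLetter, map_add, map_mul, ih]

/-- A change of alphabet. -/
theorem prefixSum_map {A' : Type*} (g : A' → A) (l : List (A → B)) (τ : List A → B) (w : List A') :
    prefixSum l τ (w.map g) = prefixSum (l.map fun e a => e (g a)) (fun v => τ (v.map g)) w := by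
  induction l generalizing w with
  | nil => rfl
  | cons e l ih =>
    cases w with
    | nil => exact ih []
    | cons a w =>
      have h := ih (a :: w)
      simp only [List.map_cons] at h
      simp only [prefixSum_cons, List.map_cons, prependLetter, ih, h]

/-- The words of the quasi-shuffle start with `a`, `b` or `a + b`, and evaluating that first letter
contributes `e a`, `e b` and `e a * e b` times products of values of `τ`. These are the three cross
terms of the product of `τ (a :: u) + e a * τ u` and `τ (b :: v) + e b * τ v`. -/
theorem IsCharacter.prependLetter [Add A] {e : A → B} (he : ∀ a b, e (a + b) = e a * e b)
    {τ : List A → B} (hτ : IsCharacter τ) : IsCharacter (prependLetter e τ) where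
  nil := hτ.nil
  mul u v := by
    have key (a : A) (l : List (List A)) : ((l.map (a :: ·)).map (_root_.prependLetter e τ)).sum =
        ((l.map (a :: ·)).map τ).sum + e a * (l.map τ).sum := by
      induction l with
      | nil => simp
      | cons w l ih =>
        simp only [List.map_cons, List.sum_cons, ih, _root_.prependLetter]
        ring
    rcases u with _ | ⟨a, u⟩
    · simp [quasiShuffle, _root_.prependLetter, hτ.nil]
    · rcases v with _ | ⟨b, v⟩
      · simp [quasiShuffle, _root_.prependLetter, hτ.nil]
      · have h := hτ.mul (a :: u) (b :: v)
        rw [quasiShuffle, List.map_append, List.map_append, List.sum_append, List.sum_append] at h ⊢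
        rw [key, key, key, hτ.mul, hτ.mul, hτ.mul, he]
        simp only [_root_.prependLetter]
        linear_combination h

theorem IsCharacter.prefixSum [Add A] {l : List (A → B)}
    (hl : ∀ e ∈ l, ∀ a b, e (a + b) = e a * e b) {τ : List A → B} (hτ : IsCharacter τ) :
    IsCharacter (prefixSum l τ) := by
  induction l with
  | nil => exact hτ
  | cons e l ih =>
    exact (ih fun e' he' => hl e' (List.mem_cons_of_mem _ he')).prependLetter
      (hl e List.mem_cons_self)

theorem IsCharacter.map [Add A] (f : B →+* B') {τ : List A → B} (hτ : IsCharacter τ) :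
    IsCharacter (fun w => f (τ w)) where
  nil := by rw [hτ.nil, map_one]
  mul u v := by
    rw [← map_mul, ← hτ.mul, map_list_sum, List.map_map, Function.comp_def]

end prefixSum

/-! ### Power series with a given logarithmic derivative -/

/-- The coefficients of the power series `F` with `F' = a F` and constant term one. -/
noncomputable def expIntCoeff {B : Type*} [CommRing B] [Algebra ℚ B] (a : ℕ → B) : ℕ → B
  | 0 => 1
  | n + 1 => ((n + 1 : ℚ)⁻¹) • ∑ i : Fin (n + 1), a (n - i) * expIntCoeff a i

section expInt
variable {B B' : Type*} [CommRing B] [CommRing B'] [Algebra ℚ B] [Algebra ℚ B']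

theorem expIntCoeff_zero (a : ℕ → B) : expIntCoeff a 0 = 1 := by rw [expIntCoeff]

theorem expIntCoeff_succ (a : ℕ → B) (n : ℕ) : expIntCoeff a (n + 1) =
    ((n + 1 : ℚ)⁻¹) • ∑ i ∈ Finset.range (n + 1), a (n - i) * expIntCoeff a i := by
  rw [expIntCoeff, Finset.sum_range]

theorem map_expIntCoeff (f : B →+* B') (a : ℕ → B) (n : ℕ) :
    f (expIntCoeff a n) = expIntCoeff (fun i => f (a i)) n := by
  induction n using Nat.strong_induction_on with
  | _ n ih =>
    cases n with
    | zero => rw [expIntCoeff_zero, expIntCoeff_zero, map_one]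
    | succ n =>
      rw [expIntCoeff_succ, expIntCoeff_succ, map_rat_smul f, map_sum]
      congr 1
      refine Finset.sum_congr rfl fun i hi => ?_
      rw [map_mul, ih i (by simpa using hi)]

theorem derivative_mk_expIntCoeff (a : ℕ → B) :
    PowerSeries.derivative B (PowerSeries.mk (expIntCoeff a)) =
      PowerSeries.mk a * PowerSeries.mk (expIntCoeff a) := by
  ext n
  rw [PowerSeries.coeff_derivative, PowerSeries.coeff_mk, expIntCoeff_succ, mul_comm (PowerSeries.mk a),
    PowerSeries.coeff_mul, Finset.Nat.sum_antidiagonal_eq_sum_range_succ_mk]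
  have h : ((n : B) + 1) = algebraMap ℚ B (n + 1) := by simp
  rw [h, mul_comm, ← Algebra.smul_def, smul_smul, mul_inv_cancel₀ (by positivity), one_smul]
  simp only [PowerSeries.coeff_mk, mul_comm]

/-- The differential equation determines coefficient `n + 1` from the earlier ones because `n + 1`
is invertible. Identities between generating series can thus be checked on logarithmic derivatives.
-/
theorem eq_expIntCoeff {a : ℕ → B} {F : PowerSeries B} (h0 : PowerSeries.constantCoeff F = 1)
    (h : PowerSeries.derivative B F = PowerSeries.mk a * F) (n : ℕ) :
    PowerSeries.coeff n F = expIntCoeff a n := by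
  induction n using Nat.strong_induction_on with
  | _ n ih =>
    cases n with
    | zero => rw [expIntCoeff_zero, PowerSeries.coeff_zero_eq_constantCoeff_apply, h0]
    | succ n =>
      have h1 := congrArg (PowerSeries.coeff n) h
      rw [PowerSeries.coeff_derivative, mul_comm (PowerSeries.mk a), PowerSeries.coeff_mul,
        Finset.Nat.sum_antidiagonal_eq_sum_range_succ_mk] at h1
      have h2 : ((n : B) + 1) = algebraMap ℚ B (n + 1) := by simp
      rw [h2, mul_comm, ← Algebra.smul_def] at h1
      rw [expIntCoeff_succ, eq_inv_smul_iff₀ (by positivity), h1]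
      refine Finset.sum_congr rfl fun i hi => ?_
      rw [ih i (by simpa using hi), PowerSeries.coeff_mk, mul_comm]

end expInt

/-! ### The binomial character -/

/-- The function on words over `ℕ` that vanishes on words with a nonzero letter and whose value at
the word `0 ⋯ 0` of length `n` is the binomial coefficient of `c` and `n`. -/
noncomputable def binomialCharacter {B : Type*} [CommRing B] [Algebra ℚ B] (c : B) (w : List ℕ) :
    B :=
  if ∀ a ∈ w, a = 0 then expIntCoeff (fun i => (-1) ^ i * c) w.length else 0

section binomialCharacter
variable {B B' : Type*} [CommRing B] [CommRing B'] [Algebra ℚ B] [Algebra ℚ B']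

theorem map_binomialCharacter (f : B →+* B') (c : B) (w : List ℕ) :
    f (binomialCharacter c w) = binomialCharacter (f c) w := by
  unfold binomialCharacter
  split_ifs
  · rw [map_expIntCoeff]; simp
  · exact map_zero f

/-- The logarithmic derivative of `(1 + X)^n` is `n / (1 + X) = ∑ (-1)^i n X^i`. -/
theorem coeff_one_add_X_pow_eq_expIntCoeff (n k : ℕ) :
    PowerSeries.coeff k ((1 + PowerSeries.X : PowerSeries B) ^ n) =
      expIntCoeff (fun i => (-1) ^ i * (n : B)) k := by
  refine eq_expIntCoeff (by simp) ?_ k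
  have h : PowerSeries.mk (fun i => (-1) ^ i * (n : B)) * (1 + PowerSeries.X) =
      PowerSeries.C (n : B) := by
    ext i
    cases i with
    | zero => simp [mul_add]
    | succ i =>
      rw [mul_add, mul_one, map_add, PowerSeries.coeff_succ_mul_X, PowerSeries.coeff_mk,
        PowerSeries.coeff_mk, PowerSeries.coeff_C, if_neg (Nat.succ_ne_zero i)]
      ring
  cases n with
  | zero => simp; rfl
  | succ n =>
    rw [PowerSeries.derivative_pow, pow_succ', ← mul_assoc, h]
    simp

/-- Pascal's rule. A binomial coefficient counts the ways to place the zeros of the word at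
increasing positions among `n` indices. -/
theorem binomialCharacter_natCast_eq_prefixSum (n : ℕ) (w : List ℕ) :
    binomialCharacter (n : B) w =
      prefixSum (List.replicate n fun a : ℕ => if a = 0 then (1 : B) else 0)
        (fun w => if w = [] then 1 else 0) w := by
  induction n generalizing w with
  | zero =>
    simp only [List.replicate_zero, prefixSum_nil]
    unfold binomialCharacter
    rw [← coeff_one_add_X_pow_eq_expIntCoeff, pow_zero, PowerSeries.coeff_one]
    cases w <;> simp
  | succ n ih =>
    cases w with
    | nil => simp [prefixSum_apply_nil, binomialCharacter, expIntCoeff_zero]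
    | cons a w =>
      rw [List.replicate_succ, prefixSum_cons, prependLetter, ← ih, ← ih]
      unfold binomialCharacter
      simp only [← coeff_one_add_X_pow_eq_expIntCoeff, List.mem_cons, forall_eq_or_imp,
        List.length_cons]
      by_cases ha : a = 0 <;> by_cases hw : ∀ a ∈ w, a = 0 <;> simp [ha, hw]
      rw [pow_succ, mul_add, mul_one, map_add, PowerSeries.coeff_succ_mul_X, if_pos hw, if_pos hw,
        if_pos hw]

/-- Multiplicativity is a polynomial identity in `c` over `ℚ`. At natural numbers it holds because
the function is then an iterated evaluation of letters, starting from the counit; so it holds for an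
indeterminate, which specializes to any `c`. -/
theorem isCharacter_binomialCharacter (c : B) : IsCharacter (binomialCharacter c) := by
  have key : IsCharacter (binomialCharacter (Polynomial.X : Polynomial ℚ)) := by
    refine ⟨by simp [binomialCharacter, expIntCoeff_zero], fun u v => ?_⟩
    refine Polynomial.eq_of_infinite_eval_eq _ _
      ((Set.infinite_range_of_injective (Nat.cast_injective (R := ℚ))).mono ?_)
    rintro _ ⟨n, rfl⟩
    have h : IsCharacter (binomialCharacter (n : ℚ)) := by
      have := isCharacter_counit (A := ℕ) (B := ℚ)
      rw [funext (binomialCharacter_natCast_eq_prefixSum n)]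
      refine this.prefixSum fun e he a b => ?_
      rw [List.eq_of_mem_replicate he]
      by_cases ha : a = 0 <;> by_cases hb : b = 0 <;> simp [ha, hb]
    have h2 (w : List ℕ) : (binomialCharacter (Polynomial.X : Polynomial ℚ) w).eval (n : ℚ) =
        binomialCharacter (n : ℚ) w := by
      rw [← Polynomial.coe_evalRingHom, map_binomialCharacter]; simp
    simp only [Set.mem_ofPred_eq, Polynomial.eval_mul, h2, ← h.mul]
    rw [← Polynomial.coe_evalRingHom, map_list_sum, List.map_map]
    simp [Function.comp_def, h2]
  have h := key.map (Polynomial.aeval c : Polynomial ℚ →ₐ[ℚ] B).toRingHom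
  simpa [map_binomialCharacter] using h

end binomialCharacter

/-! ### Sums over occurrences -/

section occurrences
variable {A : Type*}

/-- The sequences `s < i₁ < ⋯ < iₙ` for which `∏ x_{iⱼ}^{ex(aⱼ)} = x^m`, where `w = (a₁, …, aₙ)`. -/
def occurrenceSet (ex : A → ℕ) (w : List A) (s : ℕ) (m : ℕ+ →₀ ℕ) : Set (Fin w.length → ℕ+) :=
  {I | StrictMono I ∧ (∀ j, s < (I j : ℕ)) ∧ xExponent (fun j => ex (w.get j)) I = m}

theorem xExponent_cons (ex : A → ℕ) (a : A) (w : List A) (i : ℕ+) (I : Fin w.length → ℕ+) :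
    xExponent (fun j => ex ((a :: w).get j)) (Fin.cons i I : Fin (w.length + 1) → ℕ+) =
      Finsupp.single i (ex a) + xExponent (fun j => ex (w.get j)) I := by
  unfold xExponent
  exact Fin.sum_univ_succ _

theorem cons_mem_occurrenceSet (ex : A → ℕ) (a : A) (w : List A) (i : ℕ+) (I : Fin w.length → ℕ+)
    (s : ℕ) (m : ℕ+ →₀ ℕ) :
    (Fin.cons i I : Fin (w.length + 1) → ℕ+) ∈ occurrenceSet ex (a :: w) s m ↔
      s < (i : ℕ) ∧ ∃ m', I ∈ occurrenceSet ex w i m' ∧ Finsupp.single i (ex a) + m' = m := by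
  have h0 := xExponent_cons ex a w i I
  have h1 : StrictMono (Fin.cons i I : Fin (w.length + 1) → ℕ+) ↔
      (∀ j, (i : ℕ) < I j) ∧ StrictMono I := Fin.strictMono_cons
  have h2 : (∀ j, s < ((Fin.cons i I : Fin (w.length + 1) → ℕ+) j : ℕ)) ↔
      s < (i : ℕ) ∧ ∀ j, s < (I j : ℕ) := Fin.forall_fin_succ
  constructor
  · rintro ⟨h3, h5, h6⟩
    exact ⟨(h2.1 h5).1, _, ⟨(h1.1 h3).2, (h1.1 h3).1, rfl⟩, h0.symm.trans h6⟩
  · rintro ⟨h3, m', ⟨h4, h5, rfl⟩, h6⟩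
    exact ⟨h1.2 ⟨h5, h4⟩, h2.2 ⟨h3, fun j => h3.trans (h5 j)⟩, h0.trans h6⟩

theorem occurrenceSet_cons_eq_union (ex : A → ℕ) (a : A) (w : List A) (s : ℕ) (m : ℕ+ →₀ ℕ) :
    occurrenceSet ex (a :: w) s m = occurrenceSet ex (a :: w) (s + 1) m ∪
      (fun I : Fin w.length → ℕ+ => (Fin.cons s.succPNat I : Fin (w.length + 1) → ℕ+)) ''
        {I | ∃ m', I ∈ occurrenceSet ex w (s + 1) m' ∧
          Finsupp.single s.succPNat (ex a) + m' = m} := by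
  ext I
  obtain ⟨i, I, rfl⟩ : ∃ (i : ℕ+) (I' : Fin w.length → ℕ+),
      I = (Fin.cons i I' : Fin (w.length + 1) → ℕ+) := ⟨I 0, Fin.tail I, (Fin.cons_self_tail I).symm⟩
  rw [Set.mem_union, cons_mem_occurrenceSet, cons_mem_occurrenceSet]
  constructor
  · rintro ⟨h1, h2⟩
    rcases (Nat.succ_le_of_lt h1).eq_or_lt with h3 | h3
    · right
      obtain rfl : i = s.succPNat := PNat.eq h3.symm
      exact ⟨I, h2, rfl⟩
    · exact Or.inl ⟨h3, h2⟩
  · rintro (⟨h1, h2⟩ | ⟨I', h1, h2⟩)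
    · exact ⟨by omega, h2⟩
    · obtain ⟨rfl, rfl⟩ := Fin.cons_inj.1 h2
      exact ⟨Nat.lt_succ_self s, h1⟩

/-- The first index of an occurrence is either larger than `s + 1` or equal to it; in the second
case its letter contributes a monomial factor and the rest of the word lies beyond `s + 1`. -/
theorem hasSum_occurrenceSet_cons {R : Type*} [CommRing R] [TopologicalSpace R]
    [IsTopologicalRing R] (ex : A → ℕ) (g : A → ℕ+ → R) (a : A)
    (w : List A) (s : ℕ) (F G : MvPowerSeries ℕ+ R) (m : ℕ+ →₀ ℕ)
    (hF : HasSum (fun I : occurrenceSet ex (a :: w) (s + 1) m => ∏ j, g ((a :: w).get j) (I.1 j))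
      (MvPowerSeries.coeff m F))
    (hG : ∀ m' ≤ m, HasSum (fun I : occurrenceSet ex w (s + 1) m' => ∏ j, g (w.get j) (I.1 j))
      (MvPowerSeries.coeff m' G)) :
    HasSum (fun I : occurrenceSet ex (a :: w) s m => ∏ j, g ((a :: w).get j) (I.1 j))
      (MvPowerSeries.coeff m (F +
        MvPowerSeries.monomial (Finsupp.single s.succPNat (ex a)) (g a s.succPNat) * G)) := by
  rw [occurrenceSet_cons_eq_union, map_add]
  refine HasSum.add_disjoint (f := fun I : Fin (a :: w).length → ℕ+ =>
    ∏ j, g ((a :: w).get j) (I j)) ?_ hF ?_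
  · rw [Set.disjoint_left]
    rintro _ h1 ⟨I, h2, rfl⟩
    exact absurd (h1.2.1 (0 : Fin (w.length + 1))) (by simp)
  · have hinj : Function.Injective
        (fun I : Fin w.length → ℕ+ => (Fin.cons s.succPNat I : Fin (w.length + 1) → ℕ+)) :=
      fun I I' h => (Fin.cons_inj.1 h).2
    rw [← (Equiv.Set.image _ _ hinj).hasSum_iff, MvPowerSeries.coeff_monomial_mul]
    have hprod (I : Fin w.length → ℕ+) : ∏ j, g ((a :: w).get j)
        ((Fin.cons s.succPNat I : Fin (w.length + 1) → ℕ+) j) =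
        g a s.succPNat * ∏ j, g (w.get j) (I j) := Fin.prod_univ_succ _
    split_ifs with hm
    · have hset : {I | ∃ m', I ∈ occurrenceSet ex w (s + 1) m' ∧
          Finsupp.single s.succPNat (ex a) + m' = m} =
          occurrenceSet ex w (s + 1) (m - Finsupp.single s.succPNat (ex a)) := by
        ext I
        constructor
        · rintro ⟨m', h1, rfl⟩
          rwa [add_tsub_cancel_left]
        · exact fun h => ⟨_, h, add_tsub_cancel_of_le hm⟩
      have := (hG (m - Finsupp.single s.succPNat (ex a)) tsub_le_self).mul_left (g a s.succPNat)
      rw [← hset] at this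
      refine HasSum.congr_fun this fun I => ?_
      exact hprod I.1
    · have hset : {I | ∃ m', I ∈ occurrenceSet ex w (s + 1) m' ∧
          Finsupp.single s.succPNat (ex a) + m' = m} = ∅ := by
        ext I
        simp only [Set.mem_ofPred_eq, Set.mem_empty_iff_false, iff_false, not_exists, not_and]
        rintro m' - rfl
        exact hm (le_add_right le_rfl)
      rw [hset]
      exact hasSum_empty

theorem occurrenceSet_nil (ex : A → ℕ) (s s' : ℕ) (m : ℕ+ →₀ ℕ) :
    occurrenceSet ex [] s m = occurrenceSet ex [] s' m := by
  ext I
  exact ⟨fun h => ⟨h.1, fun j => j.elim0, h.2.2⟩, fun h => ⟨h.1, fun j => j.elim0, h.2.2⟩⟩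

/-- The monomial weights of the letters at the indices `s + 1, …, s + d`. -/
noncomputable def letterWeights {R : Type*} [CommRing R] (ex : A → ℕ) (g : A → ℕ+ → R) (s d : ℕ) :
    List (A → MvPowerSeries ℕ+ R) :=
  (List.range' s d).map fun i a =>
    MvPowerSeries.monomial (Finsupp.single i.succPNat (ex a)) (g a i.succPNat)

/-- Splitting the indices at `s + d` reduces a sum over all occurrences to sums over the tails,
which are needed only for the suffixes of the word and the divisors of the monomial. -/
theorem hasSum_occurrenceSet {R : Type*} [CommRing R] [TopologicalSpace R]
    [IsTopologicalRing R] (ex : A → ℕ) (g : A → ℕ+ → R)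
    (τ : List A → MvPowerSeries ℕ+ R) (s d : ℕ) (w : List A) (m : ℕ+ →₀ ℕ)
    (hτ : ∀ v, v <:+ w → ∀ m' ≤ m,
      HasSum (fun I : occurrenceSet ex v (s + d) m' => ∏ j, g (v.get j) (I.1 j))
        (MvPowerSeries.coeff m' (τ v))) :
    HasSum (fun I : occurrenceSet ex w s m => ∏ j, g (w.get j) (I.1 j))
      (MvPowerSeries.coeff m (prefixSum (letterWeights ex g s d) τ w)) := by
  induction d generalizing s w m with
  | zero => exact hτ w List.suffix_rfl m le_rfl
  | succ d ih =>
    have hsd : s + (d + 1) = s + 1 + d := by ring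
    rw [hsd] at hτ
    cases w with
    | nil =>
      rw [prefixSum_apply_nil, occurrenceSet_nil ex s (s + 1 + d)]
      exact hτ [] List.suffix_rfl m le_rfl
    | cons a w =>
      refine hasSum_occurrenceSet_cons ex g a w s _ _ m (ih (s + 1) (a :: w) m hτ) fun m' hm' => ?_
      exact ih (s + 1) w m' fun v hv m'' hm'' =>
        hτ v (hv.trans (List.suffix_cons a w)) m'' (hm''.trans hm')

theorem mem_occurrenceSet_zero (ex : A → ℕ) (w : List A) (m : ℕ+ →₀ ℕ) (I : Fin w.length → ℕ+) :
    I ∈ occurrenceSet ex w 0 m ↔ StrictMono I ∧ xExponent (fun j => ex (w.get j)) I = m :=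
  ⟨fun h => ⟨h.1, h.2.2⟩, fun h => ⟨h.1, fun j => (I j).pos, h.2⟩⟩

theorem hasSum_occurrenceSet_nil {R : Type*} [CommRing R] [TopologicalSpace R]
    (ex : A → ℕ) (g : A → ℕ+ → R) (s : ℕ) (m : ℕ+ →₀ ℕ) :
    HasSum (fun I : occurrenceSet ex [] s m => ∏ j, g (([] : List A).get j) (I.1 j))
      (MvPowerSeries.coeff m 1) := by
  have : Subsingleton (Fin ([] : List A).length → ℕ+) := inferInstanceAs (Subsingleton (Fin 0 → ℕ+))
  rw [MvPowerSeries.coeff_one]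
  split_ifs with hm
  · subst hm
    let I₀ : occurrenceSet ex ([] : List A) s 0 :=
      ⟨Fin.elim0, fun i => i.elim0, fun i => i.elim0, rfl⟩
    have h := hasSum_unique (α := R) (β := Unit) fun _ => 1
    convert hasSum_single I₀ (f := fun I : occurrenceSet ex ([] : List A) s 0 =>
      ∏ j, g (([] : List A).get j) (I.1 j)) ?_ using 1
    · rfl
    · exact fun I hI => absurd (Subsingleton.elim _ _) hI
  · have : IsEmpty (occurrenceSet ex ([] : List A) s m) := ⟨fun I => hm I.2.2.2.symm⟩
    exact hasSum_empty

theorem le_of_mem_occurrenceSet {ex : A → ℕ} {w : List A} {s : ℕ} {m : ℕ+ →₀ ℕ}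
    {I : Fin w.length → ℕ+} (hI : I ∈ occurrenceSet ex w s m) (j : Fin w.length) :
    ex (w.get j) ≤ m (I j) := by
  rw [← hI.2.2, xExponent, Finsupp.finsetSum_apply]
  refine le_trans ?_ (Finset.single_le_sum (f := fun i =>
    Finsupp.single (I i) (ex (w.get i)) (I j)) (fun _ _ => Nat.zero_le _) (Finset.mem_univ j))
  simp

/-- Letters with positive exponent do not occur beyond the support of the monomial. -/
theorem eq_zero_of_mem_occurrenceSet {ex : A → ℕ} {w : List A} {N : ℕ} {m : ℕ+ →₀ ℕ}
    (hm : ∀ i : ℕ+, N < i → m i = 0) {I : Fin w.length → ℕ+} (hI : I ∈ occurrenceSet ex w N m) :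
    m = 0 ∧ ∀ a ∈ w, ex a = 0 := by
  have h (j : Fin w.length) : ex (w.get j) = 0 :=
    Nat.le_zero.1 ((le_of_mem_occurrenceSet hI j).trans (hm _ (hI.2.1 j)).le)
  refine ⟨?_, fun a ha => ?_⟩
  · rw [← hI.2.2, xExponent]
    exact Finset.sum_eq_zero fun j _ => by rw [h j, Finsupp.single_zero]
  · obtain ⟨j, rfl⟩ := List.get_of_mem ha
    exact h j

end occurrences

/-! ### Truncation to finitely many variables -/

/-- The monomials in the variables `x₁, …, x_N`. -/
def SupportedBy (N : ℕ) (m : ℕ+ →₀ ℕ) : Prop := ∀ i : ℕ+, N < i → m i = 0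

theorem SupportedBy.mono {N : ℕ} {m m' : ℕ+ →₀ ℕ} (h : SupportedBy N m) (hm : m' ≤ m) :
    SupportedBy N m' := fun i hi => Nat.le_zero.1 ((hm i).trans (h i hi).le)

theorem exists_supportedBy (m : ℕ+ →₀ ℕ) : ∃ N, SupportedBy N m := by
  refine ⟨m.support.sup fun i => (i : ℕ), fun i hi => ?_⟩
  by_contra h
  exact absurd (Finset.le_sup (f := fun i : ℕ+ => (i : ℕ)) (Finsupp.mem_support_iff.2 h)) (by omega)

theorem IsLeftWeak.of_suffix {α β : List ℕ} (hα : IsLeftWeak α) (h : β <:+ α) : IsLeftWeak β := by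
  intro a ha
  obtain ⟨γ, rfl⟩ := h
  refine hα a ?_
  rw [Option.mem_def] at ha ⊢
  rw [List.getLast?_append, ha]
  rfl

theorem IsLeftWeak.exists_ne_zero {α : List ℕ} (hα : IsLeftWeak α) (h : α ≠ []) :
    ∃ a ∈ α, a ≠ 0 :=
  ⟨α.getLast h, List.getLast_mem h, (hα _ (List.getLast?_eq_some_getLast h)).ne'⟩

/-- The coefficients of a left weak monomial quasisymmetric function, computed in finitely many
variables. -/
theorem coeff_monomialQSym {α : List ℕ} (hα : IsLeftWeak α) {N : ℕ}
    {m : ℕ+ →₀ ℕ} (hm : SupportedBy N m) :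
    MvPowerSeries.coeff m (monomialQSym ℚ α) = MvPowerSeries.coeff m
      (prefixSum (letterWeights id (fun _ _ => (1 : ℚ)) 0 N) (fun w => if w = [] then 1 else 0) α) := by
  have h := hasSum_occurrenceSet (R := ℚ) id (fun _ _ => (1 : ℚ))
    (fun w => if w = [] then 1 else 0) 0 N α m fun v hv m' hm' => ?_
  · have e : occurrenceSet id α 0 m ≃ Occurrence α.get m :=
      Equiv.subtypeEquivRight fun I => mem_occurrenceSet_zero id α m I
    simp only [Finset.prod_const_one] at h
    -- A constant nonzero family is summable only over a finite set, so the convergence just proved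
    -- already shows that the number of occurrences is finite.
    have hfin : Finite (occurrenceSet id α 0 m) := by
      by_contra hinf
      rw [not_finite_iff_infinite] at hinf
      exact one_ne_zero ((summable_const_iff _).1 h.summable)
    have := Fintype.ofFinite (occurrenceSet id α 0 m)
    rw [h.unique (hasSum_fintype _)]
    change ((Nat.card (Occurrence α.get m) : ℕ) : ℚ) = _
    rw [← Nat.card_congr e]
    simp
  · by_cases hv0 : v = []
    · subst hv0
      rw [if_pos rfl]
      exact hasSum_occurrenceSet_nil _ (fun _ _ => 1) _ _
    · rw [if_neg hv0, map_zero]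
      have : IsEmpty (occurrenceSet id v (0 + N) m') := by
        refine ⟨fun I => ?_⟩
        obtain ⟨a, ha, ha'⟩ := (hα.of_suffix hv).exists_ne_zero hv0
        refine ha' ((eq_zero_of_mem_occurrenceSet ?_ I.2).2 a ha)
        rw [zero_add]
        exact hm.mono hm'
      exact hasSum_empty

/-! ### Sums over the tails -/

/-- The sum of the second components of the letters. -/
def weight (w : List (ℕ × ℕ+)) : ℕ := (w.map fun a => (a.2 : ℕ)).sum

@[simp] theorem weight_nil : weight [] = 0 := rfl

@[simp] theorem weight_cons (a : ℕ × ℕ+) (w : List (ℕ × ℕ+)) :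
    weight (a :: w) = a.2 + weight w := by simp [weight]

/-- The product of the `Q (βⱼ + ⋯ + βₙ)` if all exponents vanish, and zero otherwise. -/
def zeroTail {K : Type*} [CommRing K] (Q : ℕ → K) : List (ℕ × ℕ+) → K
  | [] => 1
  | a :: w => if a.1 = 0 then Q (weight (a :: w)) * zeroTail Q w else 0

theorem zeroTail_eq_zero {K : Type*} [CommRing K] (Q : ℕ → K) {w : List (ℕ × ℕ+)}
    (h : ¬ ∀ a ∈ w, a.1 = 0) : zeroTail Q w = 0 := by
  induction w with
  | nil => simp at h
  | cons a w ih =>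
    rw [zeroTail]
    split_ifs with h0
    · rw [ih, mul_zero]
      intro h1
      exact h (by simpa [h0] using h1)
    · rfl

theorem hasSum_geometric_gt {K : Type*} [NormedField K] (c : K) {q : K} (hq : ‖q‖ < 1) (N : ℕ) :
    HasSum (fun i : {i : ℕ+ // N < (i : ℕ)} => c * q ^ (i.1 : ℕ)) (c * q ^ N * (q / (1 - q))) := by
  let e : ℕ ≃ {i : ℕ+ // N < (i : ℕ)} :=
    { toFun := fun n => ⟨(N + n).succPNat, by simp⟩
      invFun := fun i => (i.1 : ℕ) - N - 1
      left_inv := fun n => by simp [Nat.succPNat_coe]; omega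
      right_inv := fun i => by
        have := i.2
        refine Subtype.ext (PNat.eq ?_)
        change (N + ((i.1 : ℕ) - N - 1)) + 1 = (i.1 : ℕ)
        omega }
  rw [← e.hasSum_iff, div_eq_mul_inv, ← mul_assoc]
  refine ((hasSum_geometric_of_norm_lt_one hq).mul_left (c * q ^ N * q)).congr_fun fun n => ?_
  change c * q ^ (N + n + 1) = _
  ring

/-- An occurrence of a word that starts with a zero letter: the first index and the others. -/
noncomputable def occurrenceSetConsEquiv (b : ℕ+) (w : List (ℕ × ℕ+)) (N : ℕ) :
    (Σ i : {i : ℕ+ // N < (i : ℕ)}, occurrenceSet Prod.fst w i.1 0) ≃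
      occurrenceSet Prod.fst ((0, b) :: w) N 0 :=
  Equiv.ofBijective
    (fun p => ⟨(Fin.cons p.1.1 p.2.1 : Fin (w.length + 1) → ℕ+),
      (cons_mem_occurrenceSet Prod.fst (0, b) w p.1.1 p.2.1 N 0).2 ⟨p.1.2, 0, p.2.2, by simp⟩⟩) <| by
    constructor
    · rintro ⟨⟨i, hi⟩, I, hI⟩ ⟨⟨i', hi'⟩, I', hI'⟩ h
      have h' : (Fin.cons i I : Fin (w.length + 1) → ℕ+) = Fin.cons i' I' := congrArg Subtype.val h
      obtain ⟨rfl, rfl⟩ := Fin.cons_inj.1 h'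
      rfl
    · rintro ⟨I, hI⟩
      obtain ⟨i, I, rfl⟩ : ∃ (i : ℕ+) (I' : Fin w.length → ℕ+),
          I = (Fin.cons i I' : Fin (w.length + 1) → ℕ+) :=
        ⟨I 0, Fin.tail I, (Fin.cons_self_tail I).symm⟩
      obtain ⟨hi, m', hI', hm⟩ := (cons_mem_occurrenceSet Prod.fst (0, b) w i I N 0).1 hI
      obtain rfl : m' = 0 := by simpa using hm
      exact ⟨⟨⟨i, hi⟩, I, hI'⟩, rfl⟩

theorem mul_pow_eq {K : Type*} [CommRing K] (x y : K) (n i : ℕ) :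
    y ^ n * (x ^ n) ^ i = (y * x ^ i) ^ n := by
  rw [mul_pow, pow_right_comm]

theorem mul_pow_mul_pow_mul {K : Type*} [CommRing K] (x y z : K) (i b n : ℕ) :
    (y * x ^ i) ^ b * ((y * x ^ i) ^ n * z) = y ^ (b + n) * (x ^ (b + n)) ^ i * z := by
  rw [← mul_assoc, ← pow_add, mul_pow_eq]

theorem hasSum_sigma_norm {K ι : Type*} [NormedField K] [CompleteSpace K] {γ : ι → Type*}
    {f : (Σ i, γ i) → K} {g : ι → K} {G : ι → ℝ} {s : K} {S : ℝ}
    (h : ∀ i, HasSum (fun c => f ⟨i, c⟩) (g i)) (h' : ∀ i, HasSum (fun c => ‖f ⟨i, c⟩‖) (G i))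
    (hg : HasSum g s) (hG : HasSum G S) : HasSum f s ∧ HasSum (fun p => ‖f p‖) S := by
  have h2 : Summable fun p => ‖f p‖ :=
    (summable_sigma_of_nonneg fun p => norm_nonneg _).2
      ⟨fun i => (h' i).summable, by simp only [fun i => (h' i).tsum_eq, hG.summable]⟩
  exact ⟨hg.sigma_of_hasSum h h2.of_norm, hG.sigma_of_hasSum h' h2⟩

/-- For a fixed first index `i`, the inner sum over indices beyond `i` is a constant times `(y *
x^i) ^ weight w`. Hence the outer sum is geometric with ratio `x` to the total weight. The norms are
carried along in the induction because the iterated sum is turned into one sum by absolute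
convergence. -/
theorem hasSum_zeroTail {K : Type*} [NormedField K] [CompleteSpace K] (x y : K) (hx : ‖x‖ < 1)
    (w : List (ℕ × ℕ+)) (hw : ∀ a ∈ w, a.1 = 0) (N : ℕ) :
    HasSum (fun I : occurrenceSet Prod.fst w N 0 => ∏ j, (y * x ^ (I.1 j : ℕ)) ^ ((w.get j).2 : ℕ))
      ((y * x ^ N) ^ weight w * zeroTail (fun b => x ^ b / (1 - x ^ b)) w) ∧
    HasSum (fun I : occurrenceSet Prod.fst w N 0 =>
      ‖∏ j, (y * x ^ (I.1 j : ℕ)) ^ ((w.get j).2 : ℕ)‖)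
      ((‖y‖ * ‖x‖ ^ N) ^ weight w * zeroTail (fun b => ‖x‖ ^ b / (1 - ‖x‖ ^ b)) w) := by
  induction w generalizing N with
  | nil =>
    have h := hasSum_occurrenceSet_nil (R := K) (A := ℕ × ℕ+) Prod.fst (fun _ _ => 1) N 0
    have h' := hasSum_occurrenceSet_nil (R := ℝ) (A := ℕ × ℕ+) Prod.fst (fun _ _ => 1) N 0
    constructor
    · simpa [zeroTail] using h
    · simpa [zeroTail] using h'
  | cons a w ih =>
    obtain ⟨a, b⟩ := a
    obtain rfl : a = 0 := hw (a, b) List.mem_cons_self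
    have ih' := ih fun c hc => hw c (List.mem_cons_of_mem _ hc)
    have hwt : weight ((0, b) :: w) = b + weight w := weight_cons _ _
    have hterm (i : ℕ+) (I : Fin w.length → ℕ+) :
        ∏ j, (y * x ^ (((Fin.cons i I : Fin (w.length + 1) → ℕ+) j : ℕ+) : ℕ)) ^
          ((((0, b) :: w : List (ℕ × ℕ+)).get j).2 : ℕ) =
        (y * x ^ (i : ℕ)) ^ (b : ℕ) * ∏ j, (y * x ^ (I j : ℕ)) ^ ((w.get j).2 : ℕ) :=
      Fin.prod_univ_succ _
    have hq : ‖x ^ weight ((0, b) :: w)‖ < 1 := by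
      rw [norm_pow]
      exact pow_lt_one₀ (norm_nonneg x) hx (by simp)
    have hq' : ‖‖x‖ ^ weight ((0, b) :: w)‖ < 1 := by
      rw [norm_pow] at hq
      rwa [norm_pow, norm_norm]
    have geo := (hasSum_geometric_gt (y ^ weight ((0, b) :: w)) hq N).mul_right
      (zeroTail (fun b => x ^ b / (1 - x ^ b)) w)
    have geo' := (hasSum_geometric_gt (‖y‖ ^ weight ((0, b) :: w)) hq' N).mul_right
      (zeroTail (fun b => ‖x‖ ^ b / (1 - ‖x‖ ^ b)) w)
    have hfib (i : {i : ℕ+ // N < (i : ℕ)}) := (ih' i.1).1.mul_left ((y * x ^ (i.1 : ℕ)) ^ (b : ℕ))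
    have hfib' (i : {i : ℕ+ // N < (i : ℕ)}) :=
      (ih' i.1).2.mul_left ((‖y‖ * ‖x‖ ^ (i.1 : ℕ)) ^ (b : ℕ))
    let f : (Σ i : {i : ℕ+ // N < (i : ℕ)}, occurrenceSet Prod.fst w i.1 0) → K := fun p =>
      (y * x ^ (p.1.1 : ℕ)) ^ (b : ℕ) * ∏ j, (y * x ^ (p.2.1 j : ℕ)) ^ ((w.get j).2 : ℕ)
    have h1 (i : {i : ℕ+ // N < (i : ℕ)}) : HasSum (fun c => f ⟨i, c⟩)
        (y ^ weight ((0, b) :: w) * (x ^ weight ((0, b) :: w)) ^ (i.1 : ℕ) *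
          zeroTail (fun b => x ^ b / (1 - x ^ b)) w) := by
      have h := hfib i
      rw [mul_pow_mul_pow_mul, ← hwt] at h
      exact h
    have h2 (i : {i : ℕ+ // N < (i : ℕ)}) : HasSum (fun c => ‖f ⟨i, c⟩‖)
        (‖y‖ ^ weight ((0, b) :: w) * (‖x‖ ^ weight ((0, b) :: w)) ^ (i.1 : ℕ) *
          zeroTail (fun b => ‖x‖ ^ b / (1 - ‖x‖ ^ b)) w) := by
      have h := hfib' i
      rw [mul_pow_mul_pow_mul, ← hwt] at h
      exact h.congr_fun fun c => by simp [f]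
    obtain ⟨hsum, hnorm⟩ := hasSum_sigma_norm h1 h2 geo geo'
    rw [mul_assoc, mul_pow_eq x y] at hsum
    rw [mul_assoc, mul_pow_eq ‖x‖ ‖y‖] at hnorm
    rw [zeroTail, zeroTail, if_pos rfl, if_pos rfl]
    constructor
    · rw [← (occurrenceSetConsEquiv b w N).hasSum_iff]
      exact hsum.congr_fun fun p => hterm _ _
    · rw [← (occurrenceSetConsEquiv b w N).hasSum_iff]
      exact hnorm.congr_fun fun p => congrArg norm (hterm _ _)

/-- Beyond `N` no variable of the monomial is left, so the tail contributes only to the constant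
monomial, and only for words without positive exponents. -/
theorem hasSum_occurrenceSet_tail {K : Type*} [NormedField K] [CompleteSpace K] (x y : K)
    (hx : ‖x‖ < 1) (w : List (ℕ × ℕ+)) {N : ℕ} {m : ℕ+ →₀ ℕ} (hm : SupportedBy N m) :
    HasSum (fun I : occurrenceSet Prod.fst w N m => ∏ j, (y * x ^ (I.1 j : ℕ)) ^ ((w.get j).2 : ℕ))
      (MvPowerSeries.coeff m (MvPowerSeries.C
        ((y * x ^ N) ^ weight w * zeroTail (fun b => x ^ b / (1 - x ^ b)) w))) := by
  by_cases h : m = 0 ∧ ∀ a ∈ w, a.1 = 0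
  · obtain ⟨rfl, hw⟩ := h
    rw [MvPowerSeries.coeff_zero_C]
    exact (hasSum_zeroTail x y hx w hw N).1
  · have : IsEmpty (occurrenceSet Prod.fst w N m) :=
      ⟨fun I => h (eq_zero_of_mem_occurrenceSet hm I.2)⟩
    have h0 : MvPowerSeries.coeff m (MvPowerSeries.C
        ((y * x ^ N) ^ weight w * zeroTail (fun b => x ^ b / (1 - x ^ b)) w)) = 0 := by
      rw [MvPowerSeries.coeff_C]
      split_ifs with h0
      · rw [zeroTail_eq_zero _ fun hw => h ⟨h0, hw⟩, mul_zero]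
      · rfl
    rw [h0]
    exact hasSum_empty

/-! ### Convergent Laurent series -/

theorem hasSum_of_hasSum_int {a : ℤ → ℂ} {k : ℤ} (ha : ∀ n < k, a n = 0) {z s : ℂ} (hz : z ≠ 0)
    (h : HasSum (fun n : ℤ => a n * z ^ n) s) :
    HasSum (fun n : ℕ => a (k + n) * z ^ n) (s * z ^ (-k)) := by
  have hinj : Function.Injective fun n : ℕ => k + (n : ℤ) := fun n n' h => by simpa using h
  have h1 := (hinj.hasSum_iff (f := fun n : ℤ => a n * z ^ n) fun n hn => ?_).2 h
  · refine (h1.mul_right (z ^ (-k))).congr_fun fun n => ?_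
    rw [Function.comp_apply, zpow_add₀ hz, zpow_neg, zpow_natCast]
    field_simp
  · rw [ha n, zero_mul]
    by_contra hk
    exact hn ⟨(n - k).toNat, by simp only; omega⟩

theorem hasSum_int_of_hasSum_nat {a : ℕ → ℂ} {z s : ℂ} (h : HasSum (fun n => a n * z ^ n) s)
    {b : ℤ → ℂ} (hb : ∀ n : ℕ, b n = a n) (hb' : ∀ n < 0, b n = 0) :
    HasSum (fun n : ℤ => b n * z ^ n) s := by
  refine ((Nat.cast_injective (R := ℤ)).hasSum_iff fun n hn => ?_).1 (h.congr_fun fun n => ?_)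
  · rw [hb' n, zero_mul]
    by_contra hk
    exact hn ⟨n.toNat, by omega⟩
  · simp [hb]

instance neBot_nhdsWithin_re_neg : (nhdsWithin (0 : ℂ) {z : ℂ | z.re < 0}).NeBot := by
  rw [← mem_closure_iff_nhdsWithin_neBot, Metric.mem_closure_iff]
  intro ε hε
  refine ⟨-(ε / 2 : ℝ), ?_, ?_⟩
  · simp [hε]
  · rw [dist_eq_norm, zero_sub, neg_neg, Complex.norm_real, Real.norm_eq_abs, abs_of_pos (by positivity)]
    linarith

theorem nhdsWithin_re_neg_le : nhdsWithin (0 : ℂ) {z : ℂ | z.re < 0} ≤ nhdsWithin 0 {0}ᶜ :=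
  nhdsWithin_mono _ fun z hz h => by
    rw [Set.mem_singleton_iff] at h
    subst h
    exact absurd hz (by simp)

/-- Convergence at a single nonzero point gives a positive radius of convergence; the analytic sum
vanishes at points that accumulate at 0, so the identity theorem applies although only a half-plane
is known. -/
theorem eq_zero_of_hasSum_zero {a : ℕ → ℂ}
    (h : ∀ᶠ z : ℂ in nhdsWithin 0 {z : ℂ | z.re < 0}, HasSum (fun n => a n * z ^ n) 0) (n : ℕ) :
    a n = 0 := by
  let p := FormalMultilinearSeries.ofScalars ℂ a
  have hterm (z : ℂ) (n : ℕ) : p n (fun _ => z) = a n * z ^ n := by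
    simp [p, FormalMultilinearSeries.ofScalars]
  obtain ⟨z₀, hz₀, hz₀'⟩ := (h.and (eventually_mem_nhdsWithin.filter_mono nhdsWithin_re_neg_le)).exists
  have hrad : 0 < p.radius := by
    refine lt_of_lt_of_le ?_ (p.le_radius_of_summable_norm (r := ‖z₀‖₊) ?_)
    · simpa using hz₀'
    · refine hz₀.summable.norm.congr fun n => ?_
      simp [p]
  have hp := p.hasFPowerSeriesOnBall hrad
  have hzero : ∃ᶠ z in nhdsWithin (0 : ℂ) {0}ᶜ, p.sum z = 0 := by
    refine Filter.Frequently.filter_mono (Filter.Eventually.frequently ?_) nhdsWithin_re_neg_le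
    filter_upwards [h] with z hz
    rw [FormalMultilinearSeries.sum, ← hz.tsum_eq]
    exact tsum_congr (hterm z)
  have hev := (hp.analyticAt.frequently_zero_iff_eventually_zero).1 hzero
  have hp0 : p = 0 := (hp.hasFPowerSeriesAt.congr hev).eq_zero
  have := hterm 1 n
  rw [hp0] at this
  simpa using this.symm

theorem laurentSeries_eq_of_hasSum {G H : LaurentSeries ℂ}
    (h : ∀ᶠ z : ℂ in nhdsWithin 0 {z : ℂ | z.re < 0}, ∃ s,
      HasSum (fun n : ℤ => G.coeff n * z ^ n) s ∧ HasSum (fun n : ℤ => H.coeff n * z ^ n) s) :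
    G = H := by
  rw [← sub_eq_zero]
  ext n
  by_cases hn : n < (G - H).order
  · exact HahnSeries.coeff_eq_zero_of_lt_order hn
  · have h0 (k : ℕ) : (G - H).coeff ((G - H).order + k) = 0 := by
      refine eq_zero_of_hasSum_zero (a := fun k => (G - H).coeff ((G - H).order + k)) ?_ k
      filter_upwards [h, nhdsWithin_re_neg_le self_mem_nhdsWithin] with z ⟨s, h1, h2⟩ hz
      have h3 : HasSum (fun n : ℤ => (G - H).coeff n * z ^ n) 0 := by
        rw [← sub_self s]
        exact (h1.sub h2).congr_fun fun n => by rw [HahnSeries.coeff_sub, sub_mul]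
      simpa using hasSum_of_hasSum_int (fun n => HahnSeries.coeff_eq_zero_of_lt_order) hz h3
    have := h0 (n - (G - H).order).toNat
    rw [Int.toNat_of_nonneg (by omega)] at this
    simpa using this

theorem hasSum_mul_of_complete {ι κ : Type*} {f : ι → ℂ} {g : κ → ℂ} {s t : ℂ} (hf : HasSum f s)
    (hg : HasSum g t) : HasSum (fun p : ι × κ => f p.1 * g p.2) (s * t) :=
  hf.mul hg (summable_mul_of_summable_norm hf.summable.norm hg.summable.norm)

/-- The Laurent series `G`, with coefficients mapped to `ℂ[[X]]` by `φ`, converges at `z`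
coefficientwise, with sum `g`. -/
def HasLaurentSum {R : Type*} [CommRing R] (φ : R →+* MvPowerSeries ℕ+ ℂ) (z : ℂ)
    (G : LaurentSeries R) (g : MvPowerSeries ℕ+ ℂ) : Prop :=
  ∀ m, HasSum (fun n : ℤ => MvPowerSeries.coeff m (φ (G.coeff n)) * z ^ n) (MvPowerSeries.coeff m g)

namespace HasLaurentSum
variable {R : Type*} [CommRing R] {φ : R →+* MvPowerSeries ℕ+ ℂ} {z : ℂ}
  {G H : LaurentSeries R} {g h : MvPowerSeries ℕ+ ℂ}

theorem add (hG : HasLaurentSum φ z G g) (hH : HasLaurentSum φ z H h) :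
    HasLaurentSum φ z (G + H) (g + h) := fun m => by
  rw [map_add]
  exact ((hG m).add (hH m)).congr_fun fun n => by rw [HahnSeries.coeff_add, map_add, map_add, add_mul]

theorem sub (hG : HasLaurentSum φ z G g) (hH : HasLaurentSum φ z H h) :
    HasLaurentSum φ z (G - H) (g - h) := fun m => by
  rw [map_sub]
  exact ((hG m).sub (hH m)).congr_fun fun n => by rw [HahnSeries.coeff_sub, map_sub, map_sub, sub_mul]

/-- Convergent families in `ℂ` converge absolutely, so the double family may be regrouped by total
degree in `z`. Each coefficient in `X` involves only finitely many products of coefficients. -/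
theorem mul (hz : z ≠ 0) (hG : HasLaurentSum φ z G g) (hH : HasLaurentSum φ z H h) :
    HasLaurentSum φ z (G * H) (g * h) := fun m => by
  classical
  obtain ⟨a, ha⟩ : ∃ a : (ℕ+ →₀ ℕ) → ℤ → ℂ, ∀ q n, MvPowerSeries.coeff q (φ (G.coeff n)) = a q n :=
    ⟨_, fun _ _ => rfl⟩
  obtain ⟨b, hb⟩ : ∃ b : (ℕ+ →₀ ℕ) → ℤ → ℂ, ∀ q n, MvPowerSeries.coeff q (φ (H.coeff n)) = b q n :=
    ⟨_, fun _ _ => rfl⟩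
  have h1 : HasSum (fun p : ℤ × ℤ =>
      MvPowerSeries.coeff m (φ (G.coeff p.1) * φ (H.coeff p.2)) * z ^ (p.1 + p.2))
      (MvPowerSeries.coeff m (g * h)) := by
    rw [MvPowerSeries.coeff_mul]
    have h2 (q : (ℕ+ →₀ ℕ) × (ℕ+ →₀ ℕ)) : HasSum (fun p : ℤ × ℤ =>
        (a q.1 p.1 * z ^ p.1) * (b q.2 p.2 * z ^ p.2))
        (MvPowerSeries.coeff q.1 g * MvPowerSeries.coeff q.2 h) :=
      hasSum_mul_of_complete (f := fun n => a q.1 n * z ^ n) (g := fun n => b q.2 n * z ^ n)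
        ((hG q.1).congr_fun fun n => by rw [ha]) ((hH q.2).congr_fun fun n => by rw [hb])
    refine (hasSum_sum (s := Finset.HasAntidiagonal.antidiagonal m) fun q _ => h2 q).congr_fun fun p => ?_
    rw [MvPowerSeries.coeff_mul, Finset.sum_mul]
    refine Finset.sum_congr rfl fun q _ => ?_
    rw [zpow_add₀ hz, ha, hb]
    ring
  -- Coordinates (total degree, degree in the first factor), so that the fibre over `n` is the
  -- convolution sum for the coefficient of `zⁿ`.
  let e : ℤ × ℤ ≃ ℤ × ℤ :=
    { toFun := fun p => (p.2, p.1 - p.2)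
      invFun := fun p => (p.1 + p.2, p.1)
      left_inv := fun p => by simp
      right_inv := fun p => by simp }
  rw [← e.hasSum_iff] at h1
  refine h1.prod_fiberwise fun n => ?_
  simp only [e, Function.comp_apply, Equiv.coe_fn_mk, add_sub_cancel]
  refine HasSum.mul_right _ ?_
  set s := Finset.antidiagonal G.isPWO_support H.isPWO_support n
  have hs : MvPowerSeries.coeff m (φ ((G * H).coeff n)) = ∑ i ∈ s.image Prod.fst,
      MvPowerSeries.coeff m (φ (G.coeff i) * φ (H.coeff (n - i))) := by
    rw [Finset.sum_image, HahnSeries.coeff_mul, map_sum, map_sum]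
    · refine Finset.sum_congr rfl fun p hp => ?_
      rw [map_mul, ← (Finset.mem_antidiagonal.1 hp).2.2, add_sub_cancel_left]
    · intro p hp q hq hpq
      have h2 := (Finset.mem_antidiagonal.1 hp).2.2
      have h3 := (Finset.mem_antidiagonal.1 hq).2.2
      exact Prod.ext hpq (by omega)
  rw [hs]
  refine hasSum_sum_of_ne_finset_zero fun i hi => ?_
  by_cases h2 : G.coeff i = 0
  · simp [h2]
  by_cases h3 : H.coeff (n - i) = 0
  · simp [h3]
  exact absurd (Finset.mem_image.2 ⟨(i, n - i), Finset.mem_antidiagonal.2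
    ⟨h2, h3, by simp⟩, rfl⟩) hi

theorem ofPowerSeries {p : PowerSeries R} {a : ℕ → ℂ}
    (hp : ∀ n, φ (PowerSeries.coeff n p) = MvPowerSeries.C (a n)) {s : ℂ}
    (h : HasSum (fun n => a n * z ^ n) s) :
    HasLaurentSum φ z (HahnSeries.ofPowerSeries ℤ R p) (MvPowerSeries.C s) := fun m => by
  rw [MvPowerSeries.coeff_C]
  have hneg (n : ℤ) (hn : n < 0) : (HahnSeries.ofPowerSeries ℤ R p).coeff n = 0 := by
    rw [PowerSeries.coeff_coe, if_pos hn]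
  split_ifs with hm
  · refine hasSum_int_of_hasSum_nat h (fun n => ?_) fun n hn => by rw [hneg n hn]; simp
    rw [LaurentSeries.coeff_coe_powerSeries, hp, MvPowerSeries.coeff_C, if_pos hm]
  · convert hasSum_zero with n
    rcases lt_or_ge n 0 with hn | hn
    · rw [hneg n hn]; simp
    · lift n to ℕ using hn
      rw [LaurentSeries.coeff_coe_powerSeries, hp, MvPowerSeries.coeff_C, if_neg hm, zero_mul]

theorem single (n : ℤ) (r : R) :
    HasLaurentSum φ z (HahnSeries.single n r) (φ r * MvPowerSeries.C (z ^ n)) := fun m => by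
  rw [MvPowerSeries.coeff_mul_C]
  convert hasSum_single n fun k hk => ?_ using 1
  · rw [HahnSeries.coeff_single_same]
  · rw [HahnSeries.coeff_single_of_ne hk]; simp

theorem prefixSum {A : Type*} (hz : z ≠ 0) {l : List (A → LaurentSeries R)}
    {l' : List (A → MvPowerSeries ℕ+ ℂ)}
    (hl : List.Forall₂ (fun e e' => ∀ a, HasLaurentSum φ z (e a) (e' a)) l l')
    {τ : List A → LaurentSeries R} {τ' : List A → MvPowerSeries ℕ+ ℂ} {w : List A}
    (hτ : ∀ v, v <:+ w → HasLaurentSum φ z (τ v) (τ' v)) :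
    HasLaurentSum φ z (prefixSum l τ w) (prefixSum l' τ' w) := by
  induction hl generalizing w with
  | nil => exact hτ w List.suffix_rfl
  | cons he hl ih =>
    cases w with
    | nil => exact ih hτ
    | cons a w =>
      exact (ih hτ).add ((he a).mul hz (ih fun v hv => hτ v (hv.trans (List.suffix_cons a w))))

end HasLaurentSum

/-! ### Exponential series -/

/-- The power series `exp (c z)`. -/
noncomputable def expSeries {R : Type*} [CommRing R] [Algebra ℚ R] (c : R) : PowerSeries R :=
  PowerSeries.rescale c (PowerSeries.exp R)

/-- The Laurent series `exp (b z) / (1 - exp (b z))`. -/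
noncomputable def geomSeries (R : Type*) [CommRing R] [Algebra ℚ R] (b : ℕ) : LaurentSeries R :=
  HahnSeries.single (-1) (-algebraMap ℚ R (b : ℚ)⁻¹) *
    HahnSeries.ofPowerSeries ℤ R (PowerSeries.rescale (b : R) (bernoulli'PowerSeries R))

section expSeries
variable {R : Type*} [CommRing R] [Algebra ℚ R]

theorem expSeries_add (c d : R) : expSeries (c + d) = expSeries c * expSeries d :=
  (PowerSeries.exp_mul_exp_eq_exp_add c d).symm

theorem coeff_expSeries (c : R) (n : ℕ) :
    PowerSeries.coeff n (expSeries c) = c ^ n * algebraMap ℚ R (1 / n.factorial) := by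
  rw [expSeries, PowerSeries.coeff_rescale, PowerSeries.coeff_exp]

theorem hasSum_cexp (c z : ℂ) :
    HasSum (fun n : ℕ => c ^ n * algebraMap ℚ ℂ (1 / n.factorial) * z ^ n) (Complex.exp (c * z)) := by
  rw [Complex.exp_eq_exp_ℂ]
  refine (NormedSpace.expSeries_div_hasSum_exp (c * z)).congr_fun fun n => ?_
  rw [mul_pow, map_div₀, map_one, map_natCast]
  ring

theorem hasLaurentSum_expSeries {φ : R →+* MvPowerSeries ℕ+ ℂ} (z : ℂ) {c : R} {c' : ℂ}
    (hc : φ c = MvPowerSeries.C c') :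
    HasLaurentSum φ z (HahnSeries.ofPowerSeries ℤ R (expSeries c))
      (MvPowerSeries.C (Complex.exp (c' * z))) := by
  refine HasLaurentSum.ofPowerSeries (fun n => ?_) (hasSum_cexp c' z)
  have h : φ.comp (algebraMap ℚ R) = MvPowerSeries.C.comp (algebraMap ℚ ℂ) := Subsingleton.elim _ _
  rw [coeff_expSeries, map_mul, map_pow, hc, map_mul, map_pow]
  exact congrArg _ (RingHom.congr_fun h _)

/-- The generating function of the Bernoulli numbers satisfies `B(u) (e^u - 1) = u e^u`; put `u = b
z` and divide by `-b z`. -/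
theorem geomSeries_mul_one_sub {b : ℕ} (hb : b ≠ 0) :
    geomSeries R b * (1 - HahnSeries.ofPowerSeries ℤ R (expSeries (b : R))) =
      HahnSeries.ofPowerSeries ℤ R (expSeries (b : R)) := by
  have h := congrArg (PowerSeries.rescale (b : R)) (bernoulli'PowerSeries_mul_exp_sub_one R)
  rw [map_mul, map_mul, map_sub, map_one, PowerSeries.rescale_X] at h
  have h' := congrArg (HahnSeries.ofPowerSeries ℤ R) h
  simp only [map_mul, map_sub, map_one] at h'
  rw [HahnSeries.ofPowerSeries_X, HahnSeries.ofPowerSeries_C] at h'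
  have h1 : HahnSeries.single (-1) (-algebraMap ℚ R (b : ℚ)⁻¹) *
      (HahnSeries.C (b : R) * HahnSeries.single (1 : ℤ) (1 : R)) = -1 := by
    rw [HahnSeries.C_apply, HahnSeries.single_mul_single, HahnSeries.single_mul_single, mul_one,
      ← map_natCast (algebraMap ℚ R), neg_mul, ← map_mul, inv_mul_cancel₀ (by exact_mod_cast hb), map_one]
    exact map_neg (HahnSeries.C (Γ := ℤ)) (1 : R)
  rw [geomSeries]
  simp only [expSeries] at *
  linear_combination -HahnSeries.single (-1) (-algebraMap ℚ R (b : ℚ)⁻¹) * h' -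
    HahnSeries.ofPowerSeries ℤ R ((PowerSeries.rescale (b : R)) (PowerSeries.exp R)) * h1

theorem bernoulli'PowerSeries_eq_of_mul {p : PowerSeries ℂ}
    (h : p * (PowerSeries.exp ℂ - 1) = PowerSeries.X * PowerSeries.exp ℂ) :
    p = bernoulli'PowerSeries ℂ := by
  refine mul_right_cancel₀ (b := PowerSeries.exp ℂ - 1) (fun h0 => ?_)
    (h.trans (bernoulli'PowerSeries_mul_exp_sub_one ℂ).symm)
  have := congrArg (PowerSeries.coeff 1) h0
  simp [PowerSeries.coeff_exp, PowerSeries.coeff_one] at this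

/-- The function is `e^z` divided by the slope `(e^z - 1)/z`, which is analytic with value 1 at the
origin. So it has a convergent Taylor series, and this series is the Bernoulli series because both
solve `p (e^z - 1) = z e^z`. -/
theorem eventually_hasSum_bernoulli' : ∀ᶠ z : ℂ in nhdsWithin 0 {0}ᶜ,
    HasSum (fun n => algebraMap ℚ ℂ (bernoulli' n / n.factorial) * z ^ n)
      (z * Complex.exp z / (Complex.exp z - 1)) := by
  let g := dslope Complex.exp 0
  have hg : AnalyticAt ℂ g 0 := by
    obtain ⟨p, hp⟩ := (analyticAt_cexp (z := (0 : ℂ)))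
    exact hp.has_fpower_series_dslope_fslope.analyticAt
  have hg0 : g 0 ≠ 0 := by simp [g, dslope_same]
  obtain ⟨p, hp⟩ := (analyticAt_cexp (z := (0 : ℂ))).mul (hg.inv hg0)
  have hsum := (nhdsWithin_le_nhds (s := {0}ᶜ)) (hasFPowerSeriesAt_iff.1 hp)
  have hsum' : ∀ᶠ z : ℂ in nhdsWithin 0 {0}ᶜ, HasSum (fun n => p.coeff n * z ^ n)
      (z * Complex.exp z / (Complex.exp z - 1)) := by
    filter_upwards [hsum, self_mem_nhdsWithin] with z hz hz0
    have hz0 : z ≠ 0 := hz0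
    have hval : (Complex.exp * g⁻¹) (0 + z) = z * Complex.exp z / (Complex.exp z - 1) := by
      simp only [zero_add, Pi.mul_apply, Pi.inv_apply, g, dslope_of_ne _ hz0, slope_def_field,
        Complex.exp_zero, sub_zero, inv_div]
      ring
    rw [← hval]
    exact HasSum.congr_fun hz fun n => by rw [smul_eq_mul, mul_comm]
  have hp' : PowerSeries.mk p.coeff = bernoulli'PowerSeries ℂ := by
    refine bernoulli'PowerSeries_eq_of_mul ?_
    -- The formal identity is read off from values with `Re z < 0`, where `|e^z| < 1` excludes a
    -- zero of the denominator.
    refine HahnSeries.ofPowerSeries_injective (Γ := ℤ) (laurentSeries_eq_of_hasSum ?_)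
    filter_upwards [nhdsWithin_re_neg_le hsum', nhdsWithin_re_neg_le self_mem_nhdsWithin,
      self_mem_nhdsWithin] with z hz hz0 hz1
    have hz0 : z ≠ 0 := hz0
    have hz2 : Complex.exp z - 1 ≠ 0 := by
      intro h
      have h2 := congrArg norm (sub_eq_zero.1 h)
      rw [Complex.norm_exp, norm_one, Real.exp_eq_one_iff] at h2
      exact hz1.ne h2
    have hC : ∀ n (q : PowerSeries ℂ), (MvPowerSeries.C (σ := ℕ+)) (PowerSeries.coeff n q) =
      MvPowerSeries.C (PowerSeries.coeff n q) := fun _ _ => rfl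
    have hexp : HasLaurentSum MvPowerSeries.C z
        (HahnSeries.ofPowerSeries ℤ ℂ (PowerSeries.exp ℂ)) (MvPowerSeries.C (Complex.exp z)) := by
      have := hasLaurentSum_expSeries (φ := MvPowerSeries.C (σ := ℕ+)) z (c := (1 : ℂ)) rfl
      rwa [one_mul, expSeries, PowerSeries.rescale_one] at this
    have hone : HasLaurentSum MvPowerSeries.C z
        (1 : LaurentSeries ℂ) (MvPowerSeries.C (σ := ℕ+) (1 : ℂ)) := by
      have := HasLaurentSum.single (φ := MvPowerSeries.C (σ := ℕ+)) (z := z) 0 (1 : ℂ)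
      simpa using this
    have hX : HasLaurentSum MvPowerSeries.C z (HahnSeries.single (1 : ℤ) (1 : ℂ))
        (MvPowerSeries.C (σ := ℕ+) z) := by
      have := HasLaurentSum.single (φ := MvPowerSeries.C (σ := ℕ+)) (z := z) 1 (1 : ℂ)
      simpa using this
    have h1 := (HasLaurentSum.ofPowerSeries (φ := MvPowerSeries.C) (p := PowerSeries.mk p.coeff)
      (fun n => by rw [PowerSeries.coeff_mk]) hz).mul hz0 (hexp.sub hone)
    have h2 := hX.mul hz0 hexp
    refine ⟨z * Complex.exp z, ?_, ?_⟩
    · rw [map_mul, map_sub, map_one]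
      have := h1 0
      rw [← map_sub, ← map_mul, div_mul_cancel₀ _ hz2] at this
      simpa using this
    · rw [map_mul, HahnSeries.ofPowerSeries_X]
      have := h2 0
      rw [← map_mul] at this
      simpa using this
  filter_upwards [hsum'] with z hz
  refine hz.congr_fun fun n => ?_
  rw [← PowerSeries.coeff_mk n p.coeff, hp', bernoulli'PowerSeries, PowerSeries.coeff_mk]

theorem eventually_hasLaurentSum_geomSeries (φ : R →+* MvPowerSeries ℕ+ ℂ) {b : ℕ} (hb : b ≠ 0) :
    ∀ᶠ z : ℂ in nhdsWithin 0 {z : ℂ | z.re < 0}, HasLaurentSum φ z (geomSeries R b)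
      (MvPowerSeries.C (Complex.exp z ^ b / (1 - Complex.exp z ^ b))) := by
  have htend : Filter.Tendsto (fun z : ℂ => b * z) (nhdsWithin 0 {z : ℂ | z.re < 0})
      (nhdsWithin 0 {0}ᶜ) := by
    refine tendsto_nhdsWithin_iff.2 ⟨?_, ?_⟩
    · have : Filter.Tendsto (fun z : ℂ => b * z) (nhds 0) (nhds (b * 0)) :=
        (continuous_const.mul continuous_id).tendsto 0
      rw [mul_zero] at this
      exact this.mono_left nhdsWithin_le_nhds
    · filter_upwards [nhdsWithin_re_neg_le self_mem_nhdsWithin] with z hz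
      exact mul_ne_zero (Nat.cast_ne_zero.2 hb) hz
  have halg : φ.comp (algebraMap ℚ R) = MvPowerSeries.C.comp (algebraMap ℚ ℂ) :=
    Subsingleton.elim _ _
  filter_upwards [htend.eventually eventually_hasSum_bernoulli',
    nhdsWithin_re_neg_le self_mem_nhdsWithin, self_mem_nhdsWithin] with z hz hz0 hz1
  have hz0 : z ≠ 0 := hz0
  have h1 : HasLaurentSum φ z (HahnSeries.ofPowerSeries ℤ R
      (PowerSeries.rescale (b : R) (bernoulli'PowerSeries R)))
      (MvPowerSeries.C (b * z * Complex.exp (b * z) / (Complex.exp (b * z) - 1))) := by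
    refine HasLaurentSum.ofPowerSeries (a := fun n =>
      b ^ n * algebraMap ℚ ℂ (bernoulli' n / n.factorial)) (fun n => ?_) (hz.congr_fun fun n => ?_)
    · rw [PowerSeries.coeff_rescale, bernoulli'PowerSeries, PowerSeries.coeff_mk, map_mul, map_pow,
        map_natCast, map_mul, map_pow, map_natCast]
      exact congrArg _ (RingHom.congr_fun halg _)
    · rw [mul_pow]; ring
  have h2 := (HasLaurentSum.single (φ := φ) (z := z) (-1) (-algebraMap ℚ R (b : ℚ)⁻¹)).mul hz0 h1
  have h3 : φ (algebraMap ℚ R (b : ℚ)⁻¹) = MvPowerSeries.C (b : ℂ)⁻¹ := by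
    rw [show φ (algebraMap ℚ R (b : ℚ)⁻¹) = MvPowerSeries.C (algebraMap ℚ ℂ (b : ℚ)⁻¹) from
      RingHom.congr_fun halg _, map_inv₀, map_natCast]
  have hb' : (b : ℂ) ≠ 0 := Nat.cast_ne_zero.2 hb
  rw [map_neg φ, h3, ← map_neg MvPowerSeries.C, ← map_mul, ← map_mul] at h2
  have hval : -(b : ℂ)⁻¹ * z ^ (-1 : ℤ) * (b * z * Complex.exp (b * z) / (Complex.exp (b * z) - 1)) =
      Complex.exp z ^ b / (1 - Complex.exp z ^ b) := by
    rw [Complex.exp_nat_mul, zpow_neg_one, ← neg_sub, div_neg]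
    field_simp
  rw [hval] at h2
  exact h2

end expSeries

/-! ### Existence and uniqueness of the regularization -/

/-- The map `ℚ[[X]][t] → ℂ[[X]]` that evaluates `t` at a real number. -/
noncomputable def evalT (t : ℝ) : PowerSeriesT ℚ →+* MvPowerSeries ℕ+ ℂ :=
  Polynomial.eval₂RingHom (MvPowerSeries.map (algebraMap ℚ ℂ)) (MvPowerSeries.C (t : ℂ))

theorem coeffEval_eq_coeff_evalT (m : ℕ+ →₀ ℕ) (t : ℝ) (p : PowerSeriesT ℚ) :
    coeffEval m t p = MvPowerSeries.coeff m (evalT t p) := by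
  rw [evalT, Polynomial.coe_eval₂RingHom, Polynomial.eval₂_eq_sum, coeffEval, Polynomial.sum,
    Polynomial.sum, map_sum]
  refine Finset.sum_congr rfl fun s _ => ?_
  rw [← map_pow, MvPowerSeries.coeff_mul_C, MvPowerSeries.coeff_map, eq_ratCast]

theorem coeffEval_eq_eval (m : ℕ+ →₀ ℕ) (t : ℝ) (p : PowerSeriesT ℚ) (D : ℕ)
    (hD : p.natDegree < D) : coeffEval m t p = (∑ s ∈ Finset.range D,
      Polynomial.monomial s ((MvPowerSeries.coeff m (p.coeff s) : ℚ) : ℂ)).eval (t : ℂ) := by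
  rw [coeffEval, Polynomial.sum_over_range' _ (by simp) _ hD, Polynomial.eval_finsetSum]
  simp only [Polynomial.eval_monomial]

theorem coeffEval_congr {m : ℕ+ →₀ ℕ} {p q : PowerSeriesT ℚ}
    (h : ∀ s, MvPowerSeries.coeff m (p.coeff s) = MvPowerSeries.coeff m (q.coeff s)) (t : ℝ) :
    coeffEval m t p = coeffEval m t q := by
  have hp : p.natDegree < max p.natDegree q.natDegree + 1 := by omega
  have hq : q.natDegree < max p.natDegree q.natDegree + 1 := by omega
  rw [coeffEval_eq_eval m t p _ hp, coeffEval_eq_eval m t q _ hq]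
  simp only [h]

/-- For a fixed monomial both sides are polynomials in `t`, and they agree at all natural numbers.
-/
theorem coeff_eq_of_coeffEval_eq {m : ℕ+ →₀ ℕ} {p q : PowerSeriesT ℚ}
    (h : ∀ t : ℝ, 0 ≤ t → coeffEval m t p = coeffEval m t q) (s : ℕ) :
    MvPowerSeries.coeff m (p.coeff s) = MvPowerSeries.coeff m (q.coeff s) := by
  have hp : p.natDegree < max p.natDegree q.natDegree + 1 := by omega
  have hq : q.natDegree < max p.natDegree q.natDegree + 1 := by omega
  have h1 : (∑ s ∈ Finset.range (max p.natDegree q.natDegree + 1),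
      Polynomial.monomial s ((MvPowerSeries.coeff m (p.coeff s) : ℚ) : ℂ)) =
      ∑ s ∈ Finset.range (max p.natDegree q.natDegree + 1),
      Polynomial.monomial s ((MvPowerSeries.coeff m (q.coeff s) : ℚ) : ℂ) := by
    refine Polynomial.eq_of_infinite_eval_eq _ _
      ((Set.infinite_range_of_injective (Nat.cast_injective (R := ℂ))).mono ?_)
    rintro _ ⟨n, rfl⟩
    have h2 := h n (Nat.cast_nonneg n)
    rw [coeffEval_eq_eval m _ p _ hp, coeffEval_eq_eval m _ q _ hq] at h2
    simpa using h2
  by_cases hs : s < max p.natDegree q.natDegree + 1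
  · have h2 := congrArg (Polynomial.coeff · s) h1
    simp only [Polynomial.finsetSum_coeff, Polynomial.coeff_monomial, Finset.sum_ite_eq',
      Finset.mem_range, if_pos hs] at h2
    exact_mod_cast h2
  · rw [Polynomial.coeff_eq_zero_of_natDegree_lt (by omega),
      Polynomial.coeff_eq_zero_of_natDegree_lt (by omega)]

/-- The condition on a regularization, for one monomial. -/
def IsRegularizationAt (m : ℕ+ →₀ ℕ) (w : List (ℕ × ℕ+)) (F : LaurentSeries (PowerSeriesT ℚ)) :
    Prop :=
  ∀ t : ℝ, 0 ≤ t → ∀ᶠ z : ℂ in nhdsWithin 0 {z : ℂ | z.re < 0},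
    ∃ s : ℂ,
      HasSum (fun I : Occurrence (fun j => (w.get j).1) m =>
        ∏ j, Complex.exp ((((I.1 j : ℕ) : ℂ) + (t : ℂ)) * ((w.get j).2 : ℕ) * z)) s ∧
      HasSum (fun n : ℤ => coeffEval m t (F.coeff n) * z ^ n) s

/-- The coefficients at `x^m` agree. -/
def AgreeAt (m : ℕ+ →₀ ℕ) (F F' : LaurentSeries (PowerSeriesT ℚ)) : Prop :=
  ∀ n s, MvPowerSeries.coeff m ((F.coeff n).coeff s) = MvPowerSeries.coeff m ((F'.coeff n).coeff s)

theorem IsRegularizationAt.congr {m : ℕ+ →₀ ℕ} {w : List (ℕ × ℕ+)}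
    {F F' : LaurentSeries (PowerSeriesT ℚ)} (h : IsRegularizationAt m w F) (hF : AgreeAt m F F') :
    IsRegularizationAt m w F' := fun t ht => by
  filter_upwards [h t ht] with z ⟨s, h1, h2⟩
  exact ⟨s, h1, h2.congr_fun fun n => by rw [coeffEval_congr (hF n)]⟩

/-- For each `t ≥ 0` the two numerical Laurent series have the same sum near 0 and so the same
coefficients; these are polynomials in `t`. -/
theorem IsRegularizationAt.agreeAt {m : ℕ+ →₀ ℕ} {w : List (ℕ × ℕ+)}
    {F F' : LaurentSeries (PowerSeriesT ℚ)} (h : IsRegularizationAt m w F)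
    (h' : IsRegularizationAt m w F') : AgreeAt m F F' := fun n s => by
  refine coeff_eq_of_coeffEval_eq (fun t ht => ?_) s
  let f : ZeroHom (PowerSeriesT ℚ) ℂ :=
    ⟨coeffEval m t, by rw [coeffEval_eq_coeff_evalT, map_zero, map_zero]⟩
  have key : F.map f = F'.map f := by
    refine laurentSeries_eq_of_hasSum ?_
    filter_upwards [h t ht, h' t ht] with z ⟨s, h1, h2⟩ ⟨s', h1', h2'⟩
    obtain rfl := h1.unique h1'
    exact ⟨s, h2, h2'⟩
  exact congrArg (fun G => HahnSeries.coeff G n) key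

/-- The letter `a` evaluated at the index `i`, as a power series in `z`. -/
noncomputable def indexLetter (i : ℕ+) (a : ℕ × ℕ+) : PowerSeries (PowerSeriesT ℚ) :=
  expSeries ((((i : ℕ) : PowerSeriesT ℚ) + Polynomial.X) * ((a.2 : ℕ) : PowerSeriesT ℚ)) *
    PowerSeries.C (Polynomial.C (MvPowerSeries.monomial (Finsupp.single i a.1) 1))

/-- The values of the letters at the indices `1, …, N`. -/
noncomputable def indexLetters (N : ℕ) : List (ℕ × ℕ+ → LaurentSeries (PowerSeriesT ℚ)) :=
  (List.range' 0 N).map fun i a => HahnSeries.ofPowerSeries ℤ _ (indexLetter i.succPNat a)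

/-- The Laurent series of the regularized sum over indices greater than `N`. -/
noncomputable def laurentTail (N : ℕ) (w : List (ℕ × ℕ+)) : LaurentSeries (PowerSeriesT ℚ) :=
  HahnSeries.ofPowerSeries ℤ _
    (expSeries (((N : PowerSeriesT ℚ) + Polynomial.X) * (weight w : PowerSeriesT ℚ))) *
    zeroTail (geomSeries (PowerSeriesT ℚ)) w

theorem evalT_natCast_add_X_mul (t : ℝ) (i b : ℕ) :
    evalT t (((i : PowerSeriesT ℚ) + Polynomial.X) * (b : PowerSeriesT ℚ)) =
      MvPowerSeries.C (((i : ℂ) + t) * b) := by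
  rw [map_mul, map_add, map_natCast, map_natCast, map_mul, map_add, map_natCast, map_natCast]
  congr 2
  simp [evalT]

theorem exp_add_mul_mul (i b : ℕ) (t z : ℂ) :
    Complex.exp ((i + t) * b * z) = (Complex.exp (t * z) * Complex.exp z ^ i) ^ b := by
  rw [← Complex.exp_nat_mul z, ← Complex.exp_add, ← Complex.exp_nat_mul]
  congr 1
  ring

theorem hasLaurentSum_indexLetter (t : ℝ) {z : ℂ} (hz : z ≠ 0) (i : ℕ+) (a : ℕ × ℕ+) :
    HasLaurentSum (evalT t) z (HahnSeries.ofPowerSeries ℤ _ (indexLetter i a))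
      (MvPowerSeries.monomial (Finsupp.single i a.1)
        ((Complex.exp (t * z) * Complex.exp z ^ (i : ℕ)) ^ (a.2 : ℕ))) := by
  have h1 := hasLaurentSum_expSeries (φ := evalT t) z (evalT_natCast_add_X_mul t i a.2)
  have h2 := HasLaurentSum.single (φ := evalT t) (z := z) 0
    (Polynomial.C (MvPowerSeries.monomial (Finsupp.single i a.1) (1 : ℚ)))
  rw [indexLetter, map_mul, HahnSeries.ofPowerSeries_C]
  convert h1.mul hz h2 using 1
  · rfl
  rw [zpow_zero, map_one MvPowerSeries.C, mul_one, exp_add_mul_mul]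
  rw [evalT, Polynomial.coe_eval₂RingHom, Polynomial.eval₂_C, MvPowerSeries.map_monomial, map_one,
    ← MvPowerSeries.monomial_zero_eq_C_apply, MvPowerSeries.monomial_mul_monomial, zero_add, mul_one]

theorem hasLaurentSum_zeroTail (φ : PowerSeriesT ℚ →+* MvPowerSeries ℕ+ ℂ) {z : ℂ} (hz : z ≠ 0)
    (w : List (ℕ × ℕ+)) (h : ∀ b ∈ Finset.Icc 1 (weight w), HasLaurentSum φ z (geomSeries _ b)
      (MvPowerSeries.C (Complex.exp z ^ b / (1 - Complex.exp z ^ b)))) :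
    HasLaurentSum φ z (zeroTail (geomSeries _) w)
      (MvPowerSeries.C (zeroTail (fun b => Complex.exp z ^ b / (1 - Complex.exp z ^ b)) w)) := by
  induction w with
  | nil => simpa [zeroTail] using HasLaurentSum.single (φ := φ) (z := z) 0 1
  | cons a w ih =>
    simp only [zeroTail]
    split_ifs
    · rw [map_mul]
      refine (h _ ?_).mul hz (ih fun b hb => h b ?_)
      · rw [Finset.mem_Icc, weight_cons]
        have := a.2.pos
        omega
      · rw [Finset.mem_Icc] at hb ⊢
        rw [weight_cons]
        omega
    · simpa using HasLaurentSum.single (φ := φ) (z := z) 0 0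

theorem weight_le_of_suffix {v w : List (ℕ × ℕ+)} (h : v <:+ w) : weight v ≤ weight w := by
  obtain ⟨u, rfl⟩ := h
  simp [weight]

/-- With `x = e^z` and `y = e^{tz}`, the letter with direction `b` at index `i` has the value `(y
x^i)^b`. The finite part and the tail are expanded separately, and convergent Laurent series may be
added and multiplied. -/
theorem isRegularizationAt_prefixSum {N : ℕ} {m : ℕ+ →₀ ℕ} (hm : SupportedBy N m)
    (w : List (ℕ × ℕ+)) :
    IsRegularizationAt m w (prefixSum (indexLetters N) (laurentTail N) w) := by
  intro t ht
  -- Every geometric series in the tail of a suffix of `w` has an exponent between 1 and `weight w`,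
  -- so finitely many neighbourhoods of 0 suffice.
  have hev : ∀ᶠ z : ℂ in nhdsWithin 0 {z : ℂ | z.re < 0}, ∀ b ∈ Finset.Icc 1 (weight w),
      HasLaurentSum (evalT t) z (geomSeries _ b)
        (MvPowerSeries.C (Complex.exp z ^ b / (1 - Complex.exp z ^ b))) :=
    (Filter.eventually_all_finset _).2 fun b hb =>
      eventually_hasLaurentSum_geomSeries _ (by have := (Finset.mem_Icc.1 hb).1; omega)
  filter_upwards [hev, nhdsWithin_re_neg_le self_mem_nhdsWithin, self_mem_nhdsWithin]
    with z hz hz0 hz1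
  have hz0 : z ≠ 0 := hz0
  have hx : ‖Complex.exp z‖ < 1 := by
    rw [Complex.norm_exp, Real.exp_lt_one_iff]; exact hz1
  set x := Complex.exp z
  set y := Complex.exp (t * z)
  let τ : List (ℕ × ℕ+) → MvPowerSeries ℕ+ ℂ := fun v => MvPowerSeries.C
    ((y * x ^ N) ^ weight v * zeroTail (fun b => x ^ b / (1 - x ^ b)) v)
  have h1 := hasSum_occurrenceSet Prod.fst (fun (a : ℕ × ℕ+) i => (y * x ^ (i : ℕ)) ^ (a.2 : ℕ)) τ 0
    N w m fun v hv m' hm' => by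
      rw [zero_add]
      exact hasSum_occurrenceSet_tail x y hx v (hm.mono hm')
  have h2 : HasLaurentSum (evalT t) z (prefixSum (indexLetters N) (laurentTail N) w)
      (prefixSum (letterWeights Prod.fst (fun (a : ℕ × ℕ+) i => (y * x ^ (i : ℕ)) ^ (a.2 : ℕ)) 0 N)
        τ w) := by
    refine HasLaurentSum.prefixSum hz0 ?_ fun v hv => ?_
    · rw [indexLetters, letterWeights, List.forall₂_map_left_iff, List.forall₂_map_right_iff,
        List.forall₂_same]
      exact fun i _ a => hasLaurentSum_indexLetter t hz0 i.succPNat a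
    · have h3 := hasLaurentSum_expSeries (φ := evalT t) z (evalT_natCast_add_X_mul t N (weight v))
      have h4 := h3.mul hz0 (hasLaurentSum_zeroTail (evalT t) hz0 v fun b hb => hz b
        (Finset.Icc_subset_Icc le_rfl (weight_le_of_suffix hv) hb))
      rw [exp_add_mul_mul, ← map_mul] at h4
      exact h4
  refine ⟨_, ?_, (h2 m).congr_fun fun n => by rw [coeffEval_eq_coeff_evalT]⟩
  · let e : Occurrence (fun j => (w.get j).1) m ≃ occurrenceSet Prod.fst w 0 m :=
      Equiv.subtypeEquivRight fun I => (mem_occurrenceSet_zero Prod.fst w m I).symm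
    refine ((e.hasSum_iff).2 h1).congr_fun fun I => ?_
    exact Finset.prod_congr rfl fun j _ => exp_add_mul_mul _ _ _ _

/-! ### Degree bounds in `t`, and gluing over all monomials -/

/-- The coefficient of `zⁿ` is a polynomial in `t` of degree at most `n + K`. -/
def DegreeLE {S : Type*} [CommRing S] (K : ℤ) (F : LaurentSeries (Polynomial S)) : Prop :=
  ∀ (n : ℤ) (s : ℕ), n + K < s → (F.coeff n).coeff s = 0

namespace DegreeLE
variable {S : Type*} [CommRing S] {K L : ℤ} {F G : LaurentSeries (Polynomial S)}

theorem mono (hF : DegreeLE K F) (h : K ≤ L) : DegreeLE L F := fun n s hs => hF n s (by omega)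

theorem add (hF : DegreeLE K F) (hG : DegreeLE K G) : DegreeLE K (F + G) := fun n s hs => by
  rw [HahnSeries.coeff_add, Polynomial.coeff_add, hF n s hs, hG n s hs, add_zero]

theorem mul (hF : DegreeLE K F) (hG : DegreeLE L G) : DegreeLE (K + L) (F * G) := fun n s hs => by
  rw [HahnSeries.coeff_mul, Polynomial.finsetSum_coeff]
  refine Finset.sum_eq_zero fun p hp => ?_
  rw [Polynomial.coeff_mul]
  refine Finset.sum_eq_zero fun q hq => ?_
  have h1 := (Finset.mem_antidiagonal.1 hp).2.2
  have h2 := Finset.HasAntidiagonal.mem_antidiagonal.1 hq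
  rcases lt_or_ge (p.1 + K) q.1 with h | h
  · rw [hF _ _ h, zero_mul]
  · rw [hG _ _ (by omega), mul_zero]

theorem ofPowerSeries {p : PowerSeries (Polynomial S)}
    (h : ∀ n, (PowerSeries.coeff n p).natDegree ≤ n) :
    DegreeLE 0 (HahnSeries.ofPowerSeries ℤ _ p) := fun n s hs => by
  rcases lt_or_ge n 0 with hn | hn
  · rw [PowerSeries.coeff_coe, if_pos hn, Polynomial.coeff_zero]
  · lift n to ℕ using hn
    rw [LaurentSeries.coeff_coe_powerSeries]
    exact Polynomial.coeff_eq_zero_of_natDegree_lt ((h n).trans_lt (by omega))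

theorem single_C (n : ℤ) (r : S) : DegreeLE (-n) (HahnSeries.single n (Polynomial.C r)) :=
  fun k s hs => by
    by_cases hk : k = n
    · subst hk
      rw [HahnSeries.coeff_single_same, Polynomial.coeff_C, if_neg (by omega)]
    · rw [HahnSeries.coeff_single_of_ne hk, Polynomial.coeff_zero]

theorem zero : DegreeLE K (0 : LaurentSeries (Polynomial S)) := fun n s hs => by simp

end DegreeLE

theorem degreeLE_expSeries (i b : ℕ) : DegreeLE 0 (HahnSeries.ofPowerSeries ℤ _
    (expSeries (((i : PowerSeriesT ℚ) + Polynomial.X) * (b : PowerSeriesT ℚ)))) := by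
  refine DegreeLE.ofPowerSeries fun n => ?_
  rw [coeff_expSeries, ← Polynomial.C_eq_natCast, ← Polynomial.C_eq_natCast,
    IsScalarTower.algebraMap_apply ℚ (MvPowerSeries ℕ+ ℚ) (PowerSeriesT ℚ)]
  refine Polynomial.natDegree_mul_le.trans ?_
  rw [Polynomial.algebraMap_eq, Polynomial.natDegree_C, add_zero]
  refine Polynomial.natDegree_pow_le.trans ?_
  refine (Nat.mul_le_mul_left n (m := 1) ?_).trans (mul_one n).le
  refine Polynomial.natDegree_mul_le.trans ?_
  rw [Polynomial.natDegree_C, add_zero]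
  refine (Polynomial.natDegree_add_le _ _).trans ?_
  rw [Polynomial.natDegree_C]
  simp

theorem degreeLE_geomSeries (b : ℕ) : DegreeLE 1 (geomSeries (PowerSeriesT ℚ) b) := by
  have h1 := DegreeLE.single_C (-1) (-algebraMap ℚ (MvPowerSeries ℕ+ ℚ) (b : ℚ)⁻¹)
  have h2 : DegreeLE 0 (HahnSeries.ofPowerSeries ℤ (PowerSeriesT ℚ)
      (PowerSeries.rescale (b : PowerSeriesT ℚ) (bernoulli'PowerSeries (PowerSeriesT ℚ)))) := by
    refine DegreeLE.ofPowerSeries fun n => ?_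
    rw [PowerSeries.coeff_rescale, bernoulli'PowerSeries, PowerSeries.coeff_mk,
      IsScalarTower.algebraMap_apply ℚ (MvPowerSeries ℕ+ ℚ) (PowerSeriesT ℚ),
      Polynomial.algebraMap_eq, ← Polynomial.C_eq_natCast, ← map_pow, ← map_mul,
      Polynomial.natDegree_C]
    exact Nat.zero_le n
  rw [map_neg] at h1
  exact h1.mul h2

theorem degreeLE_zeroTail (w : List (ℕ × ℕ+)) :
    DegreeLE w.length (zeroTail (geomSeries (PowerSeriesT ℚ)) w) := by
  induction w with
  | nil => simpa [zeroTail] using DegreeLE.single_C 0 (1 : MvPowerSeries ℕ+ ℚ)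
  | cons a w ih =>
    rw [zeroTail]
    split_ifs
    · exact ((degreeLE_geomSeries _).mul ih).mono (by simp [add_comm])
    · exact DegreeLE.zero

/-- In `exp((i + t) b z)` each power of `t` comes with a power of `z`, and each of at most `|w|`
geometric factors costs one power of `z`. The bound is free of `N`, hence common to all monomials.
-/
theorem degreeLE_prefixSum (N : ℕ) (w : List (ℕ × ℕ+)) :
    DegreeLE w.length (prefixSum (indexLetters N) (laurentTail N) w) := by
  have hl : ∀ e ∈ indexLetters N, ∀ a, DegreeLE 0 (e a) := by
    intro e he a
    obtain ⟨i, -, rfl⟩ := List.mem_map.1 he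
    simp only
    rw [indexLetter, map_mul, HahnSeries.ofPowerSeries_C]
    exact (degreeLE_expSeries _ _).mul (DegreeLE.single_C 0 _)
  generalize indexLetters N = l at hl
  induction l generalizing w with
  | nil => exact ((degreeLE_expSeries _ _).mul (degreeLE_zeroTail w)).mono (by simp)
  | cons e l ih =>
    have ih' := fun w => ih w fun e' he' => hl e' (List.mem_cons_of_mem _ he')
    cases w with
    | nil => exact ih' []
    | cons a w =>
      refine (ih' (a :: w)).add (((hl e List.mem_cons_self a).mul (ih' w)).mono ?_)
      simp

/-- Laurent series with bounded degrees can be prescribed monomial by monomial. -/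
theorem exists_agreeAt {K : ℤ} {G : (ℕ+ →₀ ℕ) → LaurentSeries (PowerSeriesT ℚ)}
    (hG : ∀ m, DegreeLE K (G m)) : ∃ F, ∀ m, AgreeAt m (G m) F := by
  let d (n : ℤ) (s : ℕ) : MvPowerSeries ℕ+ ℚ := fun m =>
    MvPowerSeries.coeff m (((G m).coeff n).coeff s)
  -- The bound makes the coefficient of `zⁿ` a polynomial in `t` of degree at most `n + K`. The
  -- range is empty for `n < -K`, which bounds the support from below.
  let c (n : ℤ) : PowerSeriesT ℚ :=
    ∑ s ∈ Finset.range (n + K + 1).toNat, Polynomial.monomial s (d n s)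
  have hc (n : ℤ) (s : ℕ) (m : ℕ+ →₀ ℕ) : MvPowerSeries.coeff m ((c n).coeff s) =
      MvPowerSeries.coeff m (((G m).coeff n).coeff s) := by
    simp only [c, Polynomial.finsetSum_coeff, Polynomial.coeff_monomial, Finset.sum_ite_eq',
      Finset.mem_range]
    split_ifs with hs
    · rfl
    · rw [map_zero, hG m n s (by omega), map_zero]
  have hbdd : BddBelow (Function.support c) := by
    refine ⟨-K, fun n hn => ?_⟩
    by_contra h
    refine hn ?_
    have : (n + K + 1).toNat = 0 := by omega
    simp only [c, this, Finset.range_zero, Finset.sum_empty]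
  exact ⟨HahnSeries.ofSuppBddBelow c hbdd, fun m n s => (hc n s m).symm⟩

theorem exists_isRegularization (w : List (ℕ × ℕ+)) : ∃ F, IsRegularization w F := by
  choose N hN using exists_supportedBy
  obtain ⟨F, hF⟩ := exists_agreeAt fun m => degreeLE_prefixSum (N m) w
  exact ⟨F, fun m => (isRegularizationAt_prefixSum (hN m) w).congr (hF m)⟩

theorem existsUnique_isRegularization (w : List (ℕ × ℕ+)) : ∃! F, IsRegularization w F := by
  obtain ⟨F, hF⟩ := exists_isRegularization w
  refine ⟨F, hF, fun F' hF' => ?_⟩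
  ext n s m
  exact IsRegularizationAt.agreeAt (hF' m) (hF m) n s

theorem isRegularization_regularization (w : List (ℕ × ℕ+)) :
    IsRegularization w (regularization w) := by
  rw [regularization, dif_pos (exists_isRegularization w)]
  exact (exists_isRegularization w).choose_spec

theorem agreeAt_regularization {N : ℕ} {m : ℕ+ →₀ ℕ} (hm : SupportedBy N m)
    (w : List (ℕ × ℕ+)) :
    AgreeAt m (regularization w) (prefixSum (indexLetters N) (laurentTail N) w) :=
  IsRegularizationAt.agreeAt (isRegularization_regularization w m) (isRegularizationAt_prefixSum hm w)

/-! ### Newton's identities for a geometric alphabet -/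

section newton
variable {K : Type*} [CommRing K] {q : K} {Q : ℕ → K}

/-- With `Q n = qⁿ/(1 - qⁿ)`, the products are the elementary symmetric functions of `q, q², …`.
Their generating series satisfies `E(u) = (1 + q u) E(q u)`, and the claim is the coefficient of
`u^k` in `q E(u)/(1 + q u) = q E(q u)`. -/
theorem sum_alternating_pow_mul_prod (hQ : ∀ n, Q (n + 1) * (1 - q ^ (n + 1)) = q ^ (n + 1)) (k : ℕ) :
    ∑ i ∈ Finset.range (k + 1), (-1) ^ i * q ^ (i + 1) * ∏ j ∈ Finset.range (k - i), Q (j + 1) =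
      q ^ (k + 1) * ∏ j ∈ Finset.range k, Q (j + 1) := by
  induction k with
  | zero => simp
  | succ k ih =>
    rw [Finset.sum_range_succ']
    have h : ∑ i ∈ Finset.range (k + 1), (-1) ^ (i + 1) * q ^ (i + 1 + 1) *
        ∏ j ∈ Finset.range (k + 1 - (i + 1)), Q (j + 1) =
        -q * ∑ i ∈ Finset.range (k + 1), (-1) ^ i * q ^ (i + 1) *
          ∏ j ∈ Finset.range (k - i), Q (j + 1) := by
      rw [Finset.mul_sum]
      refine Finset.sum_congr rfl fun i _ => ?_
      rw [Nat.add_sub_add_right]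
      ring
    rw [h, ih, Nat.sub_zero, Finset.prod_range_succ]
    linear_combination (q * ∏ j ∈ Finset.range k, Q (j + 1)) * hQ k

/-- Newton's identity for the alphabet `q, q², …`, whose `n`-th power sum is `Q n`. The algebraic
proof multiplies by `1 - q^(k+2)` in order to step from `k` to `k + 1`, so no convergence enters. -/
theorem newton_geometric [IsDomain K] (hq : ∀ n, 1 - q ^ (n + 1) ≠ 0)
    (hQ : ∀ n, Q (n + 1) * (1 - q ^ (n + 1)) = q ^ (n + 1)) (k : ℕ) :
    ∑ i ∈ Finset.range (k + 1), (-1) ^ i * Q (i + 1) * ∏ j ∈ Finset.range (k - i), Q (j + 1) =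
      (k + 1) * ∏ j ∈ Finset.range (k + 1), Q (j + 1) := by
  induction k with
  | zero => simp
  | succ k ih =>
    refine mul_right_cancel₀ (hq (k + 1)) ?_
    have hA := sum_alternating_pow_mul_prod hQ (k + 1)
    rw [Finset.sum_range_succ, Nat.sub_self, Finset.prod_range_zero] at hA ⊢
    have h : (∑ i ∈ Finset.range (k + 1), (-1) ^ i * Q (i + 1) *
        ∏ j ∈ Finset.range (k + 1 - i), Q (j + 1)) * (1 - q ^ (k + 1 + 1)) =
        (∑ i ∈ Finset.range (k + 1), (-1) ^ i * q ^ (i + 1) *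
          ∏ j ∈ Finset.range (k + 1 - i), Q (j + 1)) + q ^ (k + 1 + 1) *
        ∑ i ∈ Finset.range (k + 1), (-1) ^ i * Q (i + 1) *
          ∏ j ∈ Finset.range (k - i), Q (j + 1) := by
      rw [Finset.sum_mul, Finset.mul_sum, ← Finset.sum_add_distrib]
      refine Finset.sum_congr rfl fun i hi => ?_
      obtain ⟨d, rfl⟩ : ∃ d, k = i + d := ⟨k - i, by have := Finset.mem_range.1 hi; omega⟩
      rw [show i + d + 1 - i = d + 1 by omega, show i + d - i = d by omega, Finset.prod_range_succ]
      have h1 := hQ i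
      have h2 := hQ d
      have h3 : q ^ (i + d + 1 + 1) = q ^ (i + 1) * q ^ (d + 1) := by ring
      rw [h3]
      -- Write `1 - a b = (1 - a) + a (1 - b)` with `a = q^(i+1)` and `b = q^(d+1)`; then `1 - a`
      -- cancels against `Q (i + 1)` and `1 - b` against `Q (d + 1)`.
      linear_combination ((-1) ^ i * (∏ j ∈ Finset.range d, Q (j + 1)) * Q (d + 1)) * h1 +
        ((-1) ^ i * (∏ j ∈ Finset.range d, Q (j + 1)) * Q (i + 1) * q ^ (i + 1)) * h2
    rw [ih] at h
    rw [Finset.prod_range_succ _ (k + 1)]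
    push_cast
    linear_combination h + hA + ((-1) ^ (k + 1) - (k + 1 + 1) * ∏ j ∈ Finset.range (k + 1), Q (j + 1)) * hQ (k + 1)

theorem derivative_mk_prod [IsDomain K] (hq : ∀ n, 1 - q ^ (n + 1) ≠ 0)
    (hQ : ∀ n, Q (n + 1) * (1 - q ^ (n + 1)) = q ^ (n + 1)) (c : K) :
    PowerSeries.derivative K (PowerSeries.mk fun k => c ^ k * ∏ j ∈ Finset.range k, Q (j + 1)) =
      PowerSeries.mk (fun i => (-1) ^ i * (c ^ (i + 1) * Q (i + 1))) *
        PowerSeries.mk fun k => c ^ k * ∏ j ∈ Finset.range k, Q (j + 1) := by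
  ext k
  rw [PowerSeries.coeff_derivative, PowerSeries.coeff_mul,
    Finset.Nat.sum_antidiagonal_eq_sum_range_succ_mk]
  simp only [PowerSeries.coeff_mk]
  have h := newton_geometric hq hQ k
  have h1 : ∑ i ∈ Finset.range (k + 1), (-1) ^ i * (c ^ (i + 1) * Q (i + 1)) *
      (c ^ (k - i) * ∏ j ∈ Finset.range (k - i), Q (j + 1)) = c ^ (k + 1) *
      ∑ i ∈ Finset.range (k + 1), (-1) ^ i * Q (i + 1) *
        ∏ j ∈ Finset.range (k - i), Q (j + 1) := by
    rw [Finset.mul_sum]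
    refine Finset.sum_congr rfl fun i hi => ?_
    have h2 : c ^ (k + 1) = c ^ (i + 1) * c ^ (k - i) := by
      rw [← pow_add]; congr 1; have := Finset.mem_range.1 hi; omega
    rw [h2]
    ring
  rw [h1, h]
  ring

end newton

/-! ### Convolution of functions on words -/

/-- The convolution product with respect to deconcatenation. -/
def deconcat {A B : Type*} [CommRing B] (τ σ : List A → B) : List A → B
  | [] => τ [] * σ []
  | a :: w => τ [] * σ (a :: w) + deconcat (fun v => τ (a :: v)) σ w

section deconcat
variable {A B : Type*} [CommRing B]

theorem deconcat_add_mul (τ τ' σ : List A → B) (c : B) (w : List A) :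
    deconcat (fun v => τ v + c * τ' v) σ w = deconcat τ σ w + c * deconcat τ' σ w := by
  induction w generalizing τ τ' with
  | nil => simp only [deconcat]; ring
  | cons a w ih => simp only [deconcat, ih]; ring

/-- Associativity of convolution: evaluating a prefix acts on the left, the counterterms act on the
right. -/
theorem deconcat_prefixSum (l : List (A → B)) (τ σ : List A → B) :
    deconcat (prefixSum l τ) σ = prefixSum l (deconcat τ σ) := by
  induction l with
  | nil => rfl
  | cons e l ih =>
    rw [prefixSum_cons, prefixSum_cons, ← ih]
    funext w
    cases w with
    | nil => rfl
    | cons a w => simp only [deconcat, prependLetter, deconcat_add_mul]; ring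

theorem deconcat_eq_sum (τ σ : List A → B) (w : List A) :
    deconcat τ σ w = ∑ i ∈ Finset.range (w.length + 1), τ (w.take i) * σ (w.drop i) := by
  induction w generalizing τ with
  | nil => simp [deconcat]
  | cons a w ih =>
    rw [deconcat, ih, List.length_cons, Finset.sum_range_succ' _ (w.length + 1)]
    simp only [List.take_succ_cons, List.drop_succ_cons, List.take_zero, List.drop_zero]
    ring

/-- The function on words over `ℕ` that vanishes on words with a nonzero letter and depends on the
length for the other words. -/
def zeroWordFun (T : ℕ → B) (w : List ℕ) : B := if ∀ a ∈ w, a = 0 then T w.length else 0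

/-- A word of zeros is determined by its length, so on such words convolution is multiplication of
generating series. -/
theorem deconcat_zeroWordFun (T C : ℕ → B) (w : List ℕ) :
    deconcat (zeroWordFun T) (zeroWordFun C) w =
      zeroWordFun (fun n => PowerSeries.coeff n (PowerSeries.mk T * PowerSeries.mk C)) w := by
  induction w generalizing T with
  | nil => simp [deconcat, zeroWordFun, PowerSeries.coeff_mul]
  | cons a w ih =>
    rw [deconcat]
    by_cases ha : a = 0
    · have h1 : (fun v => zeroWordFun T (a :: v)) = zeroWordFun fun n => T (n + 1) := by
        funext v; simp [zeroWordFun, ha]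
      rw [h1, ih]
      by_cases hw : ∀ a ∈ w, a = 0
      · simp only [zeroWordFun, List.forall_mem_cons, ha, true_and, List.length_cons,
          PowerSeries.coeff_mul, Finset.Nat.antidiagonal_succ, Finset.sum_cons, Finset.sum_map,
          PowerSeries.coeff_mk]
        simp only [if_pos hw]
        rfl
      · simp [zeroWordFun, ha, hw]
    · have h1 : (fun v => zeroWordFun T (a :: v)) = zeroWordFun fun _ => 0 := by
        funext v; simp [zeroWordFun, ha]
      rw [h1, ih]
      simp [zeroWordFun, ha, PowerSeries.coeff_mul]

end deconcat

/-! ### Splitting off the polar part of the power sums -/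

theorem expSeries_mul_natCast {S : Type*} [CommRing S] [Algebra ℚ S] (c : S) (n : ℕ) :
    expSeries (c * n) = expSeries c ^ n := by
  induction n with
  | zero => simp [expSeries]
  | succ n ih => rw [Nat.cast_succ, mul_add, mul_one, expSeries_add, ih, pow_succ]

/-- The holomorphic part of `exp (c z) exp (b z) / (1 - exp (b z))`. -/
noncomputable def geomRegular {S : Type*} [CommRing S] [Algebra ℚ S] (c : S) (b : ℕ) :
    PowerSeries S :=
  PowerSeries.mk fun n => -algebraMap ℚ S (b : ℚ)⁻¹ * PowerSeries.coeff (n + 1)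
    (expSeries c * PowerSeries.rescale (b : S) (bernoulli'PowerSeries S))

/-- The pole is simple, and both the exponential and the Bernoulli series have constant term 1, so
the polar part does not depend on `c`. This is why the counterterms depend neither on the truncation
`N` nor on `t`. -/
theorem expSeries_mul_geomSeries {S : Type*} [CommRing S] [Algebra ℚ S] (c : S) (b : ℕ) :
    HahnSeries.ofPowerSeries ℤ S (expSeries c) * geomSeries S b =
      HahnSeries.single (-1) (-algebraMap ℚ S (b : ℚ)⁻¹) +
        HahnSeries.ofPowerSeries ℤ S (geomRegular c b) := by
  obtain ⟨u, hu⟩ : ∃ u, u = expSeries c * PowerSeries.rescale (b : S) (bernoulli'PowerSeries S) :=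
    ⟨_, rfl⟩
  have h0 : PowerSeries.constantCoeff u = 1 := by
    rw [hu, map_mul, ← PowerSeries.coeff_zero_eq_constantCoeff_apply,
      ← PowerSeries.coeff_zero_eq_constantCoeff_apply, coeff_expSeries, PowerSeries.coeff_rescale]
    simp [bernoulli'PowerSeries]
  have h1 := PowerSeries.eq_X_mul_shift_add_const u
  have h2 : geomRegular c b = PowerSeries.C (-algebraMap ℚ S (b : ℚ)⁻¹) *
      PowerSeries.mk fun p => PowerSeries.coeff (p + 1) u := by
    ext n
    rw [geomRegular, PowerSeries.coeff_mk, PowerSeries.coeff_C_mul, PowerSeries.coeff_mk, hu]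
  have h3 : HahnSeries.single (-1) (-algebraMap ℚ S (b : ℚ)⁻¹) * HahnSeries.single (1 : ℤ) (1 : S) =
      HahnSeries.C (-algebraMap ℚ S (b : ℚ)⁻¹) := by
    rw [HahnSeries.single_mul_single, mul_one]; rfl
  rw [geomSeries, mul_left_comm, ← map_mul, ← hu, h2, map_mul, HahnSeries.ofPowerSeries_C, ← h3]
  conv_lhs => rw [h1, h0, map_add, map_mul, HahnSeries.ofPowerSeries_X,
    map_one PowerSeries.C, map_one (HahnSeries.ofPowerSeries ℤ S)]
  ring

/-- The linear coefficient of the numerator is `c b` from the exponential plus `b/2` from the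
Bernoulli series; the prefactor `-1/b` removes `b`, and with it the direction. -/
theorem constantCoeff_geomRegular {S : Type*} [CommRing S] [Algebra ℚ S] (c : S) {b : ℕ}
    (hb : b ≠ 0) : PowerSeries.constantCoeff (geomRegular (c * b) b) =
      -(c + algebraMap ℚ S (1 / 2)) := by
  have hb' : algebraMap ℚ S (b : ℚ)⁻¹ * (b : S) = 1 := by
    rw [← map_natCast (algebraMap ℚ S), ← map_mul, inv_mul_cancel₀ (by exact_mod_cast hb), map_one]
  rw [← PowerSeries.coeff_zero_eq_constantCoeff_apply, geomRegular, PowerSeries.coeff_mk,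
    PowerSeries.coeff_mul, Finset.Nat.antidiagonal_succ]
  simp [coeff_expSeries, bernoulli'PowerSeries, PowerSeries.coeff_rescale, bernoulli'_one]
  linear_combination (-(c + algebraMap ℚ S 2⁻¹)) * hb'

/-! ### Convolution with the counterterms, over a domain -/

section deconcat
variable {A B : Type*} [CommRing B]

/-- Congruence modulo an ideal survives convolution on the right; the ideal in question is that of
series vanishing on all monomials in `x₁, …, x_N`. -/
theorem deconcat_sub_induction {P : B → Prop} (hadd : ∀ x y, P x → P y → P (x + y))
    (hmul : ∀ x y, P x → P (x * y)) {τ τ' : List A → B} (h : ∀ v, P (τ v - τ' v))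
    (σ : List A → B) (w : List A) : P (deconcat τ σ w - deconcat τ' σ w) := by
  induction w generalizing τ τ' with
  | nil =>
    simp only [deconcat, ← sub_mul]
    exact hmul _ _ (h [])
  | cons a w ih =>
    simp only [deconcat, add_sub_add_comm, ← sub_mul]
    exact hadd _ _ (hmul _ _ (h [])) (ih fun v => h (a :: v))

theorem deconcat_cons_eq {τ σ : List A → B} (hτ : τ [] = 1) (hσ : σ [] = 1) (a : A) (w : List A) :
    deconcat τ σ (a :: w) = τ (a :: w) + ∑ i : Fin w.length,
      τ ((a :: w).take (i + 1)) * σ ((a :: w).drop (i + 1)) + σ (a :: w) := by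
  rw [deconcat_eq_sum, List.length_cons, Finset.sum_range_succ', Finset.sum_range_succ,
    Finset.sum_range]
  simp only [List.take_succ_cons, List.drop_succ_cons, List.take_zero, List.drop_zero,
    List.take_length, List.drop_length, hτ, hσ, one_mul, mul_one]
  ring

end deconcat

/-! ### Polar parts, and the counterterms on words of zeros -/

section tail
variable {R : Type*} [CommRing R]

/-- Laurent series that are equal to their polar part. -/
def IsPolar (F : LaurentSeries R) : Prop := ∀ n, 0 ≤ n → F.coeff n = 0

theorem IsPolar.mul {F G : LaurentSeries R} (hF : IsPolar F)
    (hG : IsPolar G) : IsPolar (F * G) := fun n hn => by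
  rw [HahnSeries.coeff_mul]
  refine Finset.sum_eq_zero fun p hp => ?_
  have h := (Finset.mem_antidiagonal.1 hp).2.2
  rcases le_or_gt 0 p.1 with h1 | h1
  · rw [hF _ h1, zero_mul]
  · rw [hG _ (by omega), mul_zero]

theorem coeff_polarPart_of_neg (F : LaurentSeries R) {n : ℤ} (hn : n < 0) :
    (polarPart F).coeff n = F.coeff n := HahnSeries.coeff_truncLT_of_lt hn F

theorem coeff_polarPart_of_nonneg (F : LaurentSeries R) {n : ℤ}
    (hn : 0 ≤ n) : (polarPart F).coeff n = 0 := HahnSeries.coeff_truncLT_of_le hn F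

/-- The uniqueness step of the Birkhoff factorization: a purely polar correction that makes `G`
regular is minus the polar part of `G`. -/
theorem polarPart_eq_neg {F G H : LaurentSeries R} (h : F = G + H) (hF : polarPart F = 0)
    (hH : IsPolar H) : -polarPart G = H := by
  ext n
  rw [HahnSeries.coeff_neg]
  rcases le_or_gt 0 n with hn | hn
  · rw [coeff_polarPart_of_nonneg G hn, hH n hn, neg_zero]
  · have h1 : (polarPart F).coeff n = 0 := by rw [hF]; rfl
    rw [coeff_polarPart_of_neg F hn, h, HahnSeries.coeff_add] at h1
    rw [coeff_polarPart_of_neg G hn]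
    exact neg_eq_of_add_eq_zero_right h1

theorem sub_polarPart {F G H : LaurentSeries R} (h : F = G + H) (h' : -polarPart G = H) :
    G - polarPart G = F := by
  rw [h, ← h', sub_eq_add_neg]

theorem IsPolar.C_mul (r : R) {F : LaurentSeries R} (hF : IsPolar F) :
    IsPolar (HahnSeries.C r * F) := fun n hn => by
  rw [HahnSeries.C_mul_eq_smul, HahnSeries.coeff_smul, hF n hn, smul_zero]

theorem ofPowerSeries_prefixSum {A : Type*} (l : List (A → PowerSeries R))
    (τ : List A → PowerSeries R) (w : List A) : HahnSeries.ofPowerSeries ℤ R (prefixSum l τ w) =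
      prefixSum (l.map fun e a => HahnSeries.ofPowerSeries ℤ R (e a))
        (fun v => HahnSeries.ofPowerSeries ℤ R (τ v)) w :=
  map_prefixSum (HahnSeries.ofPowerSeries ℤ R) l τ w

variable [Algebra ℚ R]

/-- The regularized elementary symmetric functions of the geometric progression that starts with
`exp ((x + 1) d z)`. -/
noncomputable def elementaryTail (x : R) (d k : ℕ) : LaurentSeries R :=
  HahnSeries.ofPowerSeries ℤ R (expSeries (x * d)) ^ k *
    ∏ j ∈ Finset.range k, geomSeries R ((j + 1) * d)

/-- The polar part of the logarithmic derivative of the generating series of `elementaryTail`. -/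
noncomputable def polarCoeff (R : Type*) [CommRing R] [Algebra ℚ R] (d i : ℕ) : LaurentSeries R :=
  (-1) ^ i * HahnSeries.single (-1) (-algebraMap ℚ R (((i + 1) * d : ℕ) : ℚ)⁻¹)

/-- The regular part of the logarithmic derivative of the generating series of `elementaryTail`. -/
noncomputable def regularCoeff (x : R) (d i : ℕ) : PowerSeries R :=
  (-1) ^ i * geomRegular (x * (((i + 1) * d : ℕ) : R)) ((i + 1) * d)

/-- The counterterms: the negative factor of the Birkhoff factorization, on words `0 ⋯ 0`. -/
noncomputable def counterterm (R : Type*) [CommRing R] [Algebra ℚ R] (d : ℕ) : ℕ → LaurentSeries R :=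
  expIntCoeff fun i => -polarCoeff R d i

/-- Newton's identities for `q = e^{dz}`, rescaled by `e^{xdz}`: the logarithmic derivative consists
of the signed power sums, each of which splits into a polar and a regular part. -/
theorem derivative_elementaryTail [IsDomain R] (x : R) {d : ℕ} (hd : d ≠ 0) :
    PowerSeries.derivative _ (PowerSeries.mk (elementaryTail x d)) =
      PowerSeries.mk (fun i => polarCoeff R d i +
        HahnSeries.ofPowerSeries ℤ R (regularCoeff x d i)) * PowerSeries.mk (elementaryTail x d) := by
  have := algebraRat.charZero R
  set q : LaurentSeries R := HahnSeries.ofPowerSeries ℤ R (expSeries (d : R)) with hq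
  have hqn (n : ℕ) : q ^ n = HahnSeries.ofPowerSeries ℤ R (expSeries ((n * d : ℕ) : R)) := by
    rw [hq, ← map_pow, ← expSeries_mul_natCast, Nat.cast_mul, mul_comm]
  have h1 (n : ℕ) : 1 - q ^ (n + 1) ≠ 0 := by
    intro h
    rw [hqn, ← map_one (HahnSeries.ofPowerSeries ℤ R), ← map_sub,
      ← map_zero (HahnSeries.ofPowerSeries ℤ R)] at h
    have h2 := congrArg (PowerSeries.coeff 1) (HahnSeries.ofPowerSeries_injective h)
    simp [coeff_expSeries, PowerSeries.coeff_one, hd] at h2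
    norm_cast at h2
  have h2 (n : ℕ) : geomSeries R ((n + 1) * d) * (1 - q ^ (n + 1)) = q ^ (n + 1) := by
    rw [hqn]
    exact geomSeries_mul_one_sub (by positivity)
  have h3 := derivative_mk_prod (Q := fun n => geomSeries R (n * d)) h1 h2
    (HahnSeries.ofPowerSeries ℤ R (expSeries (x * d)))
  refine h3.trans ?_
  congr 2
  funext i
  rw [← map_pow, ← expSeries_mul_natCast, mul_assoc, ← Nat.cast_mul, mul_comm d,
    expSeries_mul_geomSeries, mul_add, regularCoeff, polarCoeff, map_mul, map_pow,
    map_neg (HahnSeries.ofPowerSeries ℤ R), map_one (HahnSeries.ofPowerSeries ℤ R)]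

/-- Logarithmic derivatives add, and that of the counterterm series is minus the polar part. Only
the regular part remains, so all poles of the product cancel. -/
theorem coeff_elementaryTail_mul_counterterm [IsDomain R] (x : R) {d : ℕ} (hd : d ≠ 0) (k : ℕ) :
    PowerSeries.coeff k (PowerSeries.mk (elementaryTail x d) * PowerSeries.mk (counterterm R d)) =
      HahnSeries.ofPowerSeries ℤ R (expIntCoeff (regularCoeff x d) k) := by
  rw [map_expIntCoeff]
  refine eq_expIntCoeff ?_ ?_ k
  · rw [map_mul, ← PowerSeries.coeff_zero_eq_constantCoeff_apply,
      ← PowerSeries.coeff_zero_eq_constantCoeff_apply, PowerSeries.coeff_mk, PowerSeries.coeff_mk,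
      counterterm, expIntCoeff_zero, elementaryTail]
    simp
  · rw [Derivation.leibniz, derivative_elementaryTail x hd, counterterm, derivative_mk_expIntCoeff,
      smul_eq_mul, smul_eq_mul]
    have h : (PowerSeries.mk fun i => polarCoeff R d i +
        HahnSeries.ofPowerSeries ℤ R (regularCoeff x d i)) =
        PowerSeries.mk (fun i => HahnSeries.ofPowerSeries ℤ R (regularCoeff x d i)) -
        PowerSeries.mk fun i => -polarCoeff R d i := by
      ext1 i; simp only [PowerSeries.coeff_mk, map_sub]; rw [sub_neg_eq_add, add_comm]
    rw [h]
    ring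

/-- Polar series are closed under sums and products, and every term of the recursion contains a
polar coefficient. The value 1 at length zero is not polar, hence the shift. -/
theorem isPolar_counterterm (d k : ℕ) : IsPolar (counterterm R d (k + 1)) := by
  have hA (i : ℕ) : IsPolar (-polarCoeff R d i) := fun n hn => by
    have h : (HahnSeries.single (-1 : ℤ)
      (-algebraMap ℚ R (((i + 1) * d : ℕ) : ℚ)⁻¹)).coeff n = 0 :=
      HahnSeries.coeff_single_of_ne (by omega)
    rcases neg_one_pow_eq_or (LaurentSeries R) i with h' | h' <;> rw [polarCoeff, h'] <;>
      simp only [one_mul, neg_mul, HahnSeries.coeff_neg, h, neg_zero]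
  have hsum (s : Finset ℕ) (F : ℕ → LaurentSeries R) (hF : ∀ i ∈ s, IsPolar (F i)) :
      IsPolar (∑ i ∈ s, F i) := fun n hn => by
    rw [HahnSeries.coeff_sum]
    exact Finset.sum_eq_zero fun i hi => hF i hi n hn
  induction k using Nat.strong_induction_on with
  | _ k ih =>
    rw [counterterm, expIntCoeff_succ]
    rw [Algebra.smul_def, Subsingleton.elim (algebraMap ℚ (LaurentSeries R))
      ((HahnSeries.C : R →+* LaurentSeries R).comp (algebraMap ℚ R))]
    refine IsPolar.C_mul _ (hsum _ _ fun i hi => ?_)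
    cases i with
    | zero => rw [expIntCoeff_zero, mul_one]; exact hA _
    | succ i => exact (hA _).mul (ih i (by have := Finset.mem_range.1 hi; omega))

theorem isPolar_zeroWordFun_counterterm (d : ℕ) (a : ℕ) (α : List ℕ) :
    IsPolar (zeroWordFun (counterterm R d) (a :: α)) := by
  unfold zeroWordFun
  split_ifs
  · exact isPolar_counterterm d _
  · exact fun n _ => rfl

end tail

/-! ### The Birkhoff factorization in a constant direction -/

/-- The coefficients at all monomials in `x₁, …, x_N` vanish. -/
def VanishesUpTo (N : ℕ) (F : LaurentSeries (PowerSeriesT ℚ)) : Prop :=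
  ∀ m, SupportedBy N m → ∀ n s, MvPowerSeries.coeff m ((F.coeff n).coeff s) = 0

namespace VanishesUpTo
variable {N : ℕ} {F G : LaurentSeries (PowerSeriesT ℚ)}

theorem add (hF : VanishesUpTo N F) (hG : VanishesUpTo N G) : VanishesUpTo N (F + G) :=
  fun m hm n s => by
    rw [HahnSeries.coeff_add, Polynomial.coeff_add, map_add, hF m hm, hG m hm, add_zero]

theorem mul_right (hF : VanishesUpTo N F) (G : LaurentSeries (PowerSeriesT ℚ)) :
    VanishesUpTo N (F * G) := fun m hm n s => by
  rw [HahnSeries.coeff_mul, Polynomial.finsetSum_coeff, map_sum]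
  refine Finset.sum_eq_zero fun p _ => ?_
  rw [Polynomial.coeff_mul, map_sum]
  refine Finset.sum_eq_zero fun q _ => ?_
  rw [MvPowerSeries.coeff_mul]
  refine Finset.sum_eq_zero fun r hr => ?_
  rw [hF r.1 (hm.mono ?_), zero_mul]
  rw [← Finset.HasAntidiagonal.mem_antidiagonal.1 hr]
  exact le_self_add

end VanishesUpTo

section direction
variable (δ : ℕ+)

/-- The regularization in the constant direction `δ`. -/
noncomputable def constRegularization (α : List ℕ) : LaurentSeries (PowerSeriesT ℚ) :=
  regularization (α.map fun a => (a, δ))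

/-- The values of the letters at the indices `1, …, N`, in a constant direction. -/
noncomputable def constLetters (N : ℕ) : List (ℕ → PowerSeries (PowerSeriesT ℚ)) :=
  (List.range' 0 N).map fun i a => indexLetter i.succPNat (a, δ)

theorem weight_map_const (α : List ℕ) : weight (α.map fun a => (a, δ)) = α.length * δ := by
  simp [weight, Function.comp_def]

theorem zeroTail_map_const {K : Type*} [CommRing K] (Q : ℕ → K) (α : List ℕ) :
    zeroTail Q (α.map fun a => (a, δ)) =
      zeroWordFun (fun k => ∏ j ∈ Finset.range k, Q ((j + 1) * δ)) α := by
  induction α with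
  | nil => simp [zeroTail, zeroWordFun]
  | cons a α ih =>
    have h := weight_map_const δ (a :: α)
    simp only [List.map_cons] at h
    simp only [List.map_cons, zeroTail, h, ih]
    by_cases ha : a = 0 <;> by_cases hα : ∀ a ∈ α, a = 0 <;>
      simp [zeroWordFun, ha, hα]
    rw [if_pos hα, if_pos hα, Finset.prod_range_succ, mul_comm]

theorem laurentTail_map_const (N : ℕ) (α : List ℕ) :
    laurentTail N (α.map fun a => (a, δ)) =
      zeroWordFun (elementaryTail ((N : PowerSeriesT ℚ) + Polynomial.X) δ) α := by
  rw [laurentTail, zeroTail_map_const, weight_map_const, mul_comm α.length, Nat.cast_mul, ← mul_assoc,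
    expSeries_mul_natCast, map_pow]
  unfold zeroWordFun elementaryTail
  split_ifs
  · rfl
  · exact mul_zero _

theorem vanishesUpTo_constRegularization (N : ℕ) (α : List ℕ) :
    VanishesUpTo N (constRegularization δ α -
      prefixSum ((constLetters δ N).map fun e a => HahnSeries.ofPowerSeries ℤ _ (e a))
        (zeroWordFun (elementaryTail ((N : PowerSeriesT ℚ) + Polynomial.X) δ)) α) :=
  fun m hm n s => by
  have h := agreeAt_regularization hm (α.map fun a => (a, δ)) n s
  rw [prefixSum_map, indexLetters, List.map_map] at h
  simp only [laurentTail_map_const] at h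
  rw [constLetters, List.map_map, HahnSeries.coeff_sub, Polynomial.coeff_sub, map_sub, sub_eq_zero]
  exact h

theorem regularization_nil : regularization [] = 1 := by
  ext n s m
  obtain ⟨N, hN⟩ := exists_supportedBy m
  have h := agreeAt_regularization hN [] n s
  rw [prefixSum_apply_nil, laurentTail] at h
  have h1 : expSeries (((N : PowerSeriesT ℚ) + Polynomial.X) * (weight [] : PowerSeriesT ℚ)) = 1 := by
    simp [weight, expSeries]
  rw [h1] at h
  erw [map_one (HahnSeries.ofPowerSeries ℤ (PowerSeriesT ℚ)), one_mul] at h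
  exact h

/-- The convolution of the regularization with the counterterms. -/
noncomputable def renormalized (α : List ℕ) : LaurentSeries (PowerSeriesT ℚ) :=
  deconcat (constRegularization δ) (zeroWordFun (counterterm (PowerSeriesT ℚ) δ)) α

/-- On monomials in `x₁, …, x_N` the regularization is a finite evaluation followed by a tail. The
counterterms act on the tail alone and make it a power series in `z`; the letters at `1, …, N` are
power series already. -/
theorem vanishesUpTo_renormalized (N : ℕ) (α : List ℕ) :
    VanishesUpTo N (renormalized δ α - HahnSeries.ofPowerSeries ℤ _
      (prefixSum (constLetters δ N) (zeroWordFun (expIntCoeff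
        (regularCoeff ((N : PowerSeriesT ℚ) + Polynomial.X) δ))) α)) := by
  have : IsDomain (MvPowerSeries ℕ+ ℚ) := NoZeroDivisors.to_isDomain _
  have h := deconcat_sub_induction (P := VanishesUpTo N) (fun _ _ => VanishesUpTo.add)
    (fun _ G h => h.mul_right G) (vanishesUpTo_constRegularization δ N)
    (zeroWordFun (counterterm (PowerSeriesT ℚ) δ)) α
  rw [show deconcat (fun v => prefixSum ((constLetters δ N).map fun e a =>
    HahnSeries.ofPowerSeries ℤ _ (e a)) (zeroWordFun (elementaryTail _ _)) v)
    (zeroWordFun (counterterm _ δ)) = _ from deconcat_prefixSum _ _ _] at h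
  convert h using 3
  · rfl
  refine (ofPowerSeries_prefixSum (R := PowerSeriesT ℚ) _ _ α).trans ?_
  refine prefixSum_congr _ _ fun v _ => ?_
  rw [deconcat_zeroWordFun]
  unfold zeroWordFun
  split_ifs
  · exact (coeff_elementaryTail_mul_counterterm _ δ.ne_zero _).symm
  · exact map_zero _

/-- Each monomial involves finitely many variables, and for a large enough `N` its coefficient is a
power series in `z`. -/
theorem polarPart_renormalized (α : List ℕ) : polarPart (renormalized δ α) = 0 := by
  ext n s m
  rcases le_or_gt 0 n with h | h
  · rw [coeff_polarPart_of_nonneg _ h]; rfl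
  · obtain ⟨N, hN⟩ := exists_supportedBy m
    have h1 := vanishesUpTo_renormalized δ N α m hN n s
    rw [HahnSeries.coeff_sub, PowerSeries.coeff_coe, if_pos h, sub_zero] at h1
    rw [coeff_polarPart_of_neg _ h]
    exact h1

theorem renormalized_cons (a : ℕ) (α : List ℕ) : renormalized δ (a :: α) =
    constRegularization δ (a :: α) + ∑ i : Fin α.length, constRegularization δ ((a :: α).take (i + 1)) *
      zeroWordFun (counterterm (PowerSeriesT ℚ) δ) ((a :: α).drop (i + 1)) +
    zeroWordFun (counterterm (PowerSeriesT ℚ) δ) (a :: α) :=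
  deconcat_cons_eq regularization_nil (by simp [zeroWordFun, counterterm, expIntCoeff_zero]) a α

/-- The convolution is the bracket of the Birkhoff recursion plus the counterterm of the whole word.
It has no polar part while the counterterm is polar, so the counterterm satisfies the recursion for
`φ₋`. -/
theorem birkhoffMinus_map_const (α : List ℕ) : birkhoffMinus (α.map fun a => (a, δ)) =
    zeroWordFun (counterterm (PowerSeriesT ℚ) δ) α := by
  induction h : α.length using Nat.strong_induction_on generalizing α with
  | _ n ih =>
  cases α with
  | nil => simp [birkhoffMinus, zeroWordFun, counterterm, expIntCoeff_zero]
  | cons a α =>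
    rw [List.map_cons, birkhoffMinus]
    refine polarPart_eq_neg ?_ (polarPart_renormalized δ (a :: α))
      (isPolar_zeroWordFun_counterterm _ a α)
    rw [renormalized_cons]
    congr 2
    refine Finset.sum_equiv (finCongr (by simp)) (by simp) fun i _ => ?_
    simp only [finCongr_apply, Fin.val_cast]
    rw [← List.map_cons (f := fun a => (a, δ)), ← List.map_take, ← List.map_drop,
      ih (((a :: α).drop (i + 1)).length) (by simp at h ⊢; omega) _ rfl]
    rfl

theorem birkhoffPlus_map_const (α : List ℕ) :
    birkhoffPlus (α.map fun a => (a, δ)) = renormalized δ α := by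
  cases α with
  | nil =>
    have h := regularization_nil
    simp [birkhoffPlus, renormalized, deconcat, zeroWordFun, counterterm, expIntCoeff_zero,
      constRegularization, h]
  | cons a α =>
    have h1 := birkhoffMinus_map_const δ (a :: α)
    rw [List.map_cons, birkhoffMinus] at h1
    rw [List.map_cons, birkhoffPlus]
    refine sub_polarPart ?_ h1
    rw [renormalized_cons]
    congr 2
    refine Finset.sum_equiv (finCongr (by simp)) (by simp) fun i _ => ?_
    simp only [finCongr_apply, Fin.val_cast]
    rw [← List.map_cons (f := fun a => (a, δ)), ← List.map_take, ← List.map_drop,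
      birkhoffMinus_map_const]
    rfl

end direction

/-! ### The renormalized values -/

/-- The values of the letters at the indices `1, …, N` for `z = 0`. -/
noncomputable def varLetters (N : ℕ) : List (ℕ → PowerSeriesT ℚ) :=
  (List.range' 0 N).map fun i a =>
    Polynomial.C (MvPowerSeries.monomial (Finsupp.single i.succPNat a) 1)

/-- The renormalized number of indices greater than `N`. -/
noncomputable def tailNumber (N : ℕ) : PowerSeriesT ℚ :=
  -((N : PowerSeriesT ℚ) + Polynomial.X + algebraMap ℚ (PowerSeriesT ℚ) (1 / 2))

theorem constantCoeff_indexLetter (i : ℕ+) (a : ℕ × ℕ+) :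
    PowerSeries.constantCoeff (indexLetter i a) =
      Polynomial.C (MvPowerSeries.monomial (Finsupp.single i a.1) 1) := by
  rw [indexLetter, map_mul, ← PowerSeries.coeff_zero_eq_constantCoeff_apply, coeff_expSeries]
  simp

theorem constantCoeff_regularCoeff {R : Type*} [CommRing R] [Algebra ℚ R] (x : R) {d : ℕ}
    (hd : d ≠ 0) (i : ℕ) : PowerSeries.constantCoeff (regularCoeff x d i) =
      (-1) ^ i * -(x + algebraMap ℚ R (1 / 2)) := by
  rw [regularCoeff, map_mul, constantCoeff_geomRegular x (by positivity)]
  simp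

/-- At `z = 0` a letter `a` at index `i` becomes `x_i^a`, and the logarithmic derivative of the tail
series becomes `∑ (-1)^i c u^i` with `c = tailNumber N`, that is, `c/(1 + u)`. The right-hand side
is free of `δ`. -/
theorem coeff_directionalQSym {N : ℕ} {m : ℕ+ →₀ ℕ} (hm : SupportedBy N m) (δ : ℕ+) (α : List ℕ)
    (s : ℕ) : MvPowerSeries.coeff m ((directionalQSym (α.map fun a => (a, δ))).coeff s) =
      MvPowerSeries.coeff m
        ((prefixSum (varLetters N) (binomialCharacter (tailNumber N)) α).coeff s) := by
  have h := vanishesUpTo_renormalized δ N α m hm 0 s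
  rw [HahnSeries.coeff_sub, Polynomial.coeff_sub, map_sub, sub_eq_zero, ← birkhoffPlus_map_const,
    ← Int.natCast_zero, LaurentSeries.coeff_coe_powerSeries,
    PowerSeries.coeff_zero_eq_constantCoeff_apply, map_prefixSum] at h
  rw [directionalQSym]
  refine h.trans ?_
  congr 2
  have h1 : (constLetters δ N).map (fun e a => PowerSeries.constantCoeff (e a)) = varLetters N := by
    rw [constLetters, varLetters, List.map_map]
    refine List.map_congr_left fun i _ => ?_
    funext a
    exact constantCoeff_indexLetter _ _
  rw [h1]
  refine prefixSum_congr _ _ fun v _ => ?_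
  unfold zeroWordFun binomialCharacter
  split_ifs
  · rw [map_expIntCoeff]
    simp only [constantCoeff_regularCoeff _ δ.ne_zero, tailNumber]
  · exact map_zero _

/-! ### Independence of the direction, multiplicativity, and explicit values -/

theorem directionalQSym_map_const (δ δ' : ℕ+) (α : List ℕ) :
    directionalQSym (α.map fun a => (a, δ)) = directionalQSym (α.map fun a => (a, δ')) := by
  ext s m
  obtain ⟨N, hN⟩ := exists_supportedBy m
  rw [coeff_directionalQSym hN, coeff_directionalQSym hN]

theorem renMonomial_direction (k : Type*) [CommRing k] [Algebra ℚ k] (δ δ' : ℕ+) (α : List ℕ) :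
    renMonomial k δ α = renMonomial k δ' α := by
  rw [renMonomial, directionalQSym_map_const δ δ', renMonomial]

theorem isCharacter_prefixSum_varLetters (N : ℕ) :
    IsCharacter (prefixSum (varLetters N) (binomialCharacter (tailNumber N))) := by
  refine (isCharacter_binomialCharacter _).prefixSum fun e he a b => ?_
  obtain ⟨i, -, rfl⟩ := List.mem_map.1 he
  simp only
  rw [← map_mul, MvPowerSeries.monomial_mul_monomial, ← Finsupp.single_add, one_mul]

theorem coeff_coeff_mul_congr {p p' q q' : PowerSeriesT ℚ} {N : ℕ}
    (hp : ∀ m, SupportedBy N m → ∀ s, MvPowerSeries.coeff m (p.coeff s) = MvPowerSeries.coeff m (p'.coeff s))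
    (hq : ∀ m, SupportedBy N m → ∀ s, MvPowerSeries.coeff m (q.coeff s) = MvPowerSeries.coeff m (q'.coeff s))
    (m : ℕ+ →₀ ℕ) (hm : SupportedBy N m) (s : ℕ) :
    MvPowerSeries.coeff m ((p * q).coeff s) = MvPowerSeries.coeff m ((p' * q').coeff s) := by
  rw [Polynomial.coeff_mul, Polynomial.coeff_mul, map_sum, map_sum]
  refine Finset.sum_congr rfl fun x _ => ?_
  rw [MvPowerSeries.coeff_mul, MvPowerSeries.coeff_mul]
  refine Finset.sum_congr rfl fun y hy => ?_
  have h := Finset.HasAntidiagonal.mem_antidiagonal.1 hy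
  rw [hp _ (hm.mono (h ▸ le_self_add)), hq _ (hm.mono (h ▸ le_add_self))]

theorem isCharacter_directionalQSym (δ : ℕ+) :
    IsCharacter fun α : List ℕ => directionalQSym (α.map fun a => (a, δ)) where
  nil := by simp [directionalQSym, birkhoffPlus]
  mul u v := by
    ext s m
    obtain ⟨N, hN⟩ := exists_supportedBy m
    rw [coeff_coeff_mul_congr (fun m hm s => coeff_directionalQSym hm δ u s)
      (fun m hm s => coeff_directionalQSym hm δ v s) m hN s,
      ← (isCharacter_prefixSum_varLetters N).mul]
    generalize quasiShuffle u v = l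
    induction l with
    | nil => rfl
    | cons w l ih =>
      simp only [List.map_cons, List.sum_cons, Polynomial.coeff_add, map_add, ih,
        coeff_directionalQSym hN]

theorem isCharacter_renMonomial (k : Type*) [CommRing k] [Algebra ℚ k] (δ : ℕ+) :
    IsCharacter (renMonomial k δ) :=
  (isCharacter_directionalQSym δ).map (Polynomial.mapRingHom (MvPowerSeries.map (algebraMap ℚ k)))

theorem map_monomialQSym (k : Type*) [CommRing k] [Algebra ℚ k] (α : List ℕ) :
    MvPowerSeries.map (algebraMap ℚ k) (monomialQSym ℚ α) = monomialQSym k α := by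
  ext m
  rw [MvPowerSeries.coeff_map]
  exact map_natCast _ _

/-- Every nonempty suffix of a left weak word contains a positive letter, which kills the binomial
tail and with it all dependence on `t`. -/
theorem directionalQSym_of_isLeftWeak (δ : ℕ+) {α : List ℕ} (hα : IsLeftWeak α) :
    directionalQSym (α.map fun a => (a, δ)) = Polynomial.C (monomialQSym ℚ α) := by
  ext s m
  obtain ⟨N, hN⟩ := exists_supportedBy m
  rw [coeff_directionalQSym hN]
  have h1 : prefixSum (varLetters N) (binomialCharacter (tailNumber N)) α =
      Polynomial.C (prefixSum (letterWeights id (fun _ _ => (1 : ℚ)) 0 N)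
        (fun w => if w = [] then 1 else 0) α) := by
    rw [map_prefixSum, letterWeights, List.map_map]
    refine prefixSum_congr _ _ fun v hv => ?_
    have hv' := hα.of_suffix hv
    by_cases h : v = []
    · simp [h, binomialCharacter, expIntCoeff_zero]
    · obtain ⟨a, ha, ha'⟩ := hv'.exists_ne_zero h
      rw [binomialCharacter, if_neg (fun h => ha' (h a ha)), if_neg h, map_zero]
  rw [h1, Polynomial.coeff_C, Polynomial.coeff_C]
  split_ifs
  · exact (coeff_monomialQSym hα hN).symm
  · rfl

theorem renMonomial_of_isLeftWeak (k : Type*) [CommRing k] [Algebra ℚ k] (δ : ℕ+) {α : List ℕ}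
    (hα : IsLeftWeak α) : renMonomial k δ α = Polynomial.C (monomialQSym k α) := by
  rw [renMonomial, directionalQSym_of_isLeftWeak δ hα, Polynomial.map_C, map_monomialQSym]

/-- Each of the indices `1, …, N` contributes 1 and the tail contributes `-(N + t + 1/2)`, so `N`
cancels. This element supplies the variable `t`. -/
theorem directionalQSym_zero (δ : ℕ+) :
    directionalQSym ([0].map fun a => (a, δ)) = tailNumber 0 := by
  ext s m
  obtain ⟨N, hN⟩ := exists_supportedBy m
  rw [coeff_directionalQSym hN]
  have h1 (l : List (ℕ → PowerSeriesT ℚ)) (hl : ∀ e ∈ l, e 0 = 1) (c : PowerSeriesT ℚ) :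
      prefixSum l (binomialCharacter c) [0] = c + l.length := by
    induction l with
    | nil => simp [binomialCharacter, expIntCoeff_succ, expIntCoeff_zero]
    | cons e l ih =>
      rw [prefixSum_cons, prependLetter, ih fun e he => hl e (List.mem_cons_of_mem _ he),
        hl e List.mem_cons_self, prefixSum_apply_nil, binomialCharacter, if_pos (by simp),
        List.length_nil, expIntCoeff_zero, List.length_cons]
      push_cast
      ring
  rw [h1]
  · simp only [varLetters, List.length_map, List.length_range', tailNumber, Nat.cast_zero]
    congr 2
    ring
  · intro e he
    obtain ⟨i, -, rfl⟩ := List.mem_map.1 he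
    simp

theorem renMonomial_zero (k : Type*) [CommRing k] [Algebra ℚ k] (δ : ℕ+) :
    renMonomial k δ [0] =
      -(Polynomial.X + Polynomial.C (MvPowerSeries.C (algebraMap ℚ k (1 / 2)))) := by
  rw [renMonomial, directionalQSym_zero, tailNumber,
    IsScalarTower.algebraMap_apply ℚ (MvPowerSeries ℕ+ ℚ) (PowerSeriesT ℚ),
    Polynomial.algebraMap_eq, Polynomial.map_neg, Polynomial.map_add, Polynomial.map_add,
    Polynomial.map_C, Polynomial.map_X, Nat.cast_zero, Polynomial.map_zero, zero_add,
    MvPowerSeries.algebraMap_apply, MvPowerSeries.map_C]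
  rfl

/-! ### Left weak words in the quasi-shuffle algebra -/

theorem ne_nil_of_mem_quasiShuffle {A : Type*} [Add A] {u v w : List A}
    (hw : w ∈ quasiShuffle u v) (h : u ≠ [] ∨ v ≠ []) : w ≠ [] := by
  revert hw
  fun_cases quasiShuffle u v <;> intro hw
  · simp_all
  · simp_all
  · simp only [List.mem_append, List.mem_map] at hw
    rcases hw with ⟨_, _, rfl⟩ | ⟨_, _, rfl⟩ | ⟨_, _, rfl⟩ <;> simp

theorem isLeftWeak_cons_iff {a : ℕ} {w : List ℕ} :
    IsLeftWeak (a :: w) ↔ (w = [] → 0 < a) ∧ IsLeftWeak w := by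
  unfold IsLeftWeak
  cases w <;> simp [List.getLast?_cons_cons]

theorem IsLeftWeak.of_mem_quasiShuffle {u v w : List ℕ} (hu : IsLeftWeak u) (hv : IsLeftWeak v)
    (hw : w ∈ quasiShuffle u v) : IsLeftWeak w := by
  fun_induction quasiShuffle u v generalizing w with
  | case1 v => rw [List.mem_singleton.1 hw]; exact hv
  | case2 a u => rw [List.mem_singleton.1 hw]; exact hu
  | case3 a u b v h1 h2 h3 =>
    have hu' := isLeftWeak_cons_iff.1 hu
    have hv' := isLeftWeak_cons_iff.1 hv
    simp only [List.mem_append, List.mem_map] at hw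
    rcases hw with ⟨w, hw, rfl⟩ | ⟨w, hw, rfl⟩ | ⟨w, hw, rfl⟩ <;> rw [isLeftWeak_cons_iff]
    · exact ⟨fun h => absurd h (ne_nil_of_mem_quasiShuffle hw (by simp)), h1 hu'.2 hv hw⟩
    · exact ⟨fun h => absurd h (ne_nil_of_mem_quasiShuffle hw (by simp)), h2 hu hv'.2 hw⟩
    · refine ⟨fun h => ?_, h3 hu'.2 hv'.2 hw⟩
      by_contra h'
      refine absurd h (ne_nil_of_mem_quasiShuffle hw (Or.inl fun h => h' ?_))
      have := hu'.1 h
      omega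

theorem exists_isLeftWeak_append_replicate (w : List ℕ) :
    ∃ β j, IsLeftWeak β ∧ w = β ++ List.replicate j 0 := by
  induction w with
  | nil => exact ⟨[], 0, by simp [IsLeftWeak], rfl⟩
  | cons a w ih =>
    obtain ⟨β, j, hβ, rfl⟩ := ih
    by_cases h : β = [] ∧ a = 0
    · exact ⟨[], j + 1, by simp [IsLeftWeak], by simp [h.1, h.2, List.replicate_succ]⟩
    · refine ⟨a :: β, j, isLeftWeak_cons_iff.2 ⟨fun h' => ?_, hβ⟩, rfl⟩
      exact Nat.pos_of_ne_zero fun h'' => h ⟨h', h''⟩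

/-- The words that arise by inserting a zero before one of the letters. -/
def zeroInsertions : List ℕ → List (List ℕ)
  | [] => []
  | a :: w => (0 :: a :: w) :: (zeroInsertions w).map (a :: ·)

theorem ne_nil_of_mem_zeroInsertions {w v : List ℕ} (hv : v ∈ zeroInsertions w) : v ≠ [] := by
  cases w with
  | nil => simp [zeroInsertions] at hv
  | cons a w =>
    simp only [zeroInsertions, List.mem_cons, List.mem_map] at hv
    rcases hv with rfl | ⟨_, _, rfl⟩ <;> simp

theorem IsLeftWeak.of_mem_zeroInsertions {w v : List ℕ} (hw : IsLeftWeak w)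
    (hv : v ∈ zeroInsertions w) : IsLeftWeak v := by
  induction w generalizing v with
  | nil => simp [zeroInsertions] at hv
  | cons a w ih =>
    simp only [zeroInsertions, List.mem_cons, List.mem_map] at hv
    rcases hv with rfl | ⟨v, hv, rfl⟩
    · exact isLeftWeak_cons_iff.2 ⟨by simp, hw⟩
    · exact isLeftWeak_cons_iff.2 ⟨fun h => absurd h (ne_nil_of_mem_zeroInsertions hv),
        ih (isLeftWeak_cons_iff.1 hw).2 hv⟩

theorem QS.of_cons_mul_of_zero {k : Type*} [CommRing k] (a : ℕ) (w : List ℕ) :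
    of k (a :: w) * of k [0] = cons a (of k w * of k [0]) + of k (0 :: a :: w) + of k (a :: w) := by
  rw [of_mul_of, of_mul_of, cons_sum_of, quasiShuffle]
  cases w <;> simp [quasiShuffle, add_assoc]

/-- The new zero is placed in one of the `j + 1` positions around the trailing zeros, or merged with
one of the `|β| + j` letters, which changes nothing, or inserted before a letter of `β`. Only the
first kind lengthens the block of trailing zeros. -/
theorem QS.of_append_replicate_mul_of_zero {k : Type*} [CommRing k] (β : List ℕ) (j : ℕ) :
    of k (β ++ List.replicate j 0) * of k [0] =
      (j + 1) • of k (β ++ List.replicate (j + 1) 0) +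
      (β.length + j) • of k (β ++ List.replicate j 0) +
      ((zeroInsertions β).map fun γ => of k (γ ++ List.replicate j 0)).sum := by
  induction β with
  | nil =>
    simp only [List.nil_append, zeroInsertions, List.map_nil, List.sum_nil, add_zero]
    induction j with
    | zero => simp [← one_def]
    | succ j ih =>
      rw [List.replicate_succ, of_cons_mul_of_zero, ih]
      simp only [map_add, map_nsmul, cons_of, ← List.replicate_succ, List.length_nil, zero_add,
        add_smul, one_smul]
      abel
  | cons a β ih =>
    rw [List.cons_append, of_cons_mul_of_zero, ih]
    simp only [map_add, map_nsmul, cons_of, map_list_sum, List.map_map, zeroInsertions,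
      List.map_cons, List.sum_cons, Function.comp_def, List.cons_append, List.length_cons, add_smul,
      one_smul]
    abel

/-- The homomorphism of algebras defined by a multiplicative function on words. -/
noncomputable def IsCharacter.algHom {k A B : Type*} [CommRing k] [AddCommSemigroup A] [CommRing B]
    [Algebra k B] {τ : List A → B} (hτ : IsCharacter τ) : QS k A →ₐ[k] B :=
  AlgHom.ofLinearMap ((QS.basis k A).constr k τ) (by
    rw [QS.one_def, QS.of, Module.Basis.constr_basis, hτ.nil]) fun x y => by
    have h (w : List A) : (QS.basis k A).constr k τ (QS.of k w) = τ w :=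
      (QS.basis k A).constr_basis k τ w
    induction x using QS.ind with
    | h0 => simp
    | hadd x x' h h' => simp only [map_add, add_mul, h, h']
    | hsmul c x h => simp only [map_smul, smul_mul_assoc, h]
    | hof u =>
      induction y using QS.ind with
      | h0 => simp
      | hadd x x' h h' => simp only [map_add, mul_add, h, h']
      | hsmul c x h => simp only [map_smul, mul_smul_comm, h]
      | hof v =>
        rw [QS.of_mul_of, map_list_sum, List.map_map, h, h, ← hτ.mul]
        congr 2
        funext w
        exact h w

theorem IsCharacter.algHom_of {k A B : Type*} [CommRing k] [AddCommSemigroup A] [CommRing B]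
    [Algebra k B] {τ : List A → B} (hτ : IsCharacter τ) (w : List A) :
    hτ.algHom (QS.of k w) = τ w :=
  (QS.basis k A).constr_basis k τ w

/-- In a vanishing combination take an index of minimal key in the support: its functional kills all
other terms. Units on the diagonal replace a field. -/
theorem linearIndependent_of_triangular {k ι M o : Type*} [CommRing k] [AddCommGroup M] [Module k M]
    [LinearOrder o] (key : ι → o) {v : ι → M} (φ : ι → M →ₗ[k] k)
    (h1 : ∀ i, IsUnit (φ i (v i))) (h2 : ∀ i j, j ≠ i → key i ≤ key j → φ i (v j) = 0) :
    LinearIndependent k v := by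
  rw [linearIndependent_iff]
  intro l hl
  by_contra hne
  obtain ⟨i, hi, hmin⟩ := Finset.exists_min_image l.support key
    (Finsupp.support_nonempty_iff.2 hne)
  have h := congrArg (φ i) hl
  rw [Finsupp.linearCombination_apply, Finsupp.sum, map_sum, map_zero,
    Finset.sum_eq_single_of_mem i hi, map_smul, smul_eq_mul, (h1 i).mul_left_eq_zero] at h
  · exact Finsupp.mem_support_iff.1 hi h
  · intro j hj hji
    rw [map_smul, h2 i j hji (hmin j hj), smul_zero]

/-! ### Linear independence of the monomial quasisymmetric functions -/

/-- The exponent of `x₁^{β₁} ⋯ xₙ^{βₙ}`. -/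
noncomputable def initialExponent (β : List ℕ) : ℕ+ →₀ ℕ :=
  xExponent β.get fun j => (j : ℕ).succPNat

theorem xExponent_apply {n : ℕ} (a : Fin n → ℕ) {I : Fin n → ℕ+} (hI : Function.Injective I)
    (j : Fin n) : xExponent a I (I j) = a j := by
  rw [xExponent, Finsupp.finsetSum_apply, Finset.sum_eq_single j]
  · simp
  · intro i _ hi
    exact Finsupp.single_eq_of_ne fun h => hi (hI h.symm)
  · simp

theorem exists_of_xExponent_ne_zero {n : ℕ} {a : Fin n → ℕ} {I : Fin n → ℕ+} {i : ℕ+}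
    (h : xExponent a I i ≠ 0) : ∃ j, I j = i := by
  rw [xExponent, Finsupp.finsetSum_apply] at h
  obtain ⟨j, -, hj⟩ := Finset.exists_ne_zero_of_sum_ne_zero h
  refine ⟨j, ?_⟩
  by_contra hne
  exact hj (Finsupp.single_eq_of_ne (Ne.symm hne))

theorem strictMono_succPNat_fin (n : ℕ) : StrictMono fun j : Fin n => (j : ℕ).succPNat :=
  fun i j h => by
    rw [← PNat.coe_lt_coe, Nat.succPNat_coe, Nat.succPNat_coe]
    exact Nat.succ_lt_succ h

/-- Shifted by one, `I` is a strictly increasing self-map of `Fin n`, hence the identity. -/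
theorem eq_succPNat_of_strictMono {n : ℕ} {I : Fin n → ℕ+} (hI : StrictMono I)
    (h : ∀ j, (I j : ℕ) ≤ n) (j : Fin n) : I j = (j : ℕ).succPNat := by
  let J : Fin n → Fin n := fun j => ⟨(I j : ℕ) - 1, by have := h j; have := (I j).pos; omega⟩
  have hJ : StrictMono J := fun i j hij => by
    have h1 : (I i : ℕ) < I j := hI hij
    have := (I i).pos
    change (I i : ℕ) - 1 < (I j : ℕ) - 1
    omega
  have h1 : J j = j := le_antisymm hJ.apply_le hJ.le_apply
  have h2 : (I j : ℕ) - 1 = j := congrArg Fin.val h1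
  have := (I j).pos
  rw [← PNat.coe_inj, Nat.succPNat_coe]
  omega

/-- The last letter of `γ` is positive, so its variable divides the monomial and all indices are at
most `|β|`. With `|γ| ≥ |β|` the indices must be `1, …, |β|`, and the exponents can be compared. -/
theorem occurrence_initialExponent {β γ : List ℕ} (hγ : IsLeftWeak γ) (h : β.length ≤ γ.length)
    (I : Occurrence γ.get (initialExponent β)) :
    γ = β ∧ ∀ j, I.1 j = (j : ℕ).succPNat := by
  obtain ⟨I, hI, hm⟩ := I
  simp only
  have hle (j) : (I j : ℕ) ≤ β.length := by
    have hpos : 0 < γ.length := j.pos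
    let l : Fin γ.length := ⟨γ.length - 1, by omega⟩
    have h1 : I j ≤ I l := hI.monotone (by rw [Fin.le_def]; have := j.2; simp only [l]; omega)
    have h2 : 0 < γ.get l := hγ _ (by
      rw [Option.mem_def, List.getLast?_eq_getElem?]
      exact (List.getElem?_eq_some_iff.2 ⟨l.2, rfl⟩))
    have h3 := xExponent_apply γ.get hI.injective l
    rw [hm] at h3
    obtain ⟨i, hi⟩ := exists_of_xExponent_ne_zero (h3.trans_ne h2.ne')
    have h4 : (I l : ℕ) ≤ β.length := by
      rw [← hi, Nat.succPNat_coe]; exact i.2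
    exact le_trans h1 h4
  have hIj := eq_succPNat_of_strictMono hI fun j => (hle j).trans h
  refine ⟨?_, hIj⟩
  have hlen : γ.length = β.length := by
    rcases Nat.eq_zero_or_pos γ.length with h0 | h0
    · omega
    · have h1 := hle ⟨γ.length - 1, by omega⟩
      rw [hIj, Nat.succPNat_coe] at h1
      simp only at h1
      omega
  refine List.ext_get hlen fun n h1 h2 => ?_
  have h3 := xExponent_apply γ.get hI.injective ⟨n, h1⟩
  have h4 := xExponent_apply β.get (strictMono_succPNat_fin _).injective ⟨n, h2⟩
  rw [hm, hIj] at h3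
  exact h3.symm.trans h4

theorem coeff_initialExponent_monomialQSym_self (k : Type*) [CommRing k] {β : List ℕ}
    (hβ : IsLeftWeak β) : MvPowerSeries.coeff (initialExponent β) (monomialQSym k β) = 1 := by
  have : Nat.card (Occurrence β.get (initialExponent β)) = 1 := by
    rw [Nat.card_eq_one_iff_unique]
    refine ⟨⟨fun I J => Subtype.ext (funext fun j => ?_)⟩,
      ⟨⟨fun j => (j : ℕ).succPNat, strictMono_succPNat_fin _, rfl⟩⟩⟩
    rw [(occurrence_initialExponent hβ le_rfl I).2, (occurrence_initialExponent hβ le_rfl J).2]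
  change ((Nat.card (Occurrence β.get (initialExponent β)) : ℕ) : k) = 1
  rw [this, Nat.cast_one]

theorem coeff_initialExponent_monomialQSym_of_ne (k : Type*) [CommRing k] {β γ : List ℕ}
    (hγ : IsLeftWeak γ) (h : β.length ≤ γ.length) (hne : γ ≠ β) :
    MvPowerSeries.coeff (initialExponent β) (monomialQSym k γ) = 0 := by
  have : IsEmpty (Occurrence γ.get (initialExponent β)) :=
    ⟨fun I => hne (occurrence_initialExponent hγ h I).1⟩
  change ((Nat.card (Occurrence γ.get (initialExponent β)) : ℕ) : k) = 0
  rw [Nat.card_of_isEmpty, Nat.cast_zero]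

/-! ### Multiplication by `-(t + c)` and degrees in `t` -/

section polynomial
variable {S : Type*} [CommRing S] (c : S) {p : Polynomial S} {j : ℕ}

theorem coeff_neg_X_add_C_mul (hp : p.natDegree ≤ j) :
    (-(Polynomial.X + Polynomial.C c) * p).coeff (j + 1) = -p.coeff j := by
  rw [neg_mul, add_mul, Polynomial.coeff_neg, Polynomial.coeff_add, Polynomial.coeff_X_mul,
    Polynomial.coeff_C_mul, Polynomial.coeff_eq_zero_of_natDegree_lt (by omega : _ < j + 1),
    mul_zero, add_zero]

theorem natDegree_neg_X_add_C_mul_le (hp : p.natDegree ≤ j) :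
    (-(Polynomial.X + Polynomial.C c) * p).natDegree ≤ j + 1 := by
  refine Polynomial.natDegree_mul_le.trans ?_
  have h : (-(Polynomial.X + Polynomial.C c)).natDegree ≤ 1 := by
    rw [Polynomial.natDegree_neg]
    exact (Polynomial.natDegree_add_C).le.trans Polynomial.natDegree_X_le
  omega

end polynomial

/-! ### The structure of the renormalized quasisymmetric functions -/

section structure_theory
variable (k : Type*) [CommRing k] [Algebra ℚ k] (δ : ℕ+)

/-- The homomorphism of algebras `α ↦ M_α`. -/
noncomputable def renHom : QS k ℕ →ₐ[k] PowerSeriesT k := (isCharacter_renMonomial k δ).algHom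

theorem renHom_of (α : List ℕ) : renHom k δ (QS.of k α) = renMonomial k δ α :=
  (isCharacter_renMonomial k δ).algHom_of α

/-- The product with the word `(0)`, solved for the only term with one more trailing zero; this
drives the induction on the number of trailing zeros. -/
theorem renMonomial_append_replicate_succ (β : List ℕ) (j : ℕ) :
    ((j : k) + 1) • renMonomial k δ (β ++ List.replicate (j + 1) 0) =
      renMonomial k δ [0] * renMonomial k δ (β ++ List.replicate j 0) -
      (β.length + j) • renMonomial k δ (β ++ List.replicate j 0) -
      ((zeroInsertions β).map fun γ => renMonomial k δ (γ ++ List.replicate j 0)).sum := by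
  have h := congrArg (renHom k δ) (QS.of_append_replicate_mul_of_zero (k := k) β j)
  simp only [map_mul, map_add, map_nsmul, map_list_sum, List.map_map, Function.comp_def,
    renHom_of] at h
  rw [mul_comm, h, ← Nat.cast_succ, Nat.cast_smul_eq_nsmul]
  abel

/-- The algebra of left weak quasisymmetric functions. -/
noncomputable def lwSubalgebra : Subalgebra k (MvPowerSeries ℕ+ k) :=
  (LWQSym k).toSubalgebra
    (Submodule.subset_span ⟨[], by simp [IsLeftWeak], by
      have h := (isCharacter_renMonomial k 1).nil
      rw [renMonomial_of_isLeftWeak k 1 (by simp [IsLeftWeak]), ← map_one Polynomial.C] at h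
      exact (Polynomial.C_injective h).symm⟩)
    fun x y hx hy => by
      refine Submodule.span_induction₂ (p := fun x y _ _ => x * y ∈ LWQSym k) ?_ ?_ ?_ ?_ ?_ ?_ ?_ hx hy
      · rintro _ _ ⟨α, hα, rfl⟩ ⟨β, hβ, rfl⟩
        -- The product formula is taken from `k[[X]][t]`: for left weak words the renormalized
        -- functions are constants in `t`, and quasi-shuffles of left weak words are left weak.
        have h := (isCharacter_renMonomial k 1).mul α β
        rw [renMonomial_of_isLeftWeak k 1 hα, renMonomial_of_isLeftWeak k 1 hβ, ← map_mul,
          List.map_congr_left fun w hw =>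
            renMonomial_of_isLeftWeak k 1 (hα.of_mem_quasiShuffle hβ hw)] at h
        rw [show (fun w => Polynomial.C (monomialQSym k w)) =
          Polynomial.C ∘ monomialQSym k from rfl, ← List.map_map, ← map_list_sum] at h
        rw [← Polynomial.C_injective h]
        refine list_sum_mem fun F hF => ?_
        obtain ⟨w, hw, rfl⟩ := List.mem_map.1 hF
        exact Submodule.subset_span ⟨w, hα.of_mem_quasiShuffle hβ hw, rfl⟩
      · intro y _; rw [zero_mul]; exact zero_mem _
      · intro y _; rw [mul_zero]; exact zero_mem _
      · intro x y z _ _ _ h1 h2; rw [add_mul]; exact add_mem h1 h2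
      · intro x y z _ _ _ h1 h2; rw [mul_add]; exact add_mem h1 h2
      · intro r x y _ _ h; rw [smul_mul_assoc]; exact Submodule.smul_mem _ _ h
      · intro r x y _ _ h; rw [mul_smul_comm]; exact Submodule.smul_mem _ _ h

theorem monomialQSym_mem_lwSubalgebra {β : List ℕ} (hβ : IsLeftWeak β) :
    monomialQSym k β ∈ lwSubalgebra k :=
  Submodule.subset_span ⟨β, hβ, rfl⟩

/-- The algebra of polynomials in `t` over the left weak quasisymmetric functions. -/
noncomputable abbrev lwPolynomials : Subalgebra k (PowerSeriesT k) :=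
  (Polynomial.mapAlgHom (lwSubalgebra k).val).range

theorem C_mem_lwPolynomials {F : MvPowerSeries ℕ+ k} (hF : F ∈ lwSubalgebra k) :
    Polynomial.C F ∈ lwPolynomials k :=
  ⟨Polynomial.C ⟨F, hF⟩, by simp⟩

theorem X_mem_lwPolynomials : Polynomial.X ∈ lwPolynomials k := ⟨Polynomial.X, by simp⟩

theorem C_C_mem_lwSubalgebra (r : k) : MvPowerSeries.C r ∈ lwSubalgebra k := by
  have h := (lwSubalgebra k).algebraMap_mem r
  rwa [MvPowerSeries.algebraMap_apply] at h

theorem isUnit_natCast_add_one (j : ℕ) : IsUnit ((j : k) + 1) := by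
  have h : ((j : k) + 1) = algebraMap ℚ k (j + 1) := by simp
  rw [h]
  exact (IsUnit.mk0 _ (by positivity)).map _

/-- In the recursion only the product with `M_(0) = -(t + 1/2)` reaches degree `j + 1`; the inserted
words keep `j` trailing zeros after a left weak word. The unit picks up `-1/(j + 1)` at each step,
so it is `(-1)^j/j!`. -/
theorem renMonomial_append_replicate_spec {β : List ℕ} (hβ : IsLeftWeak β) (j : ℕ) :
    renMonomial k δ (β ++ List.replicate j 0) ∈ lwPolynomials k ∧
    (renMonomial k δ (β ++ List.replicate j 0)).natDegree ≤ j ∧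
    ∃ u : kˣ, (renMonomial k δ (β ++ List.replicate j 0)).coeff j = u • monomialQSym k β := by
  induction j generalizing β with
  | zero =>
    rw [List.replicate_zero, List.append_nil, renMonomial_of_isLeftWeak k δ hβ]
    refine ⟨C_mem_lwPolynomials k (monomialQSym_mem_lwSubalgebra k hβ), by simp, 1, by simp⟩
  | succ j ih =>
    obtain ⟨v, hv⟩ := isUnit_natCast_add_one k j
    have h := renMonomial_append_replicate_succ k δ β j
    rw [← hv, ← Units.smul_def, ← eq_inv_smul_iff] at h
    obtain ⟨h1, h2, u, hu⟩ := ih hβ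
    have hz : ∀ p ∈ (zeroInsertions β).map fun γ => renMonomial k δ (γ ++ List.replicate j 0),
        p ∈ lwPolynomials k ∧ p.natDegree ≤ j := fun p hp => by
      obtain ⟨γ, hγ, rfl⟩ := List.mem_map.1 hp
      exact ⟨(ih (hβ.of_mem_zeroInsertions hγ)).1, (ih (hβ.of_mem_zeroInsertions hγ)).2.1⟩
    generalize (zeroInsertions β).map (fun γ => renMonomial k δ (γ ++ List.replicate j 0)) = l at h hz
    generalize renMonomial k δ (β ++ List.replicate j 0) = p at h h1 h2 hu
    have hl1 : l.sum ∈ lwPolynomials k := list_sum_mem fun p hp => (hz p hp).1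
    have hl2 : l.sum ∈ Polynomial.degreeLE (MvPowerSeries ℕ+ k) j :=
      list_sum_mem fun p hp =>
        Polynomial.mem_degreeLE.2 (Polynomial.natDegree_le_iff_degree_le.1 (hz p hp).2)
    rw [Polynomial.mem_degreeLE, ← Polynomial.natDegree_le_iff_degree_le] at hl2
    rw [h, renMonomial_zero]
    refine ⟨?_, ?_, -(v⁻¹ * u), ?_⟩
    · rw [Units.smul_def]
      refine Subalgebra.smul_mem _ (sub_mem (sub_mem (mul_mem (neg_mem (add_mem
        (X_mem_lwPolynomials k) (C_mem_lwPolynomials k (C_C_mem_lwSubalgebra k _)))) h1)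
        (nsmul_mem h1 _)) hl1) _
    · refine (Polynomial.natDegree_smul_le _ _).trans ((Polynomial.natDegree_sub_le_of_le
        (Polynomial.natDegree_sub_le_of_le (natDegree_neg_X_add_C_mul_le _ h2)
          (Polynomial.natDegree_smul_le _ _)) le_rfl).trans ?_)
      omega
    · have h3 : p.coeff (j + 1) = 0 := Polynomial.coeff_eq_zero_of_natDegree_lt (by omega)
      have h4 : l.sum.coeff (j + 1) = 0 := Polynomial.coeff_eq_zero_of_natDegree_lt (by omega)
      rw [Polynomial.coeff_smul, Polynomial.coeff_sub, Polynomial.coeff_sub, Polynomial.coeff_smul,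
        h3, h4, smul_zero, sub_zero, sub_zero, coeff_neg_X_add_C_mul _ h2, hu, Units.neg_smul,
        smul_neg, mul_smul]

end structure_theory

/-! ### Transport of Hopf algebra structures -/

section transport
variable {k A B : Type*} [CommRing k] [Ring A] [HopfAlgebra k A] [Semiring B] [Algebra k B]
  (f : A ≃ₐ[k] B)

/-- The transport of a comultiplication. -/
noncomputable def AlgEquiv.transportComul : B →ₐ[k] B ⊗[k] B :=
  ((Algebra.TensorProduct.map (f : A →ₐ[k] B) (f : A →ₐ[k] B)).comp
    (Bialgebra.comulAlgHom k A)).comp (f.symm : B →ₐ[k] A)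

/-- The transport of a counit. -/
noncomputable def AlgEquiv.transportCounit : B →ₐ[k] k :=
  (Bialgebra.counitAlgHom k A).comp (f.symm : B →ₐ[k] A)

theorem AlgEquiv.transportComul_apply (a : A) : f.transportComul (f a) =
    TensorProduct.map f.toLinearMap f.toLinearMap (Coalgebra.comul a) := by
  simp [AlgEquiv.transportComul]
  rfl

theorem AlgEquiv.transportCounit_apply (a : A) :
    f.transportCounit (f a) = Coalgebra.counit (R := k) a := by
  simp [AlgEquiv.transportCounit]

/-- The transport of a Hopf algebra structure along an isomorphism of algebras. -/
noncomputable abbrev AlgEquiv.transportHopfAlgebra : HopfAlgebra k B :=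
  letI : Bialgebra k B := Bialgebra.ofAlgHom f.transportComul f.transportCounit
    (by
      ext b
      obtain ⟨a, rfl⟩ := f.surjective b
      -- Both sides of coassociativity are written as images under `f ⊗ f ⊗ f`. A second induction
      -- on tensors is needed because the coproduct of a pure factor is not a pure tensor.
      have h1 (p : A ⊗[k] A) : Algebra.TensorProduct.assoc k k k B B B
          (Algebra.TensorProduct.map f.transportComul (AlgHom.id k B)
            (TensorProduct.map f.toLinearMap f.toLinearMap p)) =
          TensorProduct.map f.toLinearMap (TensorProduct.map f.toLinearMap f.toLinearMap)
            (TensorProduct.assoc k A A A (Coalgebra.comul.rTensor A p)) := by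
        induction p using TensorProduct.induction_on with
        | zero => simp
        | add p q hp hq => simp only [map_add, hp, hq]
        | tmul x y =>
          simp only [TensorProduct.map_tmul, Algebra.TensorProduct.map_tmul, AlgEquiv.toLinearMap_apply,
            AlgEquiv.transportComul_apply, LinearMap.rTensor_tmul]
          generalize (Coalgebra.comul x : A ⊗[k] A) = q
          induction q using TensorProduct.induction_on with
          | zero => simp
          | add p q hp hq => simp only [map_add, TensorProduct.add_tmul, hp, hq]
          | tmul x y => simp
      have h2 (p : A ⊗[k] A) : Algebra.TensorProduct.map (AlgHom.id k B) f.transportComul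
            (TensorProduct.map f.toLinearMap f.toLinearMap p) =
          TensorProduct.map f.toLinearMap (TensorProduct.map f.toLinearMap f.toLinearMap)
            (Coalgebra.comul.lTensor A p) := by
        induction p using TensorProduct.induction_on with
        | zero => simp
        | add p q hp hq => simp only [map_add, hp, hq]
        | tmul x y =>
          simp only [TensorProduct.map_tmul, Algebra.TensorProduct.map_tmul, AlgEquiv.toLinearMap_apply,
            AlgEquiv.transportComul_apply, LinearMap.lTensor_tmul]
          rfl
      have h3 := congrArg (TensorProduct.map f.toLinearMap
        (TensorProduct.map f.toLinearMap f.toLinearMap)) (Coalgebra.coassoc_apply (R := k) a)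
      rw [← h1, ← h2, ← AlgEquiv.transportComul_apply] at h3
      exact h3)
    (by
      ext b
      obtain ⟨a, rfl⟩ := f.surjective b
      have h1 (p : A ⊗[k] A) : Algebra.TensorProduct.map f.transportCounit (AlgHom.id k B)
            (TensorProduct.map f.toLinearMap f.toLinearMap p) =
          TensorProduct.map LinearMap.id f.toLinearMap (Coalgebra.counit.rTensor A p) := by
        induction p using TensorProduct.induction_on with
        | zero => simp
        | add p q hp hq => simp only [map_add, hp, hq]
        | tmul x y => simp [AlgEquiv.transportCounit_apply]
      have h3 := h1 (Coalgebra.comul a)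
      rw [Coalgebra.rTensor_counit_comul, ← AlgEquiv.transportComul_apply] at h3
      exact h3)
    (by
      ext b
      obtain ⟨a, rfl⟩ := f.surjective b
      have h1 (p : A ⊗[k] A) : Algebra.TensorProduct.map (AlgHom.id k B) f.transportCounit
            (TensorProduct.map f.toLinearMap f.toLinearMap p) =
          TensorProduct.map f.toLinearMap LinearMap.id (Coalgebra.counit.lTensor A p) := by
        induction p using TensorProduct.induction_on with
        | zero => simp
        | add p q hp hq => simp only [map_add, hp, hq]
        | tmul x y => simp [AlgEquiv.transportCounit_apply]
      have h3 := h1 (Coalgebra.comul a)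
      rw [Coalgebra.lTensor_counit_comul, ← AlgEquiv.transportComul_apply] at h3
      exact h3)
  have hmul (S T : A →ₗ[k] A) (p : A ⊗[k] A) :
      LinearMap.mul' k B (TensorProduct.map (f.toLinearMap ∘ₗ S ∘ₗ f.symm.toLinearMap)
        (f.toLinearMap ∘ₗ T ∘ₗ f.symm.toLinearMap)
        (TensorProduct.map f.toLinearMap f.toLinearMap p)) =
      f (LinearMap.mul' k A (TensorProduct.map S T p)) := by
    induction p using TensorProduct.induction_on with
    | zero => simp
    | add p q hp hq => simp only [map_add, hp, hq]
    | tmul x y => simp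
  have hid : f.toLinearMap ∘ₗ LinearMap.id ∘ₗ f.symm.toLinearMap = LinearMap.id := by
    ext; simp
  { antipode := f.toLinearMap ∘ₗ HopfAlgebra.antipode k ∘ₗ f.symm.toLinearMap
    mul_antipode_rTensor_comul := by
      ext b
      obtain ⟨a, rfl⟩ := f.surjective b
      have h := hmul (HopfAlgebra.antipode k) LinearMap.id (Coalgebra.comul a)
      rw [hid, ← AlgEquiv.transportComul_apply] at h
      refine h.trans ?_
      refine (congrArg f (HopfAlgebra.mul_antipode_rTensor_comul_apply (R := k) a)).trans ?_
      rw [f.commutes, ← f.transportCounit_apply]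
      rfl
    mul_antipode_lTensor_comul := by
      ext b
      obtain ⟨a, rfl⟩ := f.surjective b
      have h := hmul LinearMap.id (HopfAlgebra.antipode k) (Coalgebra.comul a)
      rw [hid, ← AlgEquiv.transportComul_apply] at h
      refine h.trans ?_
      refine (congrArg f (HopfAlgebra.mul_antipode_lTensor_comul_apply (R := k) a)).trans ?_
      rw [f.commutes, ← f.transportCounit_apply]
      rfl }

theorem AlgEquiv.isHopfIso_transport {B : Type*} [Ring B] [Algebra k B] (f : A ≃ₐ[k] B) :
    letI := f.transportHopfAlgebra
    IsHopfIso k f := by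
  let _ := f.transportHopfAlgebra
  refine ⟨BialgEquiv.ofAlgEquiv f ?_ ?_, fun x => rfl⟩
  · ext a
    exact f.transportCounit_apply a
  · ext a
    exact (f.transportComul_apply a).symm

theorem Subalgebra.exists_isHopfIso {P : Type*} [CommRing P] [Algebra k P] (R : Subalgebra k P)
    (f : A ≃ₐ[k] R) : ∃ H : HopfAlgebra k R, H.toAlgebra = R.algebra ∧ IsHopfIso k f :=
  ⟨f.transportHopfAlgebra, rfl, AlgEquiv.isHopfIso_transport f⟩

end transport

/-! ### Linear independence, and the image of `α ↦ M_α` -/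

section structure_theory
variable (k : Type*) [CommRing k] [Algebra ℚ k] (δ : ℕ+)

theorem linearIndependent_renMonomial : LinearIndependent k (renMonomial k δ) := by
  choose core nz hcore heq using exists_isLeftWeak_append_replicate
  have hspec (w : List ℕ) := renMonomial_append_replicate_spec k δ (hcore w) (nz w)
  simp only [← heq] at hspec
  -- Words are ordered by decreasing number of trailing zeros, then by the length of the left weak
  -- core. The functional of `w` takes the coefficient of the top power of `t` and then of the
  -- initial monomial of the core: fewer zeros fail by degree, and equally many zeros with a core at
  -- least as long fail by `occurrence_initialExponent`.
  refine linearIndependent_of_triangular (o := ℕᵒᵈ ×ₗ ℕ)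
    (fun w => toLex (OrderDual.toDual (nz w), (core w).length))
    (fun w => MvPowerSeries.coeff (initialExponent (core w)) ∘ₗ
      (Polynomial.lcoeff (MvPowerSeries ℕ+ k) (nz w)).restrictScalars k) (fun w => ?_)
    fun w v hne hle => ?_
  · obtain ⟨-, -, u, hu⟩ := hspec w
    simp only [LinearMap.comp_apply, LinearMap.coe_restrictScalars, Polynomial.lcoeff_apply, hu,
      Units.smul_def, map_smul, coeff_initialExponent_monomialQSym_self k (hcore w), smul_eq_mul,
      mul_one]
    exact u.isUnit
  · obtain ⟨-, hdeg, u, hu⟩ := hspec v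
    simp only [LinearMap.comp_apply, LinearMap.coe_restrictScalars, Polynomial.lcoeff_apply]
    rcases (Prod.Lex.toLex_le_toLex).1 hle with h | ⟨h, h'⟩
    · have h : nz v < nz w := h
      rw [Polynomial.coeff_eq_zero_of_natDegree_lt (by omega), map_zero]
    · have h : nz w = nz v := h
      rw [h, hu, Units.smul_def, map_smul, coeff_initialExponent_monomialQSym_of_ne k (hcore v) h',
        smul_zero]
      intro hc
      exact hne (by rw [heq v, heq w, hc, h])

theorem renMonomial_mem_lwPolynomials (w : List ℕ) : renMonomial k δ w ∈ lwPolynomials k := by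
  obtain ⟨β, j, hβ, rfl⟩ := exists_isLeftWeak_append_replicate w
  exact (renMonomial_append_replicate_spec k δ hβ j).1

theorem toSubmodule_range_renHom : Subalgebra.toSubmodule (renHom k δ).range = RenQSym k δ := by
  refine le_antisymm ?_ (Submodule.span_le.2 ?_)
  · rintro _ ⟨x, rfl⟩
    change renHom k δ x ∈ _
    induction x using QS.ind with
    | h0 => rw [map_zero]; exact zero_mem _
    | hadd x y hx hy => rw [map_add]; exact add_mem hx hy
    | hsmul c x hx => rw [map_smul]; exact Submodule.smul_mem _ _ hx
    | hof w => rw [renHom_of]; exact Submodule.subset_span ⟨w, rfl⟩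
  · rintro _ ⟨w, rfl⟩
    exact ⟨QS.of k w, renHom_of k δ w⟩

/-- The constants `LWQSym` are the images of left weak words, and `t` is obtained from `M_(0)` after
removing the constant 1/2; these generate everything. -/
theorem range_renHom : (renHom k δ).range = lwPolynomials k := by
  refine le_antisymm ?_ ?_
  · refine Subalgebra.toSubmodule.le_iff_le.1 ?_
    rw [toSubmodule_range_renHom]
    refine Submodule.span_le.2 ?_
    rintro _ ⟨w, rfl⟩
    exact renMonomial_mem_lwPolynomials k δ w
  · have hC (F : MvPowerSeries ℕ+ k) (hF : F ∈ LWQSym k) :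
        Polynomial.C F ∈ (renHom k δ).range := by
      induction hF using Submodule.span_induction with
      | mem F hF =>
        obtain ⟨β, hβ, rfl⟩ := hF
        exact ⟨QS.of k β, (renHom_of k δ β).trans (renMonomial_of_isLeftWeak k δ hβ)⟩
      | zero => rw [map_zero]; exact zero_mem _
      | add F G _ _ hF hG => rw [map_add]; exact add_mem hF hG
      | smul c F _ hF => rw [← Polynomial.smul_C]; exact Subalgebra.smul_mem _ hF c
    have hX : Polynomial.X ∈ (renHom k δ).range := by
      have h : renMonomial k δ [0] ∈ (renHom k δ).range := ⟨_, renHom_of k δ [0]⟩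
      rw [renMonomial_zero, neg_mem_iff] at h
      exact (add_mem_cancel_right (hC _ (C_C_mem_lwSubalgebra k _))).1 h
    rintro _ ⟨p, rfl⟩
    change Polynomial.mapAlgHom (lwSubalgebra k).val p ∈ _
    induction p using Polynomial.induction_on' with
    | add p q hp hq => rw [map_add]; exact add_mem hp hq
    | monomial n a =>
      rw [Polynomial.coe_mapAlgHom, Polynomial.map_monomial, ← Polynomial.C_mul_X_pow_eq_monomial]
      exact mul_mem (hC _ a.2) (pow_mem hX n)

theorem renHom_injective : Function.Injective (renHom k δ) := by
  have h : (renHom k δ).toLinearMap = Finsupp.linearCombination k (renMonomial k δ) ∘ₗ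
      (QS.basis k ℕ).repr.toLinearMap :=
    (QS.basis k ℕ).ext fun w => by
      simp only [LinearMap.comp_apply, LinearEquiv.coe_coe, Module.Basis.repr_self,
        Finsupp.linearCombination_single, one_smul]
      exact renHom_of k δ w
  have h' : Function.Injective (renHom k δ).toLinearMap := by
    rw [h]
    exact Function.Injective.comp (linearIndependent_renMonomial k δ) (QS.basis k ℕ).repr.injective
  exact h'

end structure_theory

theorem mainTheorem4 (k : Type*) [CommRing k] [Nontrivial k] [Algebra ℚ k] (δ : ℕ+) :
    -- the regularization is well defined, and `M_α` does not depend on the direction `δ`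
    (∀ w : List (ℕ × ℕ+), ∃! F : LaurentSeries (PowerSeriesT ℚ), IsRegularization w F) ∧
    (∀ (δ' : ℕ+) (α : List ℕ), renMonomial k δ α = renMonomial k δ' α) ∧
    -- (1) the `M_α` form a basis of `RenQSym`
    (∃ b : Module.Basis (List ℕ) k (RenQSym k δ),
      ∀ α, (b α : PowerSeriesT k) = renMonomial k δ α) ∧
    -- (2) `LWQSym` and `RenQSym` are subalgebras `L` and `R`, with `R = L[t]`, and
    -- `α ↦ M_α` is an algebra isomorphism from `QS(ℕ)` onto `R`
    ∃ (L : Subalgebra k (MvPowerSeries ℕ+ k)) (R : Subalgebra k (PowerSeriesT k)),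
      Subalgebra.toSubmodule L = LWQSym k ∧
      Subalgebra.toSubmodule R = RenQSym k δ ∧
      R = (Polynomial.mapAlgHom L.val).range ∧
      ∃ f : QS k ℕ ≃ₐ[k] R,
        (∀ α : List ℕ, (f (QS.of k α) : PowerSeriesT k) = renMonomial k δ α) ∧
        -- the Hopf algebra structure that `R` receives from `QS(ℕ)`
        ∃ H : HopfAlgebra k R, H.toAlgebra = R.algebra ∧ IsHopfIso k f := by
  refine ⟨existsUnique_isRegularization, renMonomial_direction k δ,
    ⟨Module.Basis.span (linearIndependent_renMonomial k δ), fun α => ?_⟩,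
    lwSubalgebra k, (renHom k δ).range, ?_, toSubmodule_range_renHom k δ, range_renHom k δ,
    AlgEquiv.ofInjective (renHom k δ) (renHom_injective k δ), fun α => ?_,
    Subalgebra.exists_isHopfIso _ _⟩
  · exact congrArg Subtype.val (Module.Basis.span_apply (linearIndependent_renMonomial k δ) α)
  · exact Submodule.toSubalgebra_toSubmodule _ _ _
  · exact renHom_of k δ α
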